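/- Write $\mathcal S=\mathcal S(\mathbb R^n)$ and $\mathcal S'=\mathcal S'(\mathbb R^n)$ for the spaces of Schwartz functions and of tempered distributions, and set $T_xf(t)=f(t-x)$, $M_\xi f(t)=e^{2\pi i\xi\cdot t}f(t)$ for $f\in\mathcal S'$, $x,\xi\in\mathbb R^n$. A complex Banach space $E$ is a translation-modulation invariant Banach space of distributions (TMIB) on $\mathbb R^n$ if there are dense continuous inclusions $\mathcal S\hookrightarrow E\hookrightarrow\mathcal S'$, if $T_x(E)\subseteq E$ and $M_\xi(E)\subseteq E$ for all $x,\xi\in\mathbb R^n$, and if there are $C_0,C_1,\tau_0,\tau_1>0$ with $\|T_x\|_{\mathcal L(E)}\le C_0(1+|x|)^{\tau_0}$ and $\|M_\xi\|_{\mathcal L(E)}\le C_1(1+|\xi|)^{\tau_1}$ for all $x,\xi\in\mathbb R^n$. A DTMIB is the strong dual of a TMIB, regarded as a subspace of $\mathcal S'$ by restricting functionals to $\mathcal S$. Let $E$ be a TMIB or a DTMIB on $\mathbb R^n$. Let $$\mathcal D_E=\{f\in\mathcal S' : f^{(\alpha)}\in E\ \text{ for all }\alpha\in\mathbb N^n\}$$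 with the topology generated by the norms $\sup_{|\alpha|\le N}\|f^{(\alpha)}\|_E$, $N\in\mathbb N$, and let $$\mathcal D'_E=\{f\in\mathcal S' : f*\varphi\in E\ \text{ for all }\varphi\in\mathcal S\}$$ with the topology induced by the embedding $f\mapsto(\varphi\mapsto f*\varphi)$ into the space $\mathcal L_b(\mathcal S,E)$ of continuous linear maps with the topology of uniform convergence on bounded sets. Let $U$ be a bounded open neighbourhood of $0$ in $\mathbb R^n$ such that the sets $k+U$, $k\in\mathbb Z^n$, are pairwise disjoint, and let $\chi\ne0$ be a smooth function with compact support contained in $U$. The discrete space associated to $E$ is $$E_d=\Big\{c\in\mathbb C^{\mathbb Z^n} : S_\chi(c)=\sum_{k\in\mathbb Z^n}c_k\,T_k\chi\in E\Big\},\qquad \|c\|_{E_d}=\|S_\chi(c)\|_E .$$ For $w:\mathbb Z^n\to(0,\infty)$ let $\ell^\infty_w$ be the space of all $c\in\mathbb C^{\mathbb Z^n}$ with $\|c\|=\sup_k|c_k|w(k)<\infty$. Let $s=\varprojlim_{N}\ell^\infty_{(1+|\cdot|)^N}$ and $s'=\varinjlim_N\ell^\infty_{(1+|\cdot|)^{-N}}$,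 as a projective and an inductive limit of locally convex spaces. Then there are isomorphisms of topological vector spaces $$\mathcal D_E\cong E_d\,\widehat\otimes\,s\qquad\text{and}\qquad \mathcal D'_E\cong E_d\,\widehat\otimes\,s',$$ where in each of the two the completed tensor product may be taken with respect to the projective ($\pi$-) topology as well as with respect to the injective ($\varepsilon$-) topology. -/

import Mathlib

open SchwartzMap TensorProduct
open scoped ENNReal

noncomputable section

/-! ### Tempered distributions on `ℝⁿ` and the operations on them -/

/-- The Euclidean space `ℝⁿ`. -/
abbrev Rn (n : ℕ) : Type := EuclideanSpace ℝ (Fin n)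

/-- The lattice point of `ℝⁿ` with integer coordinates `k`. -/
def latticePt {n : ℕ} (k : Fin n → ℤ) : Rn n := WithLp.toLp 2 fun i => (k i : ℝ)

/-- The tempered distribution `ψ ↦ ∫ φ ψ` defined by a Schwartz function `φ`. -/
def schwartzToDist {n : ℕ} : 𝓢(Rn n, ℂ) →L[ℂ] 𝓢'(Rn n, ℂ) :=
  SchwartzMap.toTemperedDistributionCLM (Rn n) ℂ MeasureTheory.volume

theorem schwartzToDist_apply {n : ℕ} (φ ψ : 𝓢(Rn n, ℂ)) :
    schwartzToDist φ ψ = ∫ x, ψ x * φ x := by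
  simp [schwartzToDist]

/-- Translation of Schwartz functions, `(T_x φ)(t) = φ (t - x)`. -/
def translateS {n : ℕ} (x : Rn n) : 𝓢(Rn n, ℂ) →L[ℂ] 𝓢(Rn n, ℂ) :=
  SchwartzMap.compSubConstCLM ℂ x

theorem translateS_apply {n : ℕ} (x : Rn n) (φ : 𝓢(Rn n, ℂ)) (t : Rn n) :
    translateS x φ t = φ (t - x) := rfl

/-- The character `t ↦ e^{2 π i ξ · t}`. -/
def character {n : ℕ} (ξ : Rn n) (t : Rn n) : ℂ :=
  Complex.exp (2 * Real.pi * Complex.I * (inner ℝ ξ t : ℝ))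

theorem character_hasTemperateGrowth {n : ℕ} (ξ : Rn n) :
    (character ξ).HasTemperateGrowth := by
  have key : (fun t : ℝ => Complex.exp (2 * Real.pi * Complex.I * (t : ℂ))).HasTemperateGrowth := by
    set c : ℂ := 2 * Real.pi * Complex.I with hc
    have hder : ∀ m : ℕ, iteratedDeriv m (fun t : ℝ => Complex.exp (c * (t : ℂ)))
        = fun t : ℝ => c ^ m * Complex.exp (c * (t : ℂ)) := by
      intro m
      induction m with
      | zero => simp
      | succ m ih =>
        rw [iteratedDeriv_succ, ih]
        funext t
        have h1 : HasDerivAt (fun t : ℝ => c * (t : ℂ)) (c * 1) t :=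
          (Complex.ofRealCLM.hasDerivAt (x := t)).const_mul c
        have h2 := (h1.cexp).const_mul (c ^ m)
        rw [h2.deriv]
        ring
    refine ⟨(contDiff_const.mul Complex.ofRealCLM.contDiff).cexp, fun m => ⟨0, ‖c‖ ^ m, fun t => ?_⟩⟩
    rw [norm_iteratedFDeriv_eq_norm_iteratedDeriv, hder m]
    have h3 : ‖Complex.exp (c * (t : ℂ))‖ = 1 := by
      rw [hc, Complex.norm_exp]
      simp
    simp [h3]
  exact key.comp (Function.hasTemperateGrowth_inner_right ξ)

/-- Modulation of Schwartz functions, `(M_ξ φ)(t) = e^{2 π i ξ · t} φ t`. -/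
def modulateS {n : ℕ} (ξ : Rn n) : 𝓢(Rn n, ℂ) →L[ℂ] 𝓢(Rn n, ℂ) :=
  SchwartzMap.smulLeftCLM ℂ (character ξ)

theorem modulateS_apply {n : ℕ} (ξ : Rn n) (φ : 𝓢(Rn n, ℂ)) (t : Rn n) :
    modulateS ξ φ t = Complex.exp (2 * Real.pi * Complex.I * (inner ℝ ξ t : ℝ)) * φ t := by
  rw [modulateS, SchwartzMap.smulLeftCLM_apply_apply (character_hasTemperateGrowth ξ)]
  rfl

/-- Reflection of Schwartz functions, `φ̌ t = φ (-t)`. -/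
def reflectS {n : ℕ} : 𝓢(Rn n, ℂ) →L[ℂ] 𝓢(Rn n, ℂ) :=
  SchwartzMap.compCLMOfContinuousLinearEquiv ℂ (ContinuousLinearEquiv.neg ℝ)

theorem reflectS_apply {n : ℕ} (φ : 𝓢(Rn n, ℂ)) (t : Rn n) : reflectS φ t = φ (-t) := rfl

/-- Convolution with a fixed Schwartz function as an operator on Schwartz functions. -/
def convS {n : ℕ} (φ : 𝓢(Rn n, ℂ)) : 𝓢(Rn n, ℂ) →L[ℂ] 𝓢(Rn n, ℂ) :=
  SchwartzMap.convolution (ContinuousLinearMap.mul ℂ ℂ) φ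

theorem convS_apply {n : ℕ} (φ ψ : 𝓢(Rn n, ℂ)) (x : Rn n) :
    convS φ ψ x = ∫ t, φ t * ψ (x - t) := by
  rw [convS, SchwartzMap.convolution_apply]
  rfl

/-- Translation of tempered distributions, `⟨T_x f, φ⟩ = ⟨f, T_{-x} φ⟩`. -/
def translateD {n : ℕ} (x : Rn n) : 𝓢'(Rn n, ℂ) →L[ℂ] 𝓢'(Rn n, ℂ) :=
  PointwiseConvergenceCLM.precomp ℂ (translateS (-x))

/-- Modulation of tempered distributions, `⟨M_ξ f, φ⟩ = ⟨f, M_ξ φ⟩`. -/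
def modulateD {n : ℕ} (ξ : Rn n) : 𝓢'(Rn n, ℂ) →L[ℂ] 𝓢'(Rn n, ℂ) :=
  PointwiseConvergenceCLM.precomp ℂ (modulateS ξ)

/-- The convolution `f * φ` of a tempered distribution `f` with a Schwartz function `φ`,
`⟨f * φ, ψ⟩ = ⟨f, φ̌ * ψ⟩`, as a linear function of `f`. -/
def convD {n : ℕ} (φ : 𝓢(Rn n, ℂ)) : 𝓢'(Rn n, ℂ) →L[ℂ] 𝓢'(Rn n, ℂ) :=
  PointwiseConvergenceCLM.precomp ℂ (convS (reflectS φ))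

/-- The distributional derivative `f ↦ f^{(α)} = ∂₁^{α₁} ⋯ ∂ₙ^{αₙ} f`. -/
def derivD {n : ℕ} (α : Fin n → ℕ) : 𝓢'(Rn n, ℂ) →L[ℂ] 𝓢'(Rn n, ℂ) :=
  ((List.finRange n).map fun i =>
    (LineDeriv.lineDerivOpCLM ℂ 𝓢'(Rn n, ℂ) (EuclideanSpace.single i (1 : ℝ))) ^ (α i)).prod

/-! ### Translation-modulation invariant Banach spaces of distributions and their duals -/

/-- A continuous inclusion of a normed space `E` into the space of tempered distributions on `ℝⁿ`.
For complete `E`, continuity does not depend on whether the space of tempered distributions carries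
the topology of pointwise convergence (used here) or the strong dual topology. -/
structure DistInclusion (n : ℕ) (E : Type*) [NormedAddCommGroup E] [NormedSpace ℂ E] where
  toDist : E →L[ℂ] 𝓢'(Rn n, ℂ)
  injective : Function.Injective toDist

/-- `E`, regarded as a space of tempered distributions through `ι`, is a translation-modulation
invariant Banach space of distributions (completeness of `E` is required separately). -/
structure IsTMIB {n : ℕ} {E : Type*} [NormedAddCommGroup E] [NormedSpace ℂ E]
    (ι : DistInclusion n E) : Prop where
  /-- the dense continuous inclusion of the Schwartz space -/
  dense_inclusion : ∃ j : 𝓢(Rn n, ℂ) →L[ℂ] E,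
    DenseRange j ∧ ∀ φ, ι.toDist (j φ) = schwartzToDist φ
  /-- `T_x E ⊆ E` -/
  translate_mem : ∀ (x : Rn n) (e : E), ∃ e' : E, ι.toDist e' = translateD x (ι.toDist e)
  /-- `M_ξ E ⊆ E` -/
  modulate_mem : ∀ (ξ : Rn n) (e : E), ∃ e' : E, ι.toDist e' = modulateD ξ (ι.toDist e)
  /-- `‖T_x‖ ≤ C (1 + |x|)^τ` -/
  translate_bound : ∃ C > (0 : ℝ), ∃ τ > (0 : ℝ), ∀ (x : Rn n) (e e' : E),
    ι.toDist e' = translateD x (ι.toDist e) → ‖e'‖ ≤ C * (1 + ‖x‖) ^ τ * ‖e‖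
  /-- `‖M_ξ‖ ≤ C (1 + |ξ|)^τ` -/
  modulate_bound : ∃ C > (0 : ℝ), ∃ τ > (0 : ℝ), ∀ (ξ : Rn n) (e e' : E),
    ι.toDist e' = modulateD ξ (ι.toDist e) → ‖e'‖ ≤ C * (1 + ‖ξ‖) ^ τ * ‖e‖

/-- `E`, regarded as a space of tempered distributions through `ι`, is the strong dual `F'` of a
translation-modulation invariant Banach space of distributions `F`; a functional on `F` is regarded
as a tempered distribution by restricting it to the Schwartz functions. -/
def IsDTMIB.{u} {n : ℕ} {E : Type u} [NormedAddCommGroup E] [NormedSpace ℂ E]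
    (ι : DistInclusion n E) : Prop :=
  ∃ (F : Type u) (_ : NormedAddCommGroup F) (_ : NormedSpace ℂ F) (_ : CompleteSpace F)
    (κ : DistInclusion n F) (_ : IsTMIB κ) (Φ : E ≃L[ℂ] StrongDual ℂ F),
    ∀ (e : E) (φ : 𝓢(Rn n, ℂ)) (f : F), κ.toDist f = schwartzToDist φ → ι.toDist e φ = Φ e f

theorem hasSum_of_eq {I V : Type*} [AddCommMonoid V] [TopologicalSpace V] {f g : I → V} {v : V}
    (h : ∀ k, f k = g k) (hg : HasSum g v) : HasSum f v := by
  rwa [funext h]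

namespace DistInclusion

variable {n : ℕ} {E : Type*} [NormedAddCommGroup E] [NormedSpace ℂ E]

/-- The inverse of the inclusion, defined on the tempered distributions that belong to `E`. -/
def toE (ι : DistInclusion n E) : LinearMap.range (ι.toDist : E →ₗ[ℂ] 𝓢'(Rn n, ℂ)) →ₗ[ℂ] E :=
  (LinearEquiv.ofInjective (ι.toDist : E →ₗ[ℂ] 𝓢'(Rn n, ℂ)) ι.injective).symm.toLinearMap

theorem toDist_toE (ι : DistInclusion n E)
    (f : LinearMap.range (ι.toDist : E →ₗ[ℂ] 𝓢'(Rn n, ℂ))) : ι.toDist (ι.toE f) = f :=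
  congrArg Subtype.val
    ((LinearEquiv.ofInjective (ι.toDist : E →ₗ[ℂ] 𝓢'(Rn n, ℂ)) ι.injective).apply_symm_apply f)

/-! ### The test function space `D_E` -/

/-- `{f ∈ S' | f^{(α)} ∈ E for all α}` -/
def testSubmodule (ι : DistInclusion n E) : Submodule ℂ 𝓢'(Rn n, ℂ) :=
  ⨅ α : Fin n → ℕ,
    (LinearMap.range (ι.toDist : E →ₗ[ℂ] 𝓢'(Rn n, ℂ))).comap (derivD α : _ →ₗ[ℂ] 𝓢'(Rn n, ℂ))

/-- The test function space `D_E`. -/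
def TestSpace (ι : DistInclusion n E) : Type := ↥ι.testSubmodule

instance (ι : DistInclusion n E) : AddCommGroup ι.TestSpace :=
  inferInstanceAs (AddCommGroup ↥ι.testSubmodule)

instance (ι : DistInclusion n E) : Module ℂ ι.TestSpace :=
  inferInstanceAs (Module ℂ ↥ι.testSubmodule)

/-- `f ↦ f^{(α)}` as a map from `D_E` to `E`. -/
def testDeriv (ι : DistInclusion n E) (α : Fin n → ℕ) (f : ι.TestSpace) : E :=
  ι.toE ⟨derivD α f.1, (Submodule.mem_iInf _).1 f.2 α⟩

/-- The Fréchet topology of `D_E`: it is generated by the seminorms `f ↦ ‖f^{(α)}‖_E`, equivalently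
by the norms `f ↦ sup_{|α| ≤ N} ‖f^{(α)}‖_E`. -/
instance (ι : DistInclusion n E) : TopologicalSpace ι.TestSpace :=
  ⨅ α : Fin n → ℕ, TopologicalSpace.induced (ι.testDeriv α) inferInstance

/-! ### The distribution space `D'_E` -/

/-- `{f ∈ S' | f * φ ∈ E for all φ ∈ S}` -/
def distSubmodule (ι : DistInclusion n E) : Submodule ℂ 𝓢'(Rn n, ℂ) :=
  ⨅ φ : 𝓢(Rn n, ℂ),
    (LinearMap.range (ι.toDist : E →ₗ[ℂ] 𝓢'(Rn n, ℂ))).comap (convD φ : _ →ₗ[ℂ] 𝓢'(Rn n, ℂ))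

/-- The distribution space `D'_E`. -/
def DistSpace (ι : DistInclusion n E) : Type := ↥ι.distSubmodule

instance (ι : DistInclusion n E) : AddCommGroup ι.DistSpace :=
  inferInstanceAs (AddCommGroup ↥ι.distSubmodule)

instance (ι : DistInclusion n E) : Module ℂ ι.DistSpace :=
  inferInstanceAs (Module ℂ ↥ι.distSubmodule)

/-- `φ ↦ f * φ` as a map from `S` to `E`, for `f ∈ D'_E`. -/
def distConv (ι : DistInclusion n E) (f : ι.DistSpace) (φ : 𝓢(Rn n, ℂ)) : E :=
  ι.toE ⟨convD φ f.1, (Submodule.mem_iInf _).1 f.2 φ⟩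

/-- The topology of `D'_E`, induced by the embedding `f ↦ (φ ↦ f * φ)` into the space of continuous
linear maps from `S` to `E` with the topology of uniform convergence on the bounded subsets
of `S`. -/
instance (ι : DistInclusion n E) : TopologicalSpace ι.DistSpace :=
  TopologicalSpace.induced
    (fun f => UniformOnFun.ofFun {B : Set 𝓢(Rn n, ℂ) | Bornology.IsVonNBounded ℂ B} (ι.distConv f))
    inferInstance

/-! ### The discrete space `E_d` -/

/-- `{c ∈ ℂ^{ℤⁿ} | ∑ₖ cₖ T_k χ ∈ E}`, the sum being taken in the tempered distributions. -/
def discreteSubmodule (ι : DistInclusion n E) (χ : 𝓢(Rn n, ℂ)) :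
    Submodule ℂ ((Fin n → ℤ) → ℂ) where
  carrier := {c | ∃ e : E,
    HasSum (fun k => c k • schwartzToDist (translateS (latticePt k) χ)) (ι.toDist e)}
  add_mem' := by
    rintro a b ⟨e, he⟩ ⟨e', he'⟩
    refine ⟨e + e', ?_⟩
    rw [map_add]
    exact hasSum_of_eq (fun k => add_smul (a k) (b k) (schwartzToDist (translateS (latticePt k) χ))) (he.add he')
  zero_mem' := by
    refine ⟨0, ?_⟩
    rw [map_zero]
    exact hasSum_of_eq (fun k => zero_smul ℂ (schwartzToDist (translateS (latticePt k) χ))) hasSum_zero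
  smul_mem' := by
    rintro z a ⟨e, he⟩
    refine ⟨z • e, ?_⟩
    rw [map_smul]
    exact hasSum_of_eq (fun _ => mul_smul _ _ _) (he.const_smul z)

/-- The discrete space `E_d = E_{d, χ}(ℤⁿ)` associated to `E`. -/
def DiscreteSpace (ι : DistInclusion n E) (χ : 𝓢(Rn n, ℂ)) : Type := ↥(ι.discreteSubmodule χ)

instance (ι : DistInclusion n E) (χ : 𝓢(Rn n, ℂ)) : AddCommGroup (ι.DiscreteSpace χ) :=
  inferInstanceAs (AddCommGroup ↥(ι.discreteSubmodule χ))

instance (ι : DistInclusion n E) (χ : 𝓢(Rn n, ℂ)) : Module ℂ (ι.DiscreteSpace χ) :=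
  inferInstanceAs (Module ℂ ↥(ι.discreteSubmodule χ))

/-- The map `S_χ : E_d → E`, `c ↦ ∑ₖ cₖ T_k χ`. -/
def discreteSynthesis (ι : DistInclusion n E) (χ : 𝓢(Rn n, ℂ)) : ι.DiscreteSpace χ →ₗ[ℂ] E where
  toFun c := c.2.choose
  map_add' a b := by
    apply ι.injective
    rw [map_add]
    refine (a + b).2.choose_spec.unique ?_
    exact hasSum_of_eq (fun k => add_smul (a.1 k) (b.1 k) (schwartzToDist (translateS (latticePt k) χ))) (a.2.choose_spec.add b.2.choose_spec)
  map_smul' z a := by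
    apply ι.injective
    rw [RingHom.id_apply, map_smul]
    refine (z • a).2.choose_spec.unique ?_
    exact hasSum_of_eq (fun _ => mul_smul _ _ _) (a.2.choose_spec.const_smul z)

theorem hasSum_discreteSynthesis (ι : DistInclusion n E) (χ : 𝓢(Rn n, ℂ))
    (c : ι.DiscreteSpace χ) :
    HasSum (fun k => c.1 k • schwartzToDist (translateS (latticePt k) χ))
      (ι.toDist (ι.discreteSynthesis χ c)) :=
  c.2.choose_spec

/-- The norm `‖c‖ = ‖S_χ c‖_E` of the discrete space. -/
instance (ι : DistInclusion n E) (χ : 𝓢(Rn n, ℂ)) : SeminormedAddCommGroup (ι.DiscreteSpace χ) :=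
  SeminormedAddCommGroup.induced (ι.DiscreteSpace χ) E (ι.discreteSynthesis χ)

end DistInclusion

/-- `χ` is a nonzero smooth function whose support is compact and contained in a bounded open
neighbourhood `U` of the origin the translates `k + U`, `k ∈ ℤⁿ`, of which are pairwise disjoint. -/
structure IsDiscreteWindow {n : ℕ} (U : Set (Rn n)) (χ : 𝓢(Rn n, ℂ)) : Prop where
  isOpen : IsOpen U
  isBounded : Bornology.IsBounded U
  zero_mem : (0 : Rn n) ∈ U
  pairwise_disjoint : Pairwise fun k l : Fin n → ℤ =>
    Disjoint ((fun x => latticePt k + x) '' U) ((fun x => latticePt l + x) '' U)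
  hasCompactSupport : HasCompactSupport χ
  support_subset : tsupport χ ⊆ U
  ne_zero : χ ≠ 0

/-! ### The sequence spaces `s` and `s'` -/

/-- The elements `c` of `ℂ^I` with `sup_k |c_k| w_k < ∞`. -/
def weightedBoundedSubmodule {I : Type*} (w : I → ℝ) : Submodule ℂ (I → ℂ) where
  carrier := {c | Memℓp (fun k => (w k : ℂ) * c k) ∞}
  add_mem' := by
    intro a b ha hb
    have ha' : Memℓp (fun k => (w k : ℂ) * a k) ∞ := ha
    have hb' : Memℓp (fun k => (w k : ℂ) * b k) ∞ := hb
    have h := ha'.add hb'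
    refine (congrArg (fun f : I → ℂ => Memℓp f ∞) (funext fun k => ?_)).mp h
    exact (mul_add _ _ _).symm
  zero_mem' := by
    have h : Memℓp (0 : I → ℂ) ∞ := zero_memℓp
    simpa [Pi.zero_def] using h
  smul_mem' := by
    intro z a ha
    have ha' : Memℓp (fun k => (w k : ℂ) * a k) ∞ := ha
    have h := ha'.const_smul z
    refine (congrArg (fun f : I → ℂ => Memℓp f ∞) (funext fun k => ?_)).mp h
    exact (mul_left_comm _ _ _)

/-- The weighted space `ℓ^∞_w(I)` for a positive weight `w`. -/
def WeightedBounded {I : Type*} (w : I → ℝ) : Type _ := ↥(weightedBoundedSubmodule w)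

instance {I : Type*} (w : I → ℝ) : AddCommGroup (WeightedBounded w) :=
  inferInstanceAs (AddCommGroup ↥(weightedBoundedSubmodule w))

instance {I : Type*} (w : I → ℝ) : Module ℂ (WeightedBounded w) :=
  inferInstanceAs (Module ℂ ↥(weightedBoundedSubmodule w))

/-- The map `c ↦ (w_k c_k)_k` from `ℓ^∞_w` to `ℓ^∞`. -/
def WeightedBounded.toBounded {I : Type*} (w : I → ℝ) :
    WeightedBounded w →ₗ[ℂ] lp (fun _ : I => ℂ) ∞ where
  toFun c := ⟨fun k => (w k : ℂ) * c.1 k, c.2⟩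
  map_add' a b := by
    ext k
    exact mul_add _ _ _
  map_smul' z a := by
    ext k
    exact mul_left_comm _ _ _

/-- The norm `‖c‖ = sup_k |c_k| w_k` of `ℓ^∞_w`. -/
instance {I : Type*} (w : I → ℝ) : SeminormedAddCommGroup (WeightedBounded w) :=
  SeminormedAddCommGroup.induced (WeightedBounded w) (lp (fun _ : I => ℂ) ∞)
    (WeightedBounded.toBounded w)

theorem WeightedBounded.norm_eq {I : Type*} (w : I → ℝ) (c : WeightedBounded w) :
    ‖c‖ = ⨆ k, |w k| * ‖c.1 k‖ := by
  change ‖WeightedBounded.toBounded w c‖ = _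
  rw [lp.norm_eq_ciSup]
  simp [WeightedBounded.toBounded]

/-- The weight `(1 + |k|)^m` on `ℤⁿ`, for `m ∈ ℤ`. -/
def polyWeight (n : ℕ) (m : ℤ) (k : Fin n → ℤ) : ℝ := (1 + ‖latticePt k‖) ^ m

/-- The set `⋂_N ℓ^∞_{(1 + |·|)^N}(ℤⁿ)`. -/
def rapidSubmodule (n : ℕ) : Submodule ℂ ((Fin n → ℤ) → ℂ) :=
  ⨅ N : ℕ, weightedBoundedSubmodule (polyWeight n N)

/-- The space `s = s(ℤⁿ)` of rapidly decreasing sequences. -/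
def RapidSeq (n : ℕ) : Type := ↥(rapidSubmodule n)

instance (n : ℕ) : AddCommGroup (RapidSeq n) := inferInstanceAs (AddCommGroup ↥(rapidSubmodule n))

instance (n : ℕ) : Module ℂ (RapidSeq n) := inferInstanceAs (Module ℂ ↥(rapidSubmodule n))

/-- The inclusion of `s` into `ℓ^∞_{(1 + |·|)^N}`. -/
def RapidSeq.toStep {n : ℕ} (N : ℕ) (c : RapidSeq n) : WeightedBounded (polyWeight n N) :=
  ⟨c.1, (Submodule.mem_iInf _).1 c.2 N⟩

/-- The projective limit topology of `s`. -/
instance (n : ℕ) : TopologicalSpace (RapidSeq n) :=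
  ⨅ N : ℕ, TopologicalSpace.induced (RapidSeq.toStep N) inferInstance

theorem polyWeight_neg_mono (n : ℕ) :
    Monotone fun N : ℕ => weightedBoundedSubmodule (polyWeight n (-(N : ℤ))) := by
  intro N M hNM c hc
  have hc' : Memℓp (fun k => (polyWeight n (-(N : ℤ)) k : ℂ) * c k) ∞ := hc
  change Memℓp (fun k => (polyWeight n (-(M : ℤ)) k : ℂ) * c k) ∞
  rw [memℓp_infty_iff] at hc' ⊢
  obtain ⟨C, hC⟩ := hc'
  refine ⟨C, ?_⟩
  rintro _ ⟨k, rfl⟩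
  refine le_trans ?_ (hC ⟨k, rfl⟩)
  simp only [norm_mul, Complex.norm_real]
  refine mul_le_mul_of_nonneg_right ?_ (norm_nonneg _)
  have h1 : (1 : ℝ) ≤ 1 + ‖latticePt k‖ := by linarith [norm_nonneg (latticePt k)]
  have h0 : (0 : ℝ) < 1 + ‖latticePt k‖ := by linarith
  simp only [polyWeight, Real.norm_eq_abs, abs_of_pos (zpow_pos h0 _)]
  exact zpow_le_zpow_right₀ h1 (by omega)

/-- The set `⋃_N ℓ^∞_{(1 + |·|)^{-N}}(ℤⁿ)`. -/
def slowSubmodule (n : ℕ) : Submodule ℂ ((Fin n → ℤ) → ℂ) :=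
  ⨆ N : ℕ, weightedBoundedSubmodule (polyWeight n (-(N : ℤ)))

theorem mem_slowSubmodule {n : ℕ} {c : (Fin n → ℤ) → ℂ} :
    c ∈ slowSubmodule n ↔ ∃ N : ℕ, c ∈ weightedBoundedSubmodule (polyWeight n (-(N : ℤ))) :=
  Submodule.mem_iSup_of_directed _ (polyWeight_neg_mono n).directed_le

/-- The space `s' = s'(ℤⁿ)` of slowly increasing sequences. -/
def SlowSeq (n : ℕ) : Type := ↥(slowSubmodule n)

instance (n : ℕ) : AddCommGroup (SlowSeq n) := inferInstanceAs (AddCommGroup ↥(slowSubmodule n))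

instance (n : ℕ) : Module ℂ (SlowSeq n) := inferInstanceAs (Module ℂ ↥(slowSubmodule n))

/-- The inclusion of `ℓ^∞_{(1 + |·|)^{-N}}` into `s'`. -/
def SlowSeq.ofStep {n : ℕ} (N : ℕ) (c : WeightedBounded (polyWeight n (-(N : ℤ)))) : SlowSeq n :=
  ⟨c.1, mem_slowSubmodule.2 ⟨N, c.2⟩⟩

/-! ### Locally convex topologies -/

/-- `t` is a (not necessarily Hausdorff) locally convex topology on the complex vector space `V`. -/
structure IsLocallyConvexTopology (V : Type*) [AddCommGroup V] [Module ℂ V]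
    (t : TopologicalSpace V) : Prop where
  isTopologicalAddGroup : IsTopologicalAddGroup V
  continuousSMul : ContinuousSMul ℂ V
  locallyConvexSpace : LocallyConvexSpace ℝ V

theorem IsLocallyConvexTopology.sInf {V : Type*} [AddCommGroup V] [Module ℂ V]
    {S : Set (TopologicalSpace V)} (hS : ∀ t ∈ S, IsLocallyConvexTopology V t) :
    IsLocallyConvexTopology V (sInf S) where
  isTopologicalAddGroup := topologicalAddGroup_sInf fun t ht => (hS t ht).isTopologicalAddGroup
  continuousSMul := continuousSMul_sInf fun t ht => (hS t ht).continuousSMul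
  locallyConvexSpace := LocallyConvexSpace.sInf fun t ht => (hS t ht).locallyConvexSpace

/-- The inductive limit topology of `s'`: the finest locally convex topology for which all inclusions
`ℓ^∞_{(1 + |·|)^{-N}} → s'` are continuous. (In the order of `TopologicalSpace`, finer is
smaller.) -/
instance (n : ℕ) : TopologicalSpace (SlowSeq n) :=
  sInf {t | IsLocallyConvexTopology (SlowSeq n) t ∧
    ∀ N : ℕ, @Continuous _ _ _ t (SlowSeq.ofStep (n := n) N)}

/-! ### Completed tensor products -/

section Tensor

variable (X Y : Type*) [AddCommGroup X] [Module ℂ X] [TopologicalSpace X]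
  [AddCommGroup Y] [Module ℂ Y] [TopologicalSpace Y]

/-- The algebraic tensor product `X ⊗ Y`, to be endowed with the projective topology. -/
def ProjTensor : Type _ := X ⊗[ℂ] Y

instance : AddCommGroup (ProjTensor X Y) := inferInstanceAs (AddCommGroup (X ⊗[ℂ] Y))

instance : Module ℂ (ProjTensor X Y) := inferInstanceAs (Module ℂ (X ⊗[ℂ] Y))

/-- The canonical bilinear map `X × Y → X ⊗ Y`. -/
def ProjTensor.mk (p : X × Y) : ProjTensor X Y := p.1 ⊗ₜ[ℂ] p.2

/-- The projective (`π`-) topology: the finest locally convex topology on `X ⊗ Y` for which the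
canonical bilinear map `X × Y → X ⊗ Y` is continuous. -/
instance : TopologicalSpace (ProjTensor X Y) :=
  sInf {t | IsLocallyConvexTopology (ProjTensor X Y) t ∧
    @Continuous _ _ _ t (ProjTensor.mk X Y)}

theorem ProjTensor.isLocallyConvexTopology :
    IsLocallyConvexTopology (ProjTensor X Y) inferInstance :=
  IsLocallyConvexTopology.sInf fun _ ht => ht.1

instance : IsTopologicalAddGroup (ProjTensor X Y) :=
  (ProjTensor.isLocallyConvexTopology X Y).isTopologicalAddGroup

instance : ContinuousSMul ℂ (ProjTensor X Y) :=
  (ProjTensor.isLocallyConvexTopology X Y).continuousSMul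

instance : UniformSpace (ProjTensor X Y) := IsTopologicalAddGroup.rightUniformSpace _

instance : IsUniformAddGroup (ProjTensor X Y) := isUniformAddGroup_of_addCommGroup

instance : UniformContinuousConstSMul ℂ (ProjTensor X Y) :=
  uniformContinuousConstSMul_of_continuousConstSMul ℂ _

/-- The completed projective tensor product of `X` and `Y`. -/
abbrev CompletedProjTensor : Type _ := UniformSpace.Completion (ProjTensor X Y)

/-- The algebraic tensor product `X ⊗ Y`, to be endowed with the injective topology. -/
def InjTensor : Type _ := X ⊗[ℂ] Y

instance : AddCommGroup (InjTensor X Y) := inferInstanceAs (AddCommGroup (X ⊗[ℂ] Y))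

instance : Module ℂ (InjTensor X Y) := inferInstanceAs (Module ℂ (X ⊗[ℂ] Y))

/-- The products `A × B` of an equicontinuous set `A` of functionals on `X` and an equicontinuous
set `B` of functionals on `Y`. -/
def equicontinuousProducts : Set (Set ((X →L[ℂ] ℂ) × (Y →L[ℂ] ℂ))) :=
  {S | ∃ (A : Set (X →L[ℂ] ℂ)) (B : Set (Y →L[ℂ] ℂ)),
    Equicontinuous (fun (f : A) (x : X) => f.1 x) ∧
    Equicontinuous (fun (g : B) (y : Y) => g.1 y) ∧ S = A ×ˢ B}

/-- The element `u = ∑ xᵢ ⊗ yᵢ` as the bilinear form `(f, g) ↦ (f ⊗ g) u = ∑ f xᵢ * g yᵢ` on the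
product of the dual spaces, in the space of functions with the topology of uniform convergence on
the products of equicontinuous sets. -/
def InjTensor.toForm :
    InjTensor X Y →ₗ[ℂ] UniformOnFun ((X →L[ℂ] ℂ) × (Y →L[ℂ] ℂ)) ℂ (equicontinuousProducts X Y) where
  toFun u := UniformOnFun.ofFun _ fun p =>
    LinearMap.mul' ℂ ℂ (TensorProduct.map (p.1 : X →ₗ[ℂ] ℂ) (p.2 : Y →ₗ[ℂ] ℂ) u)
  map_add' u v := by
    apply (UniformOnFun.toFun (equicontinuousProducts X Y)).injective
    funext p
    exact (LinearMap.mul' ℂ ℂ ∘ₗ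
      TensorProduct.map (p.1 : X →ₗ[ℂ] ℂ) (p.2 : Y →ₗ[ℂ] ℂ)).map_add u v
  map_smul' z u := by
    apply (UniformOnFun.toFun (equicontinuousProducts X Y)).injective
    funext p
    exact (LinearMap.mul' ℂ ℂ ∘ₗ
      TensorProduct.map (p.1 : X →ₗ[ℂ] ℂ) (p.2 : Y →ₗ[ℂ] ℂ)).map_smul z u

/-- The injective (`ε`-) topology: uniform convergence on the products of equicontinuous sets. -/
instance : TopologicalSpace (InjTensor X Y) :=
  TopologicalSpace.induced (InjTensor.toForm X Y) inferInstance

instance : IsTopologicalAddGroup (InjTensor X Y) :=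
  topologicalAddGroup_induced (InjTensor.toForm X Y)

instance : UniformSpace (InjTensor X Y) := IsTopologicalAddGroup.rightUniformSpace _

instance : IsUniformAddGroup (InjTensor X Y) := isUniformAddGroup_of_addCommGroup

instance : UniformContinuousConstSMul ℂ (InjTensor X Y) :=
  haveI : ContinuousConstSMul ℂ (InjTensor X Y) := by
    refine ⟨fun z => continuous_induced_rng.2 ?_⟩
    have h : Continuous (InjTensor.toForm X Y) := continuous_induced_dom
    have h2 : (InjTensor.toForm X Y) ∘ (fun u => z • u) = fun u => z • InjTensor.toForm X Y u := by
      funext u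
      exact map_smul _ z u
    rw [h2]
    exact h.const_smul z
  uniformContinuousConstSMul_of_continuousConstSMul ℂ _

/-- The completed injective tensor product of `X` and `Y`. -/
abbrev CompletedInjTensor : Type _ := UniformSpace.Completion (InjTensor X Y)

end Tensor

end

/-!
The proof identifies `D_E` and `D'_E` with spaces of sequences in `E_d`, and these with the completed
tensor products.

*Operators on `E`.* The argument rests on two estimates: convolution with a Schwartz function `θ` maps
`E` into itself with norm at most a Schwartz norm of `θ`, and modulation `M_ξ` acts on `E` with norm of
polynomial growth in `ξ` (`IsTMIB.isConvModBounded`, `IsDTMIB.isConvModBounded`).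
By Poisson summation, `∑ₖ f(T_k θ) T_k φ = ∑ⱼ M_j (f * (θˇ * M_{-j} φ))`. The terms on the right decay
rapidly in `E`, so the left-hand side belongs to `E` as soon as all convolutions of `f` do
(`DistInclusion.exists_discretization`). Together with the dual window of `χ`, this shows that the analysis
operators `f ↦ (f(T_k θ))ₖ` map `E` and `D'_E` to `E_d` and that the synthesis operators
`S_φ c = ∑ₖ cₖ T_k φ` map `E_d` to `E`, for all Schwartz functions `θ` and `φ`, with norms controlled by
Schwartz norms. In particular `E_d` is a retract of `E`, hence complete.

*Local cosines.* The functions `T_k w_m`, `k, m ∈ ℤⁿ`, where `w_m` is a tensor product of local cosine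
functions, form an orthonormal basis consisting of lattice translates of a sequence of windows. The
windows `w_m` are finite sums of modulations of a single bell function with frequencies comparable to `m`.
Their Schwartz norms therefore grow polynomially in `m`, while the Schwartz norms of `w_m * g` decay
rapidly. It follows that a tempered distribution is determined by its coefficients `f(T_k w_m)`
(`dist_ext_localCosine`), and that `f ↦ ((f(T_k w_m))ₖ)ₘ`, with inverse `a ↦ ∑ₘ S_{w_m} a_m`, is an
isomorphism of `D_E` onto the rapidly decreasing sequences in `E_d`, and of `D'_E` onto the sequences of
polynomial growth in `E_d` (`DistInclusion.nonempty_testSpace_equiv`,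
`DistInclusion.nonempty_distSpace_equiv`). For `D_E` the decay in `m` comes from integration by parts.
For `D'_E` the topology is matched through the bounded sets formed by multiples of the functions
`w_mˇ * M_{-j} χ`.

*Tensor products.* For a complete normed space `B`, the spaces of `B`-valued sequences are described by
weights: the seminorms are `supₘ |r m| ‖a_m‖`, with weights `r` of polynomial growth in the case of `s` and
rapidly decreasing weights in the case of `s'`. Both families of weights are stable under multiplication
by a power of `1 + |m|`, so that suprema can be replaced by sums. This is the form of nuclearity that
makes both the projective and the injective topology on `B ⊗ s` and `B ⊗ s'` coincide with the topology
induced by the weighted sequence space, in which the tensor product is dense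
(`IsNuclearSeqSpace.nonempty_equiv_completedProjTensor`,
`IsNuclearSeqSpace.nonempty_equiv_completedInjTensor`).
-/

open scoped FourierTransform
open Filter Topology

/-! ### Estimates on the Schwartz space -/

/-- The increasing sequence `‖f‖_N = max_{k, l ≤ N} sup_x |x|^k |D^l f(x)|` of norms that defines the
topology of the Schwartz space. -/
noncomputable def schwartzNorm {n : ℕ} (N : ℕ) : Seminorm ℂ 𝓢(Rn n, ℂ) :=
  (Finset.Iic (N, N)).sup (schwartzSeminormFamily ℂ (Rn n) ℂ)

section SchwartzNorm

variable {n : ℕ}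

theorem schwartzNorm_nonneg (N : ℕ) (f : 𝓢(Rn n, ℂ)) : 0 ≤ schwartzNorm N f :=
  apply_nonneg _ _

theorem seminorm_le_schwartzNorm {N k l : ℕ} (hk : k ≤ N) (hl : l ≤ N) (f : 𝓢(Rn n, ℂ)) :
    SchwartzMap.seminorm ℂ k l f ≤ schwartzNorm N f := by
  have : (k, l) ∈ Finset.Iic (N, N) := by simp [Prod.mk_le_mk, hk, hl]
  exact Seminorm.le_def.1 (Finset.le_sup (f := schwartzSeminormFamily ℂ (Rn n) ℂ) this) f

theorem schwartzNorm_mono {N M : ℕ} (h : N ≤ M) (f : 𝓢(Rn n, ℂ)) :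
    schwartzNorm N f ≤ schwartzNorm M f := by
  refine Seminorm.le_def.1 (Finset.sup_mono ?_) f
  exact Finset.Iic_subset_Iic.2 (Prod.mk_le_mk.2 ⟨h, h⟩)

theorem schwartzNorm_le {N : ℕ} {f : 𝓢(Rn n, ℂ)} {C : ℝ} (hC : 0 ≤ C)
    (h : ∀ k ≤ N, ∀ l ≤ N, ∀ x, ‖x‖ ^ k * ‖iteratedFDeriv ℝ l f x‖ ≤ C) :
    schwartzNorm N f ≤ C := by
  refine Seminorm.finset_sup_apply_le hC fun m hm => ?_
  rw [Finset.mem_Iic, Prod.le_def] at hm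
  exact SchwartzMap.seminorm_le_bound ℂ _ _ f hC (h _ hm.1 _ hm.2)

theorem one_add_pow_mul_le_schwartzNorm {N k l : ℕ} (hk : k ≤ N) (hl : l ≤ N) (f : 𝓢(Rn n, ℂ))
    (x : Rn n) : (1 + ‖x‖) ^ k * ‖iteratedFDeriv ℝ l f x‖ ≤ 2 ^ N * schwartzNorm N f :=
  SchwartzMap.one_add_le_sup_seminorm_apply (𝕜 := ℂ) (m := (N, N)) hk hl f x

theorem one_add_pow_mul_norm_le {N k : ℕ} (hk : k ≤ N) (f : 𝓢(Rn n, ℂ))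
    (x : Rn n) : (1 + ‖x‖) ^ k * ‖f x‖ ≤ 2 ^ N * schwartzNorm N f := by
  simpa using one_add_pow_mul_le_schwartzNorm hk (Nat.zero_le N) f x

theorem norm_le_schwartzNorm (f : 𝓢(Rn n, ℂ)) (x : Rn n) : ‖f x‖ ≤ schwartzNorm 0 f := by
  simpa using one_add_pow_mul_norm_le le_rfl f x (k := 0) (N := 0)

theorem continuous_schwartzNorm (N : ℕ) :
    Continuous (schwartzNorm N : 𝓢(Rn n, ℂ) → ℝ) := by
  have h : ∀ s : Finset (ℕ × ℕ),
      Continuous fun f => s.sup (schwartzSeminormFamily ℂ (Rn n) ℂ) f := by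
    intro s
    induction s using Finset.induction_on with
    | empty => simpa [Seminorm.bot_eq_zero] using continuous_const
    | insert a s ha ih =>
      rw [Finset.sup_insert]
      exact ((schwartz_withSeminorms ℂ (Rn n) ℂ).continuous_seminorm a).max ih
  exact h _

/-- Every continuous seminorm on the Schwartz space is dominated by one of the norms `‖·‖_N`. -/
theorem Seminorm.exists_le_schwartzNorm (q : Seminorm ℂ 𝓢(Rn n, ℂ)) (hq : Continuous q) :
    ∃ M C, 0 ≤ C ∧ ∀ f, q f ≤ C * schwartzNorm M f := by
  obtain ⟨s, C, -, h⟩ := Seminorm.bound_of_continuous (schwartz_withSeminorms ℂ (Rn n) ℂ) q hq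
  refine ⟨s.sup (fun m => max m.1 m.2), C, C.2, fun f => (Seminorm.le_def.1 h f).trans ?_⟩
  refine mul_le_mul_of_nonneg_left ?_ C.2
  refine Seminorm.le_def.1 (Finset.sup_mono fun m hm => ?_) f
  have := Finset.le_sup (f := fun m : ℕ × ℕ => max m.1 m.2) hm
  rw [Finset.mem_Iic, Prod.le_def]
  exact ⟨(le_max_left _ _).trans this, (le_max_right _ _).trans this⟩

theorem exists_schwartzNorm_map_le (L : 𝓢(Rn n, ℂ) →L[ℂ] 𝓢(Rn n, ℂ)) (N : ℕ) :
    ∃ M C, 0 ≤ C ∧ ∀ f, schwartzNorm N (L f) ≤ C * schwartzNorm M f :=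
  Seminorm.exists_le_schwartzNorm ((schwartzNorm N).comp (L : 𝓢(Rn n, ℂ) →ₗ[ℂ] 𝓢(Rn n, ℂ)))
    ((continuous_schwartzNorm N).comp L.continuous)

theorem exists_norm_map_le_schwartzNorm {G : Type*} [SeminormedAddCommGroup G] [NormedSpace ℂ G]
    (L : 𝓢(Rn n, ℂ) →L[ℂ] G) : ∃ M C, 0 ≤ C ∧ ∀ f, ‖L f‖ ≤ C * schwartzNorm M f :=
  Seminorm.exists_le_schwartzNorm ((normSeminorm ℂ G).comp (L : 𝓢(Rn n, ℂ) →ₗ[ℂ] G))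
    (continuous_norm.comp L.continuous)

theorem isVonNBounded_iff_schwartzNorm {B : Set 𝓢(Rn n, ℂ)} :
    Bornology.IsVonNBounded ℂ B ↔ ∀ N, ∃ C, ∀ f ∈ B, schwartzNorm N f ≤ C := by
  rw [(schwartz_withSeminorms ℂ (Rn n) ℂ).isVonNBounded_iff_finset_seminorm_bounded]
  constructor
  · intro h N
    obtain ⟨r, -, hr⟩ := h (Finset.Iic (N, N))
    exact ⟨r, fun f hf => (hr f hf).le⟩
  · intro h s
    obtain ⟨C, hC⟩ := h (s.sup (fun m => max m.1 m.2))
    refine ⟨max C 0 + 1, by positivity, fun f hf => lt_of_le_of_lt ?_ (lt_add_one _)⟩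
    refine le_trans ?_ ((hC f hf).trans (le_max_left _ _))
    refine Seminorm.le_def.1 (Finset.sup_mono fun m hm => ?_) f
    have := Finset.le_sup (f := fun m : ℕ × ℕ => max m.1 m.2) hm
    rw [Finset.mem_Iic, Prod.le_def]
    exact ⟨(le_max_left _ _).trans this, (le_max_right _ _).trans this⟩

theorem tendsto_schwartz_nhds {I : Type*} {l : Filter I} (u : I → 𝓢(Rn n, ℂ)) (g : 𝓢(Rn n, ℂ)) :
    Tendsto u l (𝓝 g) ↔ ∀ N, Tendsto (fun i => schwartzNorm N (u i - g)) l (𝓝 0) := by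
  constructor
  · intro h N
    have h1 : Tendsto (fun i => u i - g) l (𝓝 (g - g)) := h.sub_const g
    have h2 := ((continuous_schwartzNorm (n := n) N).tendsto (g - g)).comp h1
    simpa [Function.comp_def] using h2
  · intro h
    rw [(schwartz_withSeminorms ℂ (Rn n) ℂ).tendsto_nhds]
    intro m ε hε
    filter_upwards [(h (max m.1 m.2)).eventually (gt_mem_nhds hε)] with i hi
    exact (seminorm_le_schwartzNorm (le_max_left _ _) (le_max_right _ _) _).trans_lt hi

theorem one_add_norm_le_mul (x y : Rn n) : 1 + ‖x‖ ≤ (1 + ‖x - y‖) * (1 + ‖y‖) := by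
  have h := norm_add_le (x - y) y
  rw [sub_add_cancel] at h
  nlinarith [norm_nonneg (x - y), norm_nonneg y, mul_nonneg (norm_nonneg (x - y)) (norm_nonneg y)]

theorem schwartzNorm_translateS_le (N : ℕ) (y : Rn n) (f : 𝓢(Rn n, ℂ)) :
    schwartzNorm N (translateS y f) ≤ 2 ^ N * (1 + ‖y‖) ^ N * schwartzNorm N f := by
  have h0 := schwartzNorm_nonneg N f
  refine schwartzNorm_le (by positivity) fun k hk l hl x => ?_
  have h1 : iteratedFDeriv ℝ l (translateS y f) x = iteratedFDeriv ℝ l f (x - y) :=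
    iteratedFDeriv_comp_sub l y x
  rw [h1]
  have h2 : ‖x‖ ^ k ≤ (1 + ‖y‖) ^ N * (1 + ‖x - y‖) ^ k := by
    calc ‖x‖ ^ k ≤ ((1 + ‖x - y‖) * (1 + ‖y‖)) ^ k := by
          gcongr
          linarith [one_add_norm_le_mul x y]
      _ = (1 + ‖y‖) ^ k * (1 + ‖x - y‖) ^ k := by rw [mul_pow, mul_comm]
      _ ≤ _ := by
          gcongr
          linarith [norm_nonneg y]
  calc ‖x‖ ^ k * ‖iteratedFDeriv ℝ l f (x - y)‖
      ≤ (1 + ‖y‖) ^ N * (1 + ‖x - y‖) ^ k * ‖iteratedFDeriv ℝ l f (x - y)‖ := by gcongr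
    _ = (1 + ‖y‖) ^ N * ((1 + ‖x - y‖) ^ k * ‖iteratedFDeriv ℝ l f (x - y)‖) := by ring
    _ ≤ (1 + ‖y‖) ^ N * (2 ^ N * schwartzNorm N f) := by
        gcongr _ * ?_
        exact one_add_pow_mul_le_schwartzNorm hk hl f _
    _ = _ := by ring

/-- The pointwise product of Schwartz functions. -/
noncomputable def mulS (f g : 𝓢(Rn n, ℂ)) : 𝓢(Rn n, ℂ) :=
  SchwartzMap.pairing (ContinuousLinearMap.mul ℂ ℂ) f g

theorem mulS_apply (f g : 𝓢(Rn n, ℂ)) (x : Rn n) : mulS f g x = f x * g x := rfl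

/-- The product of a translate `T_y f` with `g` decays rapidly as `|y| → ∞`. -/
theorem exists_schwartzNorm_mulS_translateS_le (n K N : ℕ) : ∃ M C, 0 ≤ C ∧
    ∀ (y : Rn n) (f g : 𝓢(Rn n, ℂ)),
      (1 + ‖y‖) ^ K * schwartzNorm N (mulS (translateS y f) g)
        ≤ C * schwartzNorm M f * schwartzNorm M g := by
  refine ⟨N + K, ∑ l ∈ Finset.range (N + 1), ∑ i ∈ Finset.range (l + 1),
    (l.choose i : ℝ) * 2 ^ (N + K) * 2 ^ (N + K), by positivity, fun y f g => ?_⟩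
  have hy : 0 < (1 + ‖y‖) ^ K := by positivity
  have hf := schwartzNorm_nonneg (N + K) f
  have hg := schwartzNorm_nonneg (N + K) g
  rw [mul_comm, ← le_div_iff₀ hy]
  refine schwartzNorm_le (by positivity) fun k hk l hl x => ?_
  rw [le_div_iff₀ hy]
  have h1 : ∀ i, iteratedFDeriv ℝ i (translateS y f) x = iteratedFDeriv ℝ i f (x - y) :=
    fun i => iteratedFDeriv_comp_sub i y x
  have h2 : ‖iteratedFDeriv ℝ l (mulS (translateS y f) g) x‖ ≤ ∑ i ∈ Finset.range (l + 1),
      (l.choose i : ℝ) * ‖iteratedFDeriv ℝ i f (x - y)‖ * ‖iteratedFDeriv ℝ (l - i) g x‖ := by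
    have h := norm_iteratedFDeriv_mul_le (𝕜 := ℝ) (A := ℂ) (N := ((⊤ : ℕ∞) : WithTop ℕ∞)) ((translateS y f).smooth ⊤)
      (g.smooth ⊤) x (n := l) (mod_cast le_top)
    simp only [h1] at h
    exact h
  have h3 : 1 + ‖y‖ ≤ (1 + ‖x - y‖) * (1 + ‖x‖) := by
    have := one_add_norm_le_mul y x
    rwa [norm_sub_rev] at this
  calc ‖x‖ ^ k * ‖iteratedFDeriv ℝ l (mulS (translateS y f) g) x‖ * (1 + ‖y‖) ^ K
      ≤ (1 + ‖x‖) ^ k * (∑ i ∈ Finset.range (l + 1), (l.choose i : ℝ) *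
          ‖iteratedFDeriv ℝ i f (x - y)‖ * ‖iteratedFDeriv ℝ (l - i) g x‖)
          * ((1 + ‖x - y‖) * (1 + ‖x‖)) ^ K := by
        gcongr
        linarith
    _ = ∑ i ∈ Finset.range (l + 1), (l.choose i : ℝ) *
          ((1 + ‖x - y‖) ^ K * ‖iteratedFDeriv ℝ i f (x - y)‖) *
          ((1 + ‖x‖) ^ (k + K) * ‖iteratedFDeriv ℝ (l - i) g x‖) := by
        rw [Finset.mul_sum, Finset.sum_mul]
        refine Finset.sum_congr rfl fun i _ => ?_
        rw [mul_pow, pow_add]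
        ring
    _ ≤ ∑ i ∈ Finset.range (l + 1), (l.choose i : ℝ) *
          (2 ^ (N + K) * schwartzNorm (N + K) f) * (2 ^ (N + K) * schwartzNorm (N + K) g) := by
        refine Finset.sum_le_sum fun i hi => ?_
        have hi' : i ≤ l := Nat.lt_succ_iff.1 (Finset.mem_range.1 hi)
        gcongr _ * ?_ * ?_
        · exact one_add_pow_mul_le_schwartzNorm (by omega) (by omega) f _
        · exact one_add_pow_mul_le_schwartzNorm (by omega) (by omega) g _
    _ = (∑ i ∈ Finset.range (l + 1), (l.choose i : ℝ) * 2 ^ (N + K) * 2 ^ (N + K)) *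
          schwartzNorm (N + K) f * schwartzNorm (N + K) g := by
        rw [Finset.sum_mul, Finset.sum_mul]
        exact Finset.sum_congr rfl fun i _ => by ring
    _ ≤ _ := by
        gcongr
        exact Finset.single_le_sum (f := fun l => ∑ i ∈ Finset.range (l + 1),
          (l.choose i : ℝ) * 2 ^ (N + K) * 2 ^ (N + K)) (fun i _ => by positivity)
          (Finset.mem_range.2 (by omega))

theorem fourier_modulateS (ξ : Rn n) (f : 𝓢(Rn n, ℂ)) :
    𝓕 (modulateS ξ f) = translateS ξ (𝓕 f) := by
  ext y
  rw [translateS_apply, SchwartzMap.fourier_coe, SchwartzMap.fourier_coe, Real.fourier_eq',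
    Real.fourier_eq']
  congr 1
  ext v
  rw [modulateS_apply, smul_eq_mul, smul_eq_mul, ← mul_assoc, ← Complex.exp_add, inner_sub_right,
    real_inner_comm ξ v]
  congr 2
  push_cast
  ring

theorem fourier_convS (f g : 𝓢(Rn n, ℂ)) : 𝓕 (convS f g) = mulS (𝓕 f) (𝓕 g) :=
  SchwartzMap.fourier_convolution _ _ _

theorem exists_schwartzNorm_modulateS_le (n N : ℕ) : ∃ M C, 0 ≤ C ∧
    ∀ (ξ : Rn n) (f : 𝓢(Rn n, ℂ)),
      schwartzNorm N (modulateS ξ f) ≤ C * (1 + ‖ξ‖) ^ M * schwartzNorm M f := by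
  obtain ⟨M₁, C₁, hC₁, h₁⟩ := exists_schwartzNorm_map_le
    (FourierTransform.fourierInvCLM ℂ 𝓢(Rn n, ℂ)) N
  obtain ⟨M₂, C₂, hC₂, h₂⟩ := exists_schwartzNorm_map_le
    (FourierTransform.fourierCLM ℂ 𝓢(Rn n, ℂ)) M₁
  refine ⟨max M₁ M₂, C₁ * 2 ^ M₁ * C₂, by positivity, fun ξ f => ?_⟩
  have h3 : modulateS ξ f = 𝓕⁻ (translateS ξ (𝓕 f)) := by
    rw [← fourier_modulateS, FourierTransform.fourierInv_fourier_eq]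
  have h0 := schwartzNorm_nonneg (max M₁ M₂) f
  rw [h3]
  calc schwartzNorm N (𝓕⁻ (translateS ξ (𝓕 f)))
      ≤ C₁ * schwartzNorm M₁ (translateS ξ (𝓕 f)) := h₁ _
    _ ≤ C₁ * (2 ^ M₁ * (1 + ‖ξ‖) ^ M₁ * schwartzNorm M₁ (𝓕 f)) := by
        gcongr; exact schwartzNorm_translateS_le _ _ _
    _ ≤ C₁ * (2 ^ M₁ * (1 + ‖ξ‖) ^ (max M₁ M₂) * (C₂ * schwartzNorm (max M₁ M₂) f)) := by
        gcongr
        · linarith [norm_nonneg ξ]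
        · exact le_max_left _ _
        · exact (h₂ f).trans (by gcongr; exact schwartzNorm_mono (le_max_right _ _) f)
    _ = _ := by ring

/-- The convolution of `M_ξ f` with `g` decays rapidly as `|ξ| → ∞`. -/
theorem exists_schwartzNorm_convS_modulateS_le (n K N : ℕ) : ∃ M C, 0 ≤ C ∧
    ∀ (ξ : Rn n) (f g : 𝓢(Rn n, ℂ)),
      (1 + ‖ξ‖) ^ K * schwartzNorm N (convS (modulateS ξ f) g)
        ≤ C * schwartzNorm M f * schwartzNorm M g := by
  obtain ⟨M₁, C₁, hC₁, h₁⟩ := exists_schwartzNorm_map_le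
    (FourierTransform.fourierInvCLM ℂ 𝓢(Rn n, ℂ)) N
  obtain ⟨M₂, C₂, hC₂, h₂⟩ := exists_schwartzNorm_mulS_translateS_le n K M₁
  obtain ⟨M₃, C₃, hC₃, h₃⟩ := exists_schwartzNorm_map_le
    (FourierTransform.fourierCLM ℂ 𝓢(Rn n, ℂ)) M₂
  refine ⟨M₃, C₁ * C₂ * C₃ * C₃, by positivity, fun ξ f g => ?_⟩
  have h4 : convS (modulateS ξ f) g = 𝓕⁻ (mulS (translateS ξ (𝓕 f)) (𝓕 g)) := by
    rw [← fourier_modulateS, ← fourier_convS, FourierTransform.fourierInv_fourier_eq]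
  have hf := schwartzNorm_nonneg M₃ f
  have hg := schwartzNorm_nonneg M₃ g
  have hf' := schwartzNorm_nonneg M₂ (𝓕 f)
  have hg' := schwartzNorm_nonneg M₂ (𝓕 g)
  rw [h4]
  calc (1 + ‖ξ‖) ^ K * schwartzNorm N (𝓕⁻ (mulS (translateS ξ (𝓕 f)) (𝓕 g)))
      ≤ (1 + ‖ξ‖) ^ K * (C₁ * schwartzNorm M₁ (mulS (translateS ξ (𝓕 f)) (𝓕 g))) := by
        gcongr; exact h₁ _
    _ = C₁ * ((1 + ‖ξ‖) ^ K * schwartzNorm M₁ (mulS (translateS ξ (𝓕 f)) (𝓕 g))) := by ring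
    _ ≤ C₁ * (C₂ * schwartzNorm M₂ (𝓕 f) * schwartzNorm M₂ (𝓕 g)) := by
        gcongr _ * ?_
        exact h₂ _ _ _
    _ ≤ C₁ * (C₂ * (C₃ * schwartzNorm M₃ f) * (C₃ * schwartzNorm M₃ g)) := by
        gcongr
        · exact h₃ f
        · exact h₃ g
    _ = _ := by ring

end SchwartzNorm

/-! ### Absolutely convergent series in the Schwartz space -/

section SchwartzSum

variable {n : ℕ} {I : Type*}

theorem summable_apply_of_summable_schwartzNorm {F : I → 𝓢(Rn n, ℂ)}
    (hF : ∀ N, Summable fun i => schwartzNorm N (F i)) (x : Rn n) : Summable fun i => F i x :=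
  Summable.of_norm_bounded (hF 0) fun i => norm_le_schwartzNorm (F i) x

theorem exists_schwartz_tsum {F : I → 𝓢(Rn n, ℂ)}
    (hF : ∀ N, Summable fun i => schwartzNorm N (F i)) :
    ∃ g : 𝓢(Rn n, ℂ), (∀ x, g x = ∑' i, F i x) ∧
      ∀ N, schwartzNorm N g ≤ ∑' i, schwartzNorm N (F i) := by
  have h1 : ∀ (i : I), ContDiff ℝ ((⊤ : ℕ∞) : WithTop ℕ∞) (F i) := fun i => (F i).smooth ⊤
  have hb : ∀ (k l : ℕ) (i : I) (x : Rn n),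
      ‖x‖ ^ k * ‖iteratedFDeriv ℝ l (F i) x‖ ≤ schwartzNorm (max k l) (F i) := fun k l i x =>
    (SchwartzMap.le_seminorm ℂ k l (F i) x).trans
      (seminorm_le_schwartzNorm (le_max_left _ _) (le_max_right _ _) _)
  have h2 : ∀ k : ℕ, (k : ℕ∞) ≤ ⊤ → Summable fun i => schwartzNorm (max 0 k) (F i) :=
    fun k _ => hF _
  have h3 : ∀ (k : ℕ) (i : I) (x : Rn n), (k : ℕ∞) ≤ ⊤ →
      ‖iteratedFDeriv ℝ k (F i) x‖ ≤ schwartzNorm (max 0 k) (F i) := fun k i x _ => by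
    simpa using hb 0 k i x
  have hbound : ∀ k l N : ℕ, k ≤ N → l ≤ N → ∀ x, ‖x‖ ^ k *
      ‖iteratedFDeriv ℝ l (fun y => ∑' i, F i y) x‖ ≤ ∑' i, schwartzNorm N (F i) := by
    intro k l N hk hl x
    rw [iteratedFDeriv_tsum_apply h1 h2 h3 le_top x]
    have hs : Summable fun i => ‖iteratedFDeriv ℝ l (F i) x‖ :=
      Summable.of_nonneg_of_le (fun _ => norm_nonneg _) (fun i => h3 l i x le_top) (h2 l le_top)
    calc ‖x‖ ^ k * ‖∑' i, iteratedFDeriv ℝ l (F i) x‖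
        ≤ ‖x‖ ^ k * ∑' i, ‖iteratedFDeriv ℝ l (F i) x‖ := by
          gcongr
          exact norm_tsum_le_tsum_norm hs
      _ = ∑' i, ‖x‖ ^ k * ‖iteratedFDeriv ℝ l (F i) x‖ := tsum_mul_left.symm
      _ ≤ _ := by
          refine (hs.mul_left _).tsum_le_tsum (fun i => ?_) (hF N)
          exact (hb k l i x).trans (schwartzNorm_mono (max_le hk hl) _)
  refine ⟨⟨fun x => ∑' i, F i x, contDiff_tsum h1 h2 h3, fun k l =>
    ⟨_, hbound k l (max k l) (le_max_left _ _) (le_max_right _ _)⟩⟩, fun x => rfl, fun N => ?_⟩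
  exact schwartzNorm_le (tsum_nonneg fun i => schwartzNorm_nonneg _ _)
    fun k hk l hl x => hbound k l N hk hl x

/-- A family of Schwartz functions that is absolutely summable for each of the norms `‖·‖_N` is
summable. -/
theorem summable_of_summable_schwartzNorm {F : I → 𝓢(Rn n, ℂ)}
    (hF : ∀ N, Summable fun i => schwartzNorm N (F i)) : Summable F := by
  obtain ⟨g, hg, -⟩ := exists_schwartz_tsum hF
  refine ⟨g, ?_⟩
  rw [HasSum, SummationFilter.unconditional_filter, tendsto_schwartz_nhds]
  intro N
  refine squeeze_zero (fun _ => schwartzNorm_nonneg _ _) (fun s => ?_)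
    (tendsto_tsum_compl_atTop_zero fun i => schwartzNorm N (F i))
  obtain ⟨r, hr, hrN⟩ := exists_schwartz_tsum (F := fun i : {i // i ∉ s} => F i)
    fun N => (hF N).subtype _
  have : ∑ i ∈ s, F i - g = -r := by
    ext x
    have h := (summable_apply_of_summable_schwartzNorm hF x).sum_add_tsum_compl (s := s)
    have hr' : r x = ∑' i : ↑((s : Set I)ᶜ), F i x := hr x
    have h3 : (∑ i ∈ s, F i) x = ∑ i ∈ s, F i x := by
      induction s using Finset.cons_induction with
      | empty => simp
      | cons a s ha ih => 
        simp [Finset.sum_cons]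
    rw [sub_apply, neg_apply, hg, hr', h3, ← h]
    ring
  rw [this, map_neg_eq_map]
  exact hrN N

theorem HasSum.schwartz_apply {F : I → 𝓢(Rn n, ℂ)} {g : 𝓢(Rn n, ℂ)} (h : HasSum F g) (x : Rn n) :
    HasSum (fun i => F i x) (g x) :=
  h.mapL (TemperedDistribution.delta x : 𝓢(Rn n, ℂ) →L[ℂ] ℂ)

end SchwartzSum

/-! ### Weights on the lattice -/

/-- The weight `1 + |k|` on `ℤⁿ`. -/
noncomputable def latticeWeight {n : ℕ} (k : Fin n → ℤ) : ℝ := 1 + ‖latticePt k‖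

section Lattice

variable {n : ℕ}

theorem one_le_latticeWeight (k : Fin n → ℤ) : 1 ≤ latticeWeight k := by
  have := norm_nonneg (latticePt k)
  unfold latticeWeight
  linarith

theorem latticeWeight_pos (k : Fin n → ℤ) : 0 < latticeWeight k :=
  one_pos.trans_le (one_le_latticeWeight k)

theorem one_add_abs_le_latticeWeight (k : Fin n → ℤ) (i : Fin n) :
    1 + |(k i : ℝ)| ≤ latticeWeight k := by
  have := PiLp.norm_apply_le (latticePt k) i
  rw [Real.norm_eq_abs] at this
  unfold latticeWeight
  exact add_le_add le_rfl this

theorem summable_prod_pi {f : ℤ → ℝ} (h0 : ∀ k, 0 ≤ f k) (hf : Summable f) :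
    ∀ n, Summable fun k : Fin n → ℤ => ∏ i, f (k i) := by
  intro n
  induction n with
  | zero => exact Summable.of_finite
  | succ n ih =>
    have h := hf.mul_of_nonneg ih h0 fun k => Finset.prod_nonneg fun i _ => h0 _
    rw [← (Fin.consEquiv fun _ => ℤ).summable_iff]
    refine h.congr fun p => ?_
    simp [Fin.consEquiv, Fin.prod_univ_succ]

theorem summable_inv_latticeWeight_pow (n : ℕ) :
    Summable fun k : Fin n → ℤ => (latticeWeight k ^ (2 * n))⁻¹ := by
  have h1 : Summable fun k : ℤ => ((1 + |(k : ℝ)|) ^ 2)⁻¹ := by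
    have := (Real.summable_one_div_int_pow (p := 2)).2 one_lt_two
    refine Summable.of_norm_bounded_eventually this ?_
    rw [Filter.eventually_cofinite]
    refine (Set.finite_singleton (0 : ℤ)).subset fun k hk => ?_
    by_contra hk0
    refine hk ?_
    have hk1 : 0 < |(k : ℝ)| := abs_pos.2 (by exact_mod_cast hk0)
    rw [one_div, Real.norm_of_nonneg (by positivity), ← sq_abs (k : ℝ)]
    gcongr
    linarith
  refine Summable.of_nonneg_of_le (fun k => ?_) (fun k => ?_)
    (summable_prod_pi (fun k => by positivity) h1 n)
  · have := latticeWeight_pos k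
    positivity
  · rw [Finset.prod_inv_distrib]
    refine inv_anti₀ (Finset.prod_pos fun i _ => by positivity) ?_
    · rw [mul_comm, pow_mul']
      calc ∏ i, (1 + |(k i : ℝ)|) ^ 2 ≤ ∏ _i : Fin n, latticeWeight k ^ 2 := by
            gcongr with i
            exact one_add_abs_le_latticeWeight k i
        _ = _ := by simp

/-- The sum of a family of nonnegative numbers on `ℤⁿ` that decays like a high power of the
weight. -/
theorem summable_of_latticeWeight_pow_mul_le {f : (Fin n → ℤ) → ℝ} (h0 : ∀ k, 0 ≤ f k) {C : ℝ}
    (h : ∀ k, latticeWeight k ^ (2 * n) * f k ≤ C) :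
    Summable f ∧ ∑' k, f k ≤ C * ∑' k : Fin n → ℤ, (latticeWeight k ^ (2 * n))⁻¹ := by
  have h1 : ∀ k, f k ≤ C * (latticeWeight k ^ (2 * n))⁻¹ := fun k => by
    have := pow_pos (latticeWeight_pos k) (2 * n)
    rw [← div_eq_mul_inv, le_div_iff₀ this, mul_comm]
    exact h k
  have h2 := (summable_inv_latticeWeight_pow n).mul_left C
  have h3 := Summable.of_nonneg_of_le h0 h1 h2
  exact ⟨h3, (h3.tsum_le_tsum h1 h2).trans tsum_mul_left.le⟩

end Lattice

/-! ### Convolution, translation, modulation and reflection of Schwartz functions -/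

section ConvAlgebra

variable {n : ℕ}

theorem fourierS_injective {f g : 𝓢(Rn n, ℂ)} (h : 𝓕 f = 𝓕 g) : f = g := by
  rw [← FourierTransform.fourierInv_fourier_eq (F := 𝓢(Rn n, ℂ)) f, h, FourierTransform.fourierInv_fourier_eq]

theorem convS_comm (f g : 𝓢(Rn n, ℂ)) : convS f g = convS g f := by
  refine fourierS_injective ?_
  rw [fourier_convS, fourier_convS]
  ext x
  rw [mulS_apply, mulS_apply, mul_comm]

theorem convS_assoc (f g h : 𝓢(Rn n, ℂ)) : convS (convS f g) h = convS f (convS g h) := by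
  refine fourierS_injective ?_
  simp only [fourier_convS]
  ext x
  simp only [mulS_apply, mul_assoc]

theorem modulateS_convS (ξ : Rn n) (f g : 𝓢(Rn n, ℂ)) :
    modulateS ξ (convS f g) = convS (modulateS ξ f) (modulateS ξ g) := by
  refine fourierS_injective ?_
  simp only [fourier_convS, fourier_modulateS]
  rfl

theorem translateS_convS (x : Rn n) (f g : 𝓢(Rn n, ℂ)) :
    translateS x (convS f g) = convS f (translateS x g) := by
  ext t
  rw [translateS_apply, convS_apply, convS_apply]
  refine MeasureTheory.integral_congr_ae (Eventually.of_forall fun s => ?_)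
  simp only [translateS_apply]
  congr 2
  abel

theorem reflectS_reflectS (f : 𝓢(Rn n, ℂ)) : reflectS (reflectS f) = f := by
  ext t
  simp [reflectS_apply]

theorem reflectS_modulateS (ξ : Rn n) (f : 𝓢(Rn n, ℂ)) :
    reflectS (modulateS ξ f) = modulateS (-ξ) (reflectS f) := by
  ext t
  simp [reflectS_apply, modulateS_apply]

theorem reflectS_convS (f g : 𝓢(Rn n, ℂ)) :
    reflectS (convS f g) = convS (reflectS f) (reflectS g) := by
  ext t
  rw [reflectS_apply, convS_apply, convS_apply, ← MeasureTheory.integral_neg_eq_self]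
  refine MeasureTheory.integral_congr_ae (Eventually.of_forall fun s => ?_)
  simp only [reflectS_apply]
  congr 2
  abel

theorem translateS_translateS (x y : Rn n) (f : 𝓢(Rn n, ℂ)) :
    translateS x (translateS y f) = translateS (x + y) f := by
  ext t
  rw [translateS_apply, translateS_apply, translateS_apply, sub_sub]

theorem translateS_zero (f : 𝓢(Rn n, ℂ)) : translateS 0 f = f := by
  ext t
  simp [translateS_apply]

/-- The function `x ↦ ⟨T_x φ, ρ⟩` is the convolution of the reflection of `φ` with `ρ`. -/
theorem convS_reflectS_apply (φ ρ : 𝓢(Rn n, ℂ)) (x : Rn n) :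
    convS (reflectS φ) ρ x = schwartzToDist (translateS x φ) ρ := by
  rw [convS_apply, schwartzToDist_apply, ← MeasureTheory.integral_sub_left_eq_self _ _ x]
  refine MeasureTheory.integral_congr_ae (Eventually.of_forall fun s => ?_)
  simp only [reflectS_apply, translateS_apply]
  rw [mul_comm, sub_sub_cancel, neg_sub]

theorem schwartzToDist_comm (f g : 𝓢(Rn n, ℂ)) : schwartzToDist f g = schwartzToDist g f := by
  simp only [schwartzToDist_apply, mul_comm]

end ConvAlgebra

theorem schwartzNorm_translateS_sub_le {n : ℕ} (N : ℕ) (f : 𝓢(Rn n, ℂ)) {y : Rn n} (hy : ‖y‖ ≤ 1) :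
    schwartzNorm N (translateS y f - f) ≤ 2 ^ N * (2 ^ (N + 1) * schwartzNorm (N + 1) f) * ‖y‖ := by
  have h0 := schwartzNorm_nonneg (N + 1) f
  refine schwartzNorm_le (by positivity) fun k hk l hl x => ?_
  have h1 : iteratedFDeriv ℝ l (translateS y f - f : 𝓢(Rn n, ℂ)) x
      = iteratedFDeriv ℝ l f (x - y) - iteratedFDeriv ℝ l f x := by
    have h2 : (⇑(translateS y f - f : 𝓢(Rn n, ℂ)) : Rn n → ℂ) = (translateS y f : Rn n → ℂ) - f := rfl
    rw [h2, iteratedFDeriv_sub_apply ((translateS y f).smooth l).contDiffAt (f.smooth l).contDiffAt]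
    congr 1
    exact iteratedFDeriv_comp_sub l y x
  have h3 : ∀ z ∈ Metric.closedBall x ‖y‖, ‖fderiv ℝ (iteratedFDeriv ℝ l f) z‖ * (1 + ‖x‖) ^ k
      ≤ 2 ^ N * (2 ^ (N + 1) * schwartzNorm (N + 1) f) := by
    intro z hz
    rw [mem_closedBall_iff_norm, norm_sub_rev] at hz
    have h4 : 1 + ‖x‖ ≤ 2 * (1 + ‖z‖) := by
      refine (one_add_norm_le_mul x z).trans ?_
      gcongr
      linarith
    rw [norm_fderiv_iteratedFDeriv]
    calc ‖iteratedFDeriv ℝ (l + 1) f z‖ * (1 + ‖x‖) ^ k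
        ≤ ‖iteratedFDeriv ℝ (l + 1) f z‖ * (2 * (1 + ‖z‖)) ^ k := by gcongr
      _ = 2 ^ k * ((1 + ‖z‖) ^ k * ‖iteratedFDeriv ℝ (l + 1) f z‖) := by rw [mul_pow]; ring
      _ ≤ 2 ^ N * (2 ^ (N + 1) * schwartzNorm (N + 1) f) := by
          gcongr ?_ * ?_
          · exact pow_le_pow_right₀ one_le_two hk
          · exact one_add_pow_mul_le_schwartzNorm (by omega) (by omega) f z
  have hx : 0 < (1 + ‖x‖) ^ k := by positivity
  have h5 := (convex_closedBall x ‖y‖).norm_image_sub_le_of_norm_fderiv_le (𝕜 := ℝ)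
    (f := iteratedFDeriv ℝ l f) (x := x) (y := x - y)
    (C := 2 ^ N * (2 ^ (N + 1) * schwartzNorm (N + 1) f) / (1 + ‖x‖) ^ k)
    (fun z _ => (f.smooth ⊤).differentiable_iteratedFDeriv (by exact_mod_cast ENat.natCast_lt_top l) z)
    (fun z hz => (le_div_iff₀ hx).2 (h3 z hz)) (by simp) (by simp)
  rw [h1]
  calc ‖x‖ ^ k * ‖iteratedFDeriv ℝ l f (x - y) - iteratedFDeriv ℝ l f x‖
      ≤ (1 + ‖x‖) ^ k * (2 ^ N * (2 ^ (N + 1) * schwartzNorm (N + 1) f) / (1 + ‖x‖) ^ k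
          * ‖x - y - x‖) := by
        gcongr
        linarith
    _ = _ := by
        rw [sub_sub_cancel_left, norm_neg]
        field_simp

theorem continuous_translateS {n : ℕ} (f : 𝓢(Rn n, ℂ)) : Continuous fun x => translateS x f := by
  rw [continuous_iff_continuousAt]
  intro x
  rw [ContinuousAt, tendsto_schwartz_nhds]
  intro N
  have h1 : Tendsto (fun y => 2 ^ N * (2 ^ (N + 1) * schwartzNorm (N + 1) (translateS x f)) *
      ‖y - x‖) (𝓝 x) (𝓝 0) := by
    have : Continuous fun y => 2 ^ N * (2 ^ (N + 1) * schwartzNorm (N + 1) (translateS x f)) *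
      ‖y - x‖ := by fun_prop
    simpa using this.tendsto x
  refine squeeze_zero' (Eventually.of_forall fun _ => schwartzNorm_nonneg _ _) ?_ h1
  filter_upwards [Metric.closedBall_mem_nhds x one_pos] with y hy
  have h2 : translateS y f = translateS (y - x) (translateS x f) := by
    rw [translateS_translateS, sub_add_cancel]
  rw [h2]
  exact schwartzNorm_translateS_sub_le N _ (mem_closedBall_iff_norm.1 hy)

/-! ### The Poisson summation formula on `ℝⁿ` -/

section Poisson

open MeasureTheory UnitAddTorus

variable {n : ℕ}

theorem latticePt_add (k l : Fin n → ℤ) : latticePt (k + l) = latticePt k + latticePt l := by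
  ext i
  simp [latticePt]

theorem latticePt_neg (k : Fin n → ℤ) : latticePt (-k) = -latticePt k := by
  ext i
  simp [latticePt]

/-- The half open unit box with lower corner `a`. -/
def unitBox (a : Fin n → ℝ) : Set (Fin n → ℝ) := {x | ∀ i, x i ∈ Set.Ioc (a i) (a i + 1)}

theorem measurableSet_unitBox (a : Fin n → ℝ) : MeasurableSet (unitBox a) :=
  MeasurableSet.univ_pi' fun _ => measurableSet_Ioc

theorem unitBox_subset_ball (x : Fin n → ℝ) (hx : x ∈ unitBox 0) :
    ‖(WithLp.toLp 2 x : Rn n)‖ ≤ n := by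
  have h1 : (WithLp.toLp 2 x : Rn n) = ∑ i, EuclideanSpace.single i (x i) := by
    ext j
    simp
  rw [h1]
  refine (norm_sum_le _ _).trans ?_
  calc ∑ i, ‖(EuclideanSpace.single i (x i) : Rn n)‖ ≤ ∑ _i : Fin n, (1 : ℝ) := by
        refine Finset.sum_le_sum fun i _ => ?_
        have := hx i
        simp only [Pi.zero_apply, zero_add, Set.mem_Ioc] at this
        rw [PiLp.norm_single, Real.norm_eq_abs, abs_of_pos this.1]
        exact this.2
    _ = n := by simp

/-- The integral over `ℝⁿ` is the sum of the integrals over the translates of the unit box. -/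
theorem hasSum_setIntegral_unitBox {H : (Fin n → ℝ) → ℂ} (hH : Integrable H) :
    HasSum (fun k : Fin n → ℤ => ∫ x in unitBox 0, H (x + fun i => (k i : ℝ))) (∫ x, H x) := by
  have hdisj : Pairwise (Function.onFun Disjoint fun k : Fin n → ℤ =>
      unitBox fun i => (k i : ℝ)) := by
    intro k l hkl
    rw [Function.onFun, Set.disjoint_left]
    intro x hx hy
    refine hkl (funext fun i => ?_)
    have h1 := hx i
    have h2 := hy i
    rw [Set.mem_Ioc] at h1 h2
    have h3 : (k i : ℝ) < l i + 1 := h1.1.trans_le h2.2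
    have h4 : (l i : ℝ) < k i + 1 := h2.1.trans_le h1.2
    have h5 : k i < l i + 1 := by exact_mod_cast h3
    have h6 : l i < k i + 1 := by exact_mod_cast h4
    omega
  have huniv : (⋃ k : Fin n → ℤ, unitBox fun i => (k i : ℝ)) = Set.univ := by
    refine Set.eq_univ_of_forall fun x => Set.mem_iUnion.2 ⟨fun i => ⌈x i⌉ - 1, fun i => ?_⟩
    push_cast
    exact ⟨by linarith [Int.ceil_lt_add_one (x i)], by linarith [Int.le_ceil (x i)]⟩
  have h := hasSum_integral_iUnion (f := H) (μ := volume)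
    (fun k : Fin n → ℤ => measurableSet_unitBox fun i => (k i : ℝ)) hdisj
    (by rw [huniv]; exact hH.integrableOn)
  rw [huniv, setIntegral_univ] at h
  refine hasSum_of_eq (fun k => ?_) h
  have hmp := measurePreserving_add_right (volume : Measure (Fin n → ℝ)) fun i => (k i : ℝ)
  rw [← hmp.setIntegral_preimage_emb (MeasurableEquiv.addRight _).measurableEmbedding H
    (unitBox fun i => (k i : ℝ))]
  congr 2
  ext x
  simp only [unitBox, Set.mem_ofPred_eq, Set.mem_preimage, Pi.add_apply, Pi.zero_apply, zero_add,
    Set.mem_Ioc]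
  refine forall_congr' fun i => ?_
  constructor <;> rintro ⟨h1, h2⟩ <;> constructor <;> linarith

/-- The periodization `t ↦ ∑ₖ G (t + k)` of a Schwartz function. -/
noncomputable def periodize (G : 𝓢(Rn n, ℂ)) (t : Rn n) : ℂ := ∑' k : Fin n → ℤ, G (t + latticePt k)

theorem norm_apply_add_latticePt_le (G : 𝓢(Rn n, ℂ)) (t : Rn n) (k : Fin n → ℤ) :
    ‖G (t + latticePt k)‖ ≤ (1 + ‖t‖) ^ (2 * n) *
      (2 ^ (2 * n) * schwartzNorm (2 * n) G * (latticeWeight k ^ (2 * n))⁻¹) := by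
  have h1 := one_add_norm_le_mul (latticePt k) (-t)
  rw [sub_neg_eq_add, norm_neg, add_comm (latticePt k)] at h1
  have h2 := pow_pos (latticeWeight_pos k) (2 * n)
  rw [← mul_assoc, ← div_eq_mul_inv, le_div_iff₀ h2]
  calc ‖G (t + latticePt k)‖ * latticeWeight k ^ (2 * n)
      ≤ ‖G (t + latticePt k)‖ * ((1 + ‖t + latticePt k‖) * (1 + ‖t‖)) ^ (2 * n) := by
        gcongr
        · exact (latticeWeight_pos k).le
        · exact h1
    _ = (1 + ‖t‖) ^ (2 * n) * ((1 + ‖t + latticePt k‖) ^ (2 * n) * ‖G (t + latticePt k)‖) := by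
        rw [mul_pow]; ring
    _ ≤ _ := by
        gcongr _ * ?_
        exact one_add_pow_mul_norm_le le_rfl G _

theorem summable_norm_apply_add_latticePt (G : 𝓢(Rn n, ℂ)) (t : Rn n) :
    Summable fun k : Fin n → ℤ => ‖G (t + latticePt k)‖ :=
  Summable.of_nonneg_of_le (fun _ => norm_nonneg _) (norm_apply_add_latticePt_le G t)
    (((summable_inv_latticeWeight_pow n).mul_left _).mul_left _)

theorem continuous_periodize (G : 𝓢(Rn n, ℂ)) : Continuous (periodize G) := by
  have h0 : ∀ t : Rn n, ((1 + ‖t‖ : ℝ) : ℂ) ^ (2 * n) ≠ 0 := fun t =>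
    pow_ne_zero _ (Complex.ofReal_ne_zero.2 (by positivity))
  have h : Continuous fun t : Rn n =>
      ∑' k : Fin n → ℤ, G (t + latticePt k) / ((1 + ‖t‖ : ℝ) : ℂ) ^ (2 * n) := by
    refine continuous_tsum (fun k => ?_) ((summable_inv_latticeWeight_pow n).mul_left
      (2 ^ (2 * n) * schwartzNorm (2 * n) G)) fun k t => ?_
    · refine Continuous.div (by fun_prop) (by fun_prop) h0
    · rw [norm_div, norm_pow, Complex.norm_real, Real.norm_of_nonneg (by positivity),
        div_le_iff₀ (by positivity), mul_comm]
      exact norm_apply_add_latticePt_le G t k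
  have h2 : periodize G = fun t => ((1 + ‖t‖ : ℝ) : ℂ) ^ (2 * n) *
      ∑' k : Fin n → ℤ, G (t + latticePt k) / ((1 + ‖t‖ : ℝ) : ℂ) ^ (2 * n) := by
    funext t
    rw [tsum_div_const, mul_div_cancel₀ _ (h0 t)]
    rfl
  rw [h2]
  exact Continuous.mul (by fun_prop) h

theorem periodize_add_latticePt (G : 𝓢(Rn n, ℂ)) (t : Rn n) (l : Fin n → ℤ) :
    periodize G (t + latticePt l) = periodize G t := by
  rw [periodize, periodize, ← (Equiv.addLeft l).tsum_eq fun k => G (t + latticePt k)]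
  refine tsum_congr fun k => ?_
  rw [Equiv.coe_addLeft, latticePt_add, add_assoc]

/-- The projection of `ℝⁿ` onto the torus. -/
noncomputable def toTorus : C(Fin n → ℝ, UnitAddTorus (Fin n)) where
  toFun x i := (x i : UnitAddCircle)
  continuous_toFun := continuous_pi fun i => (AddCircle.continuous_mk' 1).comp (continuous_apply i)

theorem toTorus_apply (x : Fin n → ℝ) (i : Fin n) : toTorus x i = (x i : UnitAddCircle) := rfl

theorem isOpenQuotientMap_toTorus : IsOpenQuotientMap (toTorus : C(Fin n → ℝ, UnitAddTorus (Fin n))) :=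
  IsOpenQuotientMap.piMap fun _ => QuotientAddGroup.isOpenQuotientMap_mk

theorem periodize_eq_of_toTorus_eq (G : 𝓢(Rn n, ℂ)) {x y : Fin n → ℝ}
    (hxy : toTorus x = toTorus y) :
    periodize G (WithLp.toLp 2 x) = periodize G (WithLp.toLp 2 y) := by
  have h : ∀ i, ∃ m : ℤ, x i = y i + m := fun i => by
    have h1 : ((y i : ℝ) : UnitAddCircle) = (x i : UnitAddCircle) := (congrFun hxy i).symm
    obtain ⟨m, hm⟩ := QuotientAddGroup.eq.1 h1
    refine ⟨m, ?_⟩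
    simp only [zsmul_eq_mul, mul_one] at hm
    linarith
  choose m hm using h
  have : (WithLp.toLp 2 x : Rn n) = WithLp.toLp 2 y + latticePt m := by
    ext i
    simp [latticePt, hm i]
  rw [this, periodize_add_latticePt]

/-- The periodization of a Schwartz function as a continuous function on the torus. -/
noncomputable def torusPeriodize (G : 𝓢(Rn n, ℂ)) : C(UnitAddTorus (Fin n), ℂ) :=
  isOpenQuotientMap_toTorus.isQuotientMap.lift
    ⟨fun x => periodize G (WithLp.toLp 2 x),
      (continuous_periodize G).comp (PiLp.continuous_toLp 2 _)⟩
    fun _ _ hxy => periodize_eq_of_toTorus_eq G hxy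

theorem torusPeriodize_toTorus (G : 𝓢(Rn n, ℂ)) (x : Fin n → ℝ) :
    torusPeriodize G (toTorus x) = periodize G (WithLp.toLp 2 x) := by
  have h := isOpenQuotientMap_toTorus.isQuotientMap.lift_comp
    (⟨fun x => periodize G (WithLp.toLp 2 x),
      (continuous_periodize G).comp (PiLp.continuous_toLp 2 _)⟩ : C(Fin n → ℝ, ℂ))
    fun _ _ hxy => periodize_eq_of_toTorus_eq G hxy
  exact DFunLike.congr_fun h x

theorem mFourier_toTorus (j : Fin n → ℤ) (x : Fin n → ℝ) :
    mFourier j (toTorus x) = character (latticePt j) (WithLp.toLp 2 x) := by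
  simp only [mFourier, toTorus_apply, ContinuousMap.coe_mk, fourier_coe_apply, character,
    ← Complex.exp_sum]
  congr 1
  simp only [PiLp.inner_apply, latticePt, Complex.ofReal_sum, Finset.mul_sum]
  refine Finset.sum_congr rfl fun i _ => ?_
  simp
  ring

theorem character_add_right (ξ x y : Rn n) :
    character ξ (x + y) = character ξ x * character ξ y := by
  simp only [character, ← Complex.exp_add, inner_add_right]
  congr 1
  push_cast
  ring

theorem character_latticePt (j k : Fin n → ℤ) : character (latticePt j) (latticePt k) = 1 := by
  rw [character, Complex.exp_eq_one_iff]
  refine ⟨∑ i, j i * k i, ?_⟩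
  simp only [PiLp.inner_apply, latticePt, Complex.ofReal_sum]
  push_cast
  rw [mul_comm]
  congr 1
  refine Finset.sum_congr rfl fun i _ => ?_
  simp
  ring

theorem norm_character (ξ t : Rn n) : ‖character ξ t‖ = 1 := by
  rw [character, Complex.norm_exp]
  simp

theorem continuous_character (ξ : Rn n) : Continuous (character ξ) := by
  unfold character
  fun_prop

theorem fourier_apply_eq (G : 𝓢(Rn n, ℂ)) (ξ : Rn n) :
    𝓕 G ξ = ∫ x, character (-ξ) x * G x := by
  rw [SchwartzMap.fourier_coe, Real.fourier_eq']
  congr 1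
  ext x
  rw [smul_eq_mul, character, inner_neg_left, real_inner_comm]
  congr 2
  push_cast
  ring

theorem mFourierCoeff_torusPeriodize (G : 𝓢(Rn n, ℂ)) (j : Fin n → ℤ) :
    mFourierCoeff (torusPeriodize G) j = 𝓕 G (latticePt j) := by
  set H : (Fin n → ℝ) → ℂ := fun x =>
    character (-latticePt j) (WithLp.toLp 2 x) * G (WithLp.toLp 2 x) with hH
  have hc : Continuous H := by
    refine ((continuous_character _).comp (PiLp.continuous_toLp 2 _)).mul ?_
    exact G.continuous.comp (PiLp.continuous_toLp 2 _)
  have hG : Integrable (fun x : Fin n → ℝ => G (WithLp.toLp 2 x)) :=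
    ((PiLp.volume_preserving_toLp (Fin n)).integrable_comp_emb
      (MeasurableEquiv.toLp 2 (Fin n → ℝ)).measurableEmbedding).2 G.integrable
  have hnorm : ∀ x, ‖H x‖ = ‖G (WithLp.toLp 2 x)‖ := fun x => by
    rw [hH, norm_mul, norm_character, one_mul]
  have hint : Integrable H := hG.congr' hc.aestronglyMeasurable
    (Eventually.of_forall fun x => (hnorm x).symm)
  have hper : ∀ (k : Fin n → ℤ) (x : Fin n → ℝ), H (x + fun i => (k i : ℝ))
      = character (-latticePt j) (WithLp.toLp 2 x) * G (WithLp.toLp 2 x + latticePt k) := by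
    intro k x
    have h1 : (WithLp.toLp 2 (x + fun i => (k i : ℝ)) : Rn n) = WithLp.toLp 2 x + latticePt k := rfl
    simp only [hH]
    rw [h1, character_add_right, ← latticePt_neg, character_latticePt, mul_one]
  have hfin : volume (unitBox (0 : Fin n → ℝ)) < ⊤ := by
    have : unitBox (0 : Fin n → ℝ) ⊆ Set.Icc 0 1 := fun x hx =>
      ⟨fun i => (hx i).1.le, fun i => by simpa using (hx i).2⟩
    exact (measure_mono this).trans_lt isCompact_Icc.measure_lt_top
  have hsum : HasSum (fun k : Fin n → ℤ => ∫ x in unitBox 0, H (x + fun i => (k i : ℝ)))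
      (∫ x in unitBox 0, ∑' k : Fin n → ℤ, H (x + fun i => (k i : ℝ))) := by
    refine hasSum_integral_of_summable_integral_norm (fun k => ?_) ?_
    · exact (hint.comp_add_right _).integrableOn
    · refine Summable.of_nonneg_of_le (fun k => by positivity) (fun k => ?_)
        (((summable_inv_latticeWeight_pow n).mul_left
          ((1 + (n : ℝ)) ^ (2 * n) * (2 ^ (2 * n) * schwartzNorm (2 * n) G))).mul_right
            (volume.real (unitBox (0 : Fin n → ℝ))))
      have h3 := norm_setIntegral_le_of_norm_le_const (μ := volume)
        (f := fun x => ‖H (x + fun i => (k i : ℝ))‖)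
        (C := (1 + (n : ℝ)) ^ (2 * n) * (2 ^ (2 * n) * schwartzNorm (2 * n) G) *
          (latticeWeight k ^ (2 * n))⁻¹) hfin fun x hx => by
          rw [norm_norm, hper, norm_mul, norm_character, one_mul]
          refine (norm_apply_add_latticePt_le G _ k).trans ?_
          rw [mul_assoc ((1 + (n : ℝ)) ^ (2 * n))]
          have h6 := unitBox_subset_ball x hx
          have h4 := schwartzNorm_nonneg (2 * n) G
          have h5 := latticeWeight_pos k
          gcongr
      exact (le_abs_self _).trans h3
  rw [mFourierCoeff_eq_integral _ _ 0, fourier_apply_eq,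
    ← (PiLp.volume_preserving_toLp (Fin n)).integral_comp
      (MeasurableEquiv.toLp 2 (Fin n → ℝ)).measurableEmbedding,
    (hasSum_setIntegral_unitBox hint).unique hsum]
  refine setIntegral_congr_fun (measurableSet_unitBox 0) fun x _ => ?_
  change mFourier (-j) (toTorus x) • torusPeriodize G (toTorus x) = _
  rw [mFourier_toTorus, torusPeriodize_toTorus, smul_eq_mul, periodize, ← tsum_mul_left,
    latticePt_neg]
  exact tsum_congr fun k => (hper k x).symm

/-- Poisson summation for Schwartz functions on `ℝⁿ`. -/
theorem hasSum_fourier_mul_character (G : 𝓢(Rn n, ℂ)) (t : Rn n) :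
    HasSum (fun j : Fin n → ℤ => 𝓕 G (latticePt j) * character (latticePt j) t)
      (∑' k : Fin n → ℤ, G (t + latticePt k)) := by
  have h1 : Summable (mFourierCoeff (torusPeriodize G)) := by
    have h2 := summable_norm_apply_add_latticePt (𝓕 G) 0
    simp only [zero_add] at h2
    refine Summable.of_norm (h2.congr fun j => ?_)
    rw [mFourierCoeff_torusPeriodize]
  have h3 := hasSum_mFourier_series_apply_of_summable h1 (toTorus (WithLp.ofLp t))
  rw [torusPeriodize_toTorus] at h3
  refine hasSum_of_eq (fun j => ?_) h3
  rw [mFourierCoeff_torusPeriodize, mFourier_toTorus, smul_eq_mul]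

end Poisson

/-! ### Automatic continuity -/

section ClosedGraph

variable {n : ℕ} {G : Type*} [NormedAddCommGroup G] [NormedSpace ℂ G] [CompleteSpace G]

theorem summable_schwartzNorm_geometric_smul {θ : ℕ → 𝓢(Rn n, ℂ)}
    (hθ : ∀ N, ∃ C, ∀ i, schwartzNorm N (θ i) ≤ C) (c : lp (fun _ : ℕ => ℂ) ∞) (N : ℕ) :
    Summable fun i => schwartzNorm N ((((2 : ℂ)⁻¹) ^ i * c i) • θ i) := by
  obtain ⟨C, hC⟩ := hθ N
  refine Summable.of_nonneg_of_le (fun _ => schwartzNorm_nonneg _ _) (fun i => ?_)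
    ((summable_geometric_of_lt_one (r := (2 : ℝ)⁻¹) (by norm_num) (by norm_num)).mul_right (‖c‖ * C))
  have h1 := lp.norm_apply_le_norm (by simp) c i
  rw [map_smul_eq_mul, norm_mul, norm_pow, norm_inv, mul_assoc, Complex.norm_ofNat]
  have := (schwartzNorm_nonneg N (θ i)).trans (hC i)
  gcongr
  exact hC i

/-- A linear map from the Schwartz space to a Banach space is continuous as soon as its composition
with a continuous injection into a Hausdorff space is. The closed graph theorem is applied to the
composition with the maps `c ↦ ∑ᵢ 2⁻ⁱ cᵢ θᵢ` from `ℓ^∞` given by bounded sequences `θ`. -/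
theorem continuous_of_continuous_comp_injective {H : Type*} [TopologicalSpace H] [T2Space H]
    {π : G → H} (hπ : Continuous π) (hinj : Function.Injective π) (L : 𝓢(Rn n, ℂ) →ₗ[ℂ] G)
    (hL : Continuous (π ∘ L)) : Continuous L := by
  refine LinearMap.continuous_of_locally_bounded L fun s hs => ?_
  rw [NormedSpace.isVonNBounded_iff]
  by_contra hub
  rw [isVonNBounded_iff_schwartzNorm] at hs
  have hex : ∀ i : ℕ, ∃ θ ∈ s, (4 : ℝ) ^ i < ‖L θ‖ := by
    intro i
    by_contra! hcon
    exact hub (isBounded_iff_forall_norm_le.2 ⟨4 ^ i, by rintro _ ⟨θ, hθ, rfl⟩; exact hcon θ hθ⟩)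
  choose θ hθs hθ using hex
  have hb : ∀ N, ∃ C, ∀ i, schwartzNorm N (θ i) ≤ C := fun N =>
    (hs N).imp fun C hC i => hC _ (hθs i)
  have hsum : ∀ c : lp (fun _ : ℕ => ℂ) ∞, Summable fun i => (((2 : ℂ)⁻¹) ^ i * c i) • θ i :=
    fun c => summable_of_summable_schwartzNorm (summable_schwartzNorm_geometric_smul hb c)
  let T : lp (fun _ : ℕ => ℂ) ∞ →ₗ[ℂ] 𝓢(Rn n, ℂ) :=
    { toFun := fun c => ∑' i, (((2 : ℂ)⁻¹) ^ i * c i) • θ i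
      map_add' := fun c d => by
        rw [← (hsum c).tsum_add (hsum d)]
        exact tsum_congr fun i => by rw [← add_smul, ← mul_add]; rfl
      map_smul' := fun z c => by
        rw [RingHom.id_apply, ← (hsum c).tsum_const_smul]
        refine tsum_congr fun i => ?_
        rw [smul_smul, mul_left_comm]
        rfl }
  have hT : ∀ N, ∃ C, ∀ c, schwartzNorm N (T c) ≤ C * ‖c‖ := by
    intro N
    obtain ⟨C, hC⟩ := hb N
    refine ⟨∑' i, (2 : ℝ)⁻¹ ^ i * C, fun c => ?_⟩
    have hs1 := summable_schwartzNorm_geometric_smul hb c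
    obtain ⟨g, hg, hgN⟩ := exists_schwartz_tsum hs1
    have : T c = g := by
      ext x
      rw [hg]
      exact ((hsum c).hasSum.schwartz_apply x).tsum_eq.symm
    rw [this, ← tsum_mul_right]
    have hs2 : Summable fun i => (2 : ℝ)⁻¹ ^ i * C * ‖c‖ :=
      ((summable_geometric_of_lt_one (by norm_num) (by norm_num)).mul_right C).mul_right ‖c‖
    refine (hgN N).trans ((hs1 N).tsum_le_tsum (fun i => ?_) hs2)
    have h1 := lp.norm_apply_le_norm (by simp) c i
    rw [map_smul_eq_mul, norm_mul, norm_pow, norm_inv, Complex.norm_ofNat, mul_assoc, mul_assoc,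
      mul_comm C]
    gcongr
    exact hC i
  have hTcont : Continuous T := by
    refine WithSeminorms.continuous_normedSpace_dom _ (schwartz_withSeminorms ℂ (Rn n) ℂ) T ?_
    intro m
    obtain ⟨C, hC⟩ := hT (max m.1 m.2)
    refine ⟨⟨max C 0, le_max_right _ _⟩, fun c => ?_⟩
    calc SchwartzMap.seminorm ℂ m.1 m.2 (T c) ≤ schwartzNorm (max m.1 m.2) (T c) :=
          seminorm_le_schwartzNorm (le_max_left _ _) (le_max_right _ _) _
      _ ≤ C * ‖c‖ := hC c
      _ ≤ max C 0 * ‖c‖ := by gcongr; exact le_max_left _ _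
  have hLT : Continuous (L ∘ₗ T) := by
    refine LinearMap.continuous_of_seq_closed_graph _ fun u x y hu hy => ?_
    refine hinj (tendsto_nhds_unique ((hπ.tendsto y).comp hy) ?_)
    exact ((hL.comp hTcont).tendsto x).comp hu
  obtain ⟨K, -, hK⟩ := (⟨L ∘ₗ T, hLT⟩ : lp (fun _ : ℕ => ℂ) ∞ →L[ℂ] G).bound
  obtain ⟨i, hi⟩ := pow_unbounded_of_one_lt K one_lt_two
  have h2 := hK (lp.single ∞ i 1)
  have h3 : T (lp.single ∞ i 1) = ((2 : ℂ)⁻¹ ^ i) • θ i := by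
    change ∑' j, _ = _
    rw [tsum_eq_single i]
    · simp
    · intro j hj
      simp [lp.single_apply, hj]
  rw [lp.norm_single (by simp), norm_one, mul_one] at h2
  have h4 : ‖L (T (lp.single ∞ i 1))‖ ≤ K := h2
  rw [h3, map_smul, norm_smul, norm_pow, norm_inv, Complex.norm_ofNat] at h4
  have h5 := hθ i
  have h6 : (2 : ℝ) ^ i * (2 ^ i) < ‖L (θ i)‖ := by
    rw [← mul_pow]; norm_num; exact h5
  rw [inv_pow, inv_mul_le_iff₀ (by positivity)] at h4
  have h7 : (2 : ℝ) ^ i * 2 ^ i < 2 ^ i * K := h6.trans_le h4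
  linarith [lt_of_mul_lt_mul_left h7 (by positivity)]

end ClosedGraph

/-! ### Convolution and modulation operators on a space of distributions -/

section Action

variable {n : ℕ} {E : Type*} [NormedAddCommGroup E] [NormedSpace ℂ E]

theorem translateD_apply (x : Rn n) (f : 𝓢'(Rn n, ℂ)) (ρ : 𝓢(Rn n, ℂ)) :
    translateD x f ρ = f (translateS (-x) ρ) := rfl

theorem modulateD_apply (ξ : Rn n) (f : 𝓢'(Rn n, ℂ)) (ρ : 𝓢(Rn n, ℂ)) :
    modulateD ξ f ρ = f (modulateS ξ ρ) := rfl

theorem convD_apply (θ : 𝓢(Rn n, ℂ)) (f : 𝓢'(Rn n, ℂ)) (ρ : 𝓢(Rn n, ℂ)) :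
    convD θ f ρ = f (convS (reflectS θ) ρ) := rfl

/-- The evaluation of tempered distributions at a Schwartz function. -/
noncomputable def distEval (ρ : 𝓢(Rn n, ℂ)) : 𝓢'(Rn n, ℂ) →L[ℂ] ℂ :=
  PointwiseConvergenceCLM.evalCLM _ ℂ ρ

theorem distEval_apply (ρ : 𝓢(Rn n, ℂ)) (f : 𝓢'(Rn n, ℂ)) : distEval ρ f = f ρ := rfl

theorem hasSum_dist_iff {I : Type*} {F : I → 𝓢'(Rn n, ℂ)} {f : 𝓢'(Rn n, ℂ)} :
    HasSum F f ↔ ∀ ρ, HasSum (fun i => F i ρ) (f ρ) := by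
  constructor
  · intro h ρ
    exact h.mapL (distEval ρ)
  · intro h
    have hind := (PointwiseConvergenceCLM.isInducing_inducingFn (RingHom.id ℂ) 𝓢(Rn n, ℂ) ℂ)
    rw [HasSum, hind.tendsto_nhds_iff, tendsto_pi_nhds]
    intro ρ
    refine (h ρ).congr fun s => ?_
    exact (map_sum (distEval ρ) F s).symm

theorem translateD_schwartzToDist (x : Rn n) (φ : 𝓢(Rn n, ℂ)) :
    translateD x (schwartzToDist φ) = schwartzToDist (translateS x φ) := by
  ext ρ
  rw [translateD_apply, schwartzToDist_apply, schwartzToDist_apply,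
    ← MeasureTheory.integral_sub_right_eq_self _ x]
  simp [translateS_apply]

theorem modulateD_schwartzToDist (ξ : Rn n) (φ : 𝓢(Rn n, ℂ)) :
    modulateD ξ (schwartzToDist φ) = schwartzToDist (modulateS ξ φ) := by
  ext ρ
  rw [modulateD_apply, schwartzToDist_apply, schwartzToDist_apply]
  congr 1
  ext t
  rw [modulateS_apply, modulateS_apply]
  ring

theorem schwartzToDist_apply_eq_convS (φ ρ : 𝓢(Rn n, ℂ)) :
    schwartzToDist φ ρ = convS (reflectS φ) ρ 0 := by
  rw [convS_reflectS_apply, translateS_zero]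

theorem convD_schwartzToDist (θ φ : 𝓢(Rn n, ℂ)) :
    convD θ (schwartzToDist φ) = schwartzToDist (convS θ φ) := by
  ext ρ
  rw [convD_apply, schwartzToDist_apply_eq_convS, schwartzToDist_apply_eq_convS, reflectS_convS,
    ← convS_assoc, convS_comm (reflectS φ)]

/-- The two properties of a (D)TMIB that enter the proof: convolution by a Schwartz function and
modulation act on `E`, with a norm bounded by a Schwartz norm of the function, respectively of
polynomial growth in the frequency. -/
structure IsConvModBounded (ι : DistInclusion n E) : Prop where
  conv : ∃ M C, 0 ≤ C ∧ ∀ (θ : 𝓢(Rn n, ℂ)) (e : E), ∃ e', ι.toDist e' = convD θ (ι.toDist e) ∧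
    ‖e'‖ ≤ C * schwartzNorm M θ * ‖e‖
  modulate : ∃ (K : ℕ) (C : ℝ), 0 ≤ C ∧ ∀ (ξ : Rn n) (e : E), ∃ e',
    ι.toDist e' = modulateD ξ (ι.toDist e) ∧ ‖e'‖ ≤ C * (1 + ‖ξ‖) ^ K * ‖e‖

/-- An operator on `E` that is given by its action on the underlying distributions, as a continuous
linear map. -/
theorem exists_clm_of_toDist_eq (ι : DistInclusion n E) (A : 𝓢'(Rn n, ℂ) →L[ℂ] 𝓢'(Rn n, ℂ)) {C : ℝ}
    (h : ∀ e, ∃ e', ι.toDist e' = A (ι.toDist e) ∧ ‖e'‖ ≤ C * ‖e‖) :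
    ∃ T : E →L[ℂ] E, (∀ e, ι.toDist (T e) = A (ι.toDist e)) ∧ ∀ e, ‖T e‖ ≤ C * ‖e‖ := by
  choose T hT hTn using h
  refine ⟨LinearMap.mkContinuous
    { toFun := T
      map_add' := fun a b => ι.injective (by simp only [hT, map_add])
      map_smul' := fun z a => ι.injective (by simp only [hT, map_smul, RingHom.id_apply]) } C hTn,
    hT, hTn⟩

theorem IsTMIB.isConvModBounded [CompleteSpace E] {ι : DistInclusion n E} (h : IsTMIB ι) :
    IsConvModBounded ι := by
  constructor
  · obtain ⟨j, hj, hjι⟩ := h.dense_inclusion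
    obtain ⟨C, hC, τ, hτ, hT⟩ := h.translate_bound
    set K := ⌈τ⌉₊ with hK
    have hint : MeasureTheory.Integrable (fun x : Rn n => (1 + ‖x‖) ^ (-(n + 1 : ℝ))) :=
      integrable_one_add_norm (by simp)
    set I := ∫ x : Rn n, (1 + ‖x‖) ^ (-(n + 1 : ℝ)) with hI
    have hI0 : 0 ≤ I := MeasureTheory.integral_nonneg fun x => by positivity
    refine ⟨K + (n + 1), 2 ^ (K + (n + 1)) * C * I, by positivity, fun θ => ?_⟩
    have h0 := schwartzNorm_nonneg (K + (n + 1)) θ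
    have hbound : ∀ φ : 𝓢(Rn n, ℂ), ‖j (convS θ φ)‖
        ≤ 2 ^ (K + (n + 1)) * C * I * schwartzNorm (K + (n + 1)) θ * ‖j φ‖ := by
      intro φ
      have h1 : ∀ x, ‖θ x • j (translateS x φ)‖ ≤ 2 ^ (K + (n + 1)) * C *
          schwartzNorm (K + (n + 1)) θ * ‖j φ‖ * (1 + ‖x‖) ^ (-(n + 1 : ℝ)) := by
        intro x
        have hx : 0 < 1 + ‖x‖ := by positivity
        have hx1 : 1 ≤ 1 + ‖x‖ := by linarith [norm_nonneg x]
        have h2 : ‖j (translateS x φ)‖ ≤ C * (1 + ‖x‖) ^ K * ‖j φ‖ := by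
          refine (hT x (j φ) _ (by rw [hjι, hjι, translateD_schwartzToDist])).trans ?_
          gcongr
          rw [← Real.rpow_natCast]
          exact Real.rpow_le_rpow_of_exponent_le hx1 (Nat.le_ceil τ)
        have h3 := one_add_pow_mul_norm_le le_rfl θ x (N := K + (n + 1))
        have h4 : (1 + ‖x‖) ^ (-(n + 1 : ℝ)) = ((1 + ‖x‖) ^ (n + 1))⁻¹ := by
          rw [Real.rpow_neg hx.le]
          norm_cast
        rw [norm_smul, h4, ← div_eq_mul_inv, le_div_iff₀ (by positivity)]
        calc ‖θ x‖ * ‖j (translateS x φ)‖ * (1 + ‖x‖) ^ (n + 1)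
            ≤ ‖θ x‖ * (C * (1 + ‖x‖) ^ K * ‖j φ‖) * (1 + ‖x‖) ^ (n + 1) := by gcongr
          _ = C * ‖j φ‖ * ((1 + ‖x‖) ^ (K + (n + 1)) * ‖θ x‖) := by rw [pow_add]; ring
          _ ≤ C * ‖j φ‖ * (2 ^ (K + (n + 1)) * schwartzNorm (K + (n + 1)) θ) := by
              gcongr _ * ?_
          _ = _ := by ring
      have hint2 : MeasureTheory.Integrable fun x => θ x • j (translateS x φ) := by
        refine (hint.const_mul (2 ^ (K + (n + 1)) * C *
          schwartzNorm (K + (n + 1)) θ * ‖j φ‖)).mono' ?_ (Eventually.of_forall h1)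
        exact (θ.continuous.smul (j.continuous.comp (continuous_translateS φ))).aestronglyMeasurable
      have hval : j (convS θ φ) = ∫ x, θ x • j (translateS x φ) := by
        apply ι.injective
        ext ρ
        have h5 := ((distEval ρ).comp ι.toDist).integral_comp_comm hint2
        simp only [ContinuousLinearMap.comp_apply, distEval_apply] at h5
        rw [← h5, hjι]
        calc schwartzToDist (convS θ φ) ρ = schwartzToDist θ (convS (reflectS φ) ρ) := by
              rw [← convD_schwartzToDist, convD_apply, schwartzToDist_apply_eq_convS,
                schwartzToDist_apply_eq_convS, ← convS_assoc, ← convS_assoc,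
                convS_comm (reflectS φ)]
          _ = _ := by
              rw [schwartzToDist_apply]
              congr 1
              ext x
              rw [map_smul, hjι, convS_reflectS_apply, mul_comm]
              rfl
      rw [hval]
      refine (MeasureTheory.norm_integral_le_of_norm_le (hint.const_mul (2 ^ (K + (n + 1)) * C *
          schwartzNorm (K + (n + 1)) θ * ‖j φ‖)) (Eventually.of_forall h1)).trans ?_
      rw [MeasureTheory.integral_const_mul]
      exact le_of_eq (by ring)
    set f : 𝓢(Rn n, ℂ) →ₗ[ℂ] E := (j.comp (convS θ)).toLinearMap with hf
    set T := f.extendOfNorm (j : 𝓢(Rn n, ℂ) →ₗ[ℂ] E) with hTdef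
    have hTj : ∀ φ, T (j φ) = j (convS θ φ) := fun φ =>
      LinearMap.extendOfNorm_eq (f := f) (e := (j : 𝓢(Rn n, ℂ) →ₗ[ℂ] E)) hj ⟨_, hbound⟩ φ
    have hTι : ∀ e, ι.toDist (T e) = convD θ (ι.toDist e) := by
      intro e
      refine congrFun (hj.equalizer (g := fun e => ι.toDist (T e))
        (h := fun e => convD θ (ι.toDist e)) (by fun_prop) (by fun_prop) ?_) e
      funext φ
      simp only [Function.comp_apply, hTj, hjι, convD_schwartzToDist]
    exact fun e => ⟨T e, hTι e, LinearMap.norm_extendOfNorm_apply_le (f := f)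
      (e := (j : 𝓢(Rn n, ℂ) →ₗ[ℂ] E)) hj _ hbound e⟩
  · obtain ⟨C, hC, τ, hτ, hM⟩ := h.modulate_bound
    refine ⟨⌈τ⌉₊, C, hC.le, fun ξ e => ?_⟩
    obtain ⟨e', he'⟩ := h.modulate_mem ξ e
    refine ⟨e', he', (hM ξ e e' he').trans ?_⟩
    gcongr
    rw [← Real.rpow_natCast]
    exact Real.rpow_le_rpow_of_exponent_le (by linarith [norm_nonneg ξ]) (Nat.le_ceil τ)

/-- Operators on the dual of a TMIB are obtained by transposition. -/
theorem exists_transpose {F : Type*} [NormedAddCommGroup F] [NormedSpace ℂ F]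
    {ι : DistInclusion n E} {κ : DistInclusion n F} (hκ : IsTMIB κ) (Φ : E ≃L[ℂ] StrongDual ℂ F)
    (hΦ : ∀ (e : E) (φ : 𝓢(Rn n, ℂ)) (f : F),
      κ.toDist f = schwartzToDist φ → ι.toDist e φ = Φ e f)
    (A : 𝓢'(Rn n, ℂ) →L[ℂ] 𝓢'(Rn n, ℂ)) (B : 𝓢'(Rn n, ℂ) →L[ℂ] 𝓢'(Rn n, ℂ))
    (b : 𝓢(Rn n, ℂ) → 𝓢(Rn n, ℂ)) (hB : ∀ φ, B (schwartzToDist φ) = schwartzToDist (b φ))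
    (hA : ∀ f φ, A f φ = f (b φ)) {C : ℝ} (hC : 0 ≤ C)
    (h : ∀ e, ∃ e', κ.toDist e' = B (κ.toDist e) ∧ ‖e'‖ ≤ C * ‖e‖) (e : E) :
    ∃ e', ι.toDist e' = A (ι.toDist e) ∧
      ‖e'‖ ≤ ‖(Φ.symm : StrongDual ℂ F →L[ℂ] E)‖ * ‖(Φ : E →L[ℂ] StrongDual ℂ F)‖ * C * ‖e‖ := by
  obtain ⟨T, hT, hTn⟩ := exists_clm_of_toDist_eq κ B h
  obtain ⟨j, -, hjκ⟩ := hκ.dense_inclusion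
  refine ⟨Φ.symm ((Φ e).comp T), ?_, ?_⟩
  · ext φ
    rw [hΦ _ φ (j φ) (hjκ φ), Φ.apply_symm_apply, ContinuousLinearMap.comp_apply, hA,
      hΦ e (b φ) (T (j φ)) (by rw [hT, hjκ, hB])]
  · calc ‖Φ.symm ((Φ e).comp T)‖
        ≤ ‖(Φ.symm : StrongDual ℂ F →L[ℂ] E)‖ * ‖(Φ e).comp T‖ :=
          (Φ.symm : StrongDual ℂ F →L[ℂ] E).le_opNorm _
      _ ≤ ‖(Φ.symm : StrongDual ℂ F →L[ℂ] E)‖ *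
          ((‖(Φ : E →L[ℂ] StrongDual ℂ F)‖ * ‖e‖) * C) := by
          gcongr
          refine ((Φ e).opNorm_comp_le T).trans ?_
          gcongr
          · exact (Φ : E →L[ℂ] StrongDual ℂ F).le_opNorm e
          · exact T.opNorm_le_bound hC hTn
      _ = _ := by ring

theorem IsDTMIB.isConvModBounded {ι : DistInclusion n E} (h : IsDTMIB ι) :
    IsConvModBounded ι := by
  obtain ⟨F, _, _, _, κ, hκ, Φ, hΦ⟩ := h
  obtain ⟨⟨M, C, hC, hconv⟩, ⟨K, D, hD, hmod⟩⟩ := hκ.isConvModBounded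
  set c := ‖(Φ.symm : StrongDual ℂ F →L[ℂ] E)‖ * ‖(Φ : E →L[ℂ] StrongDual ℂ F)‖ with hc
  have hc0 : 0 ≤ c := by positivity
  constructor
  · obtain ⟨M', C', hC', hr⟩ := exists_schwartzNorm_map_le (reflectS (n := n)) M
    refine ⟨M', c * (C * C'), by positivity, fun θ e => ?_⟩
    have h0 := schwartzNorm_nonneg M (reflectS θ)
    have h0' := schwartzNorm_nonneg M' θ
    obtain ⟨e', h1, h2⟩ := exists_transpose hκ Φ hΦ (convD θ) (convD (reflectS θ))
      (convS (reflectS θ)) (convD_schwartzToDist _) (fun _ _ => rfl) (by positivity)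
      (hconv (reflectS θ)) e
    refine ⟨e', h1, h2.trans ?_⟩
    calc c * (C * schwartzNorm M (reflectS θ)) * ‖e‖
        ≤ c * (C * (C' * schwartzNorm M' θ)) * ‖e‖ := by gcongr; exact hr θ
      _ = _ := by ring
  · refine ⟨K, c * D, by positivity, fun ξ e => ?_⟩
    obtain ⟨e', h1, h2⟩ := exists_transpose hκ Φ hΦ (modulateD ξ) (modulateD ξ)
      (modulateS ξ) (modulateD_schwartzToDist _) (fun _ _ => rfl) (by positivity) (hmod ξ) e
    exact ⟨e', h1, h2.trans (le_of_eq (by ring))⟩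

/-- The pairing of Schwartz functions with `E`, as a continuous map from the Schwartz space to the
dual of `E`. -/
theorem exists_norm_toDist_apply_le [CompleteSpace E] (ι : DistInclusion n E) :
    ∃ M C, 0 ≤ C ∧ ∀ (e : E) (ρ : 𝓢(Rn n, ℂ)), ‖ι.toDist e ρ‖ ≤ C * schwartzNorm M ρ * ‖e‖ := by
  let Γ : 𝓢(Rn n, ℂ) →ₗ[ℂ] StrongDual ℂ E :=
    { toFun := fun ρ => (distEval ρ).comp ι.toDist
      map_add' := fun ρ σ => by
        ext e
        exact map_add (ι.toDist e) ρ σ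
      map_smul' := fun z ρ => by
        ext e
        exact map_smul (ι.toDist e) z ρ }
  have hΓ : Continuous Γ := by
    refine continuous_of_continuous_comp_injective (π := fun (g : StrongDual ℂ E) (e : E) => g e)
      (continuous_pi fun e => (ContinuousLinearMap.apply ℂ ℂ e).continuous)
      DFunLike.coe_injective Γ (continuous_pi fun e => ?_)
    exact (ι.toDist e : 𝓢(Rn n, ℂ) →L[ℂ] ℂ).continuous
  obtain ⟨M, C, hC, h⟩ := exists_norm_map_le_schwartzNorm (⟨Γ, hΓ⟩ : 𝓢(Rn n, ℂ) →L[ℂ] StrongDual ℂ E)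
  refine ⟨M, C, hC, fun e ρ => ?_⟩
  refine ((Γ ρ).le_opNorm e).trans ?_
  gcongr
  exact h ρ

end Action

/-! ### Sums of lattice translates -/

section LatticeSums

variable {n : ℕ}

/-- The lattice translate `T_k θ`. -/
noncomputable abbrev latticeShift (k : Fin n → ℤ) (θ : 𝓢(Rn n, ℂ)) : 𝓢(Rn n, ℂ) :=
  translateS (latticePt k) θ

theorem schwartzNorm_latticeShift_le (N : ℕ) (k : Fin n → ℤ) (θ : 𝓢(Rn n, ℂ)) :
    schwartzNorm N (latticeShift k θ) ≤ 2 ^ N * latticeWeight k ^ N * schwartzNorm N θ :=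
  schwartzNorm_translateS_le N (latticePt k) θ

theorem exists_schwartzNorm_smul_latticeShift_le (n N : ℕ) : ∃ M C, 0 ≤ C ∧
    ∀ (θ g : 𝓢(Rn n, ℂ)) (k : Fin n → ℤ),
      latticeWeight k ^ (2 * n) * schwartzNorm N (g (latticePt k) • latticeShift k θ)
        ≤ C * schwartzNorm M θ * schwartzNorm M g := by
  refine ⟨2 * n + N, 2 ^ N * 2 ^ (2 * n + N), by positivity, fun θ g k => ?_⟩
  rw [map_smul_eq_mul]
  have h1 := schwartzNorm_latticeShift_le N k θ
  have h2 := one_add_pow_mul_norm_le le_rfl g (latticePt k) (N := 2 * n + N)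
  have h3 := schwartzNorm_mono (show N ≤ 2 * n + N by omega) θ
  have h4 := schwartzNorm_nonneg N θ
  have h5 := schwartzNorm_nonneg (2 * n + N) g
  have hw := latticeWeight_pos k
  change latticeWeight k ^ _ * _ ≤ _ at h2
  calc latticeWeight k ^ (2 * n) * (‖g (latticePt k)‖ * schwartzNorm N (latticeShift k θ))
      ≤ latticeWeight k ^ (2 * n) * (‖g (latticePt k)‖ *
          (2 ^ N * latticeWeight k ^ N * schwartzNorm N θ)) := by gcongr
    _ = 2 ^ N * schwartzNorm N θ * (latticeWeight k ^ (2 * n + N) * ‖g (latticePt k)‖) := by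
        rw [pow_add]; ring
    _ ≤ 2 ^ N * schwartzNorm (2 * n + N) θ * (2 ^ (2 * n + N) * schwartzNorm (2 * n + N) g) := by
        gcongr
    _ = _ := by ring

/-- The Schwartz function `∑ₖ g(k) T_k θ`. -/
noncomputable def latticeConv (θ g : 𝓢(Rn n, ℂ)) : 𝓢(Rn n, ℂ) :=
  ∑' k : Fin n → ℤ, g (latticePt k) • latticeShift k θ

theorem hasSum_latticeConv (θ g : 𝓢(Rn n, ℂ)) :
    HasSum (fun k : Fin n → ℤ => g (latticePt k) • latticeShift k θ) (latticeConv θ g) := by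
  refine (summable_of_summable_schwartzNorm fun N => ?_).hasSum
  obtain ⟨M, C, -, h⟩ := exists_schwartzNorm_smul_latticeShift_le n N
  exact (summable_of_latticeWeight_pow_mul_le (fun _ => schwartzNorm_nonneg _ _) (h θ g)).1

theorem schwartzNorm_le_tsum {I : Type*} {F : I → 𝓢(Rn n, ℂ)} {g : 𝓢(Rn n, ℂ)} (h : HasSum F g)
    {N : ℕ} (hs : Summable fun i => schwartzNorm N (F i)) :
    schwartzNorm N g ≤ ∑' i, schwartzNorm N (F i) := by
  refine le_of_tendsto' ((continuous_schwartzNorm N).tendsto g |>.comp h) fun s => ?_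
  exact (Finset.le_sum_of_subadditive (schwartzNorm N) (map_zero _).le (map_add_le_add _) s F).trans
    (hs.sum_le_tsum s fun i _ => schwartzNorm_nonneg _ _)

theorem exists_schwartzNorm_latticeConv_le (n N : ℕ) : ∃ M C, 0 ≤ C ∧ ∀ θ g : 𝓢(Rn n, ℂ),
    schwartzNorm N (latticeConv θ g) ≤ C * schwartzNorm M θ * schwartzNorm M g := by
  obtain ⟨M, C, hC, h⟩ := exists_schwartzNorm_smul_latticeShift_le n N
  have hw : 0 ≤ ∑' k : Fin n → ℤ, (latticeWeight k ^ (2 * n))⁻¹ :=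
    tsum_nonneg fun k => inv_nonneg.2 (pow_nonneg (latticeWeight_pos k).le _)
  refine ⟨M, C * ∑' k : Fin n → ℤ, (latticeWeight k ^ (2 * n))⁻¹, by positivity, fun θ g => ?_⟩
  obtain ⟨h1, h2⟩ := summable_of_latticeWeight_pow_mul_le (fun _ => schwartzNorm_nonneg _ _) (h θ g)
  refine (schwartzNorm_le_tsum (hasSum_latticeConv θ g) h1).trans (h2.trans (le_of_eq ?_))
  ring

/-- The Poisson summation formula in the form `∑ₖ g(k) T_k θ = ∑ⱼ θ * M_j g`. -/
theorem hasSum_convS_modulateS (θ g : 𝓢(Rn n, ℂ)) :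
    HasSum (fun j : Fin n → ℤ => convS θ (modulateS (latticePt j) g)) (latticeConv θ g) := by
  have hs : Summable fun j : Fin n → ℤ => convS θ (modulateS (latticePt j) g) := by
    refine summable_of_summable_schwartzNorm fun N => ?_
    obtain ⟨M, C, -, h⟩ := exists_schwartzNorm_convS_modulateS_le n (2 * n) N
    refine (summable_of_latticeWeight_pow_mul_le (C := C * schwartzNorm M g * schwartzNorm M θ)
      (fun _ => schwartzNorm_nonneg _ _) fun j => ?_).1
    rw [convS_comm]
    exact h (latticePt j) g θ
  convert hs.hasSum using 1
  ext t
  set G := mulS g (translateS t (reflectS θ)) with hG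
  have h1 := (hasSum_fourier_mul_character G 0)
  have h2 : HasSum (fun j : Fin n → ℤ => convS θ (modulateS (latticePt j) g) t)
      (∑' k : Fin n → ℤ, G (0 + latticePt k)) := by
    rw [← (Equiv.neg (Fin n → ℤ)).hasSum_iff] at h1
    refine hasSum_of_eq (fun j => ?_) h1
    have hc : character (latticePt (-j)) (0 : Rn n) = 1 := by simp [character]
    rw [Function.comp_apply, Equiv.neg_apply, hc, mul_one, fourier_apply_eq, convS_comm, convS_apply,
      latticePt_neg, neg_neg]
    congr 1
    ext s
    rw [modulateS_apply, hG, mulS_apply, translateS_apply, reflectS_apply, neg_sub, character]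
    ring
  rw [← h2.unique (hs.hasSum.schwartz_apply t)]
  refine ((hasSum_latticeConv θ g).schwartz_apply t).unique ?_
  have h3 : Summable fun k : Fin n → ℤ => G (0 + latticePt k) :=
    (summable_norm_apply_add_latticePt G 0).of_norm
  refine hasSum_of_eq (fun k => ?_) h3.hasSum
  rw [zero_add, hG, mulS_apply, translateS_apply, reflectS_apply, neg_sub]
  rfl

end LatticeSums

/-! ### Discretization of distributions whose convolutions belong to `E` -/

namespace DistInclusion

variable {n : ℕ} {E : Type*} [NormedAddCommGroup E] [NormedSpace ℂ E]

theorem toDist_distConv (ι : DistInclusion n E) (f : ι.DistSpace) (φ : 𝓢(Rn n, ℂ)) :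
    ι.toDist (ι.distConv f φ) = convD φ f.1 :=
  ι.toDist_toE _

/-- For `f ∈ D'_E`, the map `φ ↦ f * φ` is continuous from the Schwartz space to `E`. -/
theorem exists_distConv_bound [CompleteSpace E] (ι : DistInclusion n E) (f : ι.DistSpace) :
    ∃ M C, 0 ≤ C ∧ ∀ φ, ‖ι.distConv f φ‖ ≤ C * schwartzNorm M φ := by
  let L : 𝓢(Rn n, ℂ) →ₗ[ℂ] E :=
    { toFun := ι.distConv f
      map_add' := fun φ ψ => ι.injective (by
        ext ρ
        simp only [map_add, toDist_distConv, add_apply, convD_apply]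
        rw [convS_comm, map_add, map_add, convS_comm, convS_comm ρ])
      map_smul' := fun z φ => ι.injective (by
        ext ρ
        simp only [map_smul, toDist_distConv, convD_apply, RingHom.id_apply]
        rw [convS_comm, map_smul, convS_comm, map_smul]
        simp [convD_apply]) }
  have hL : Continuous L := by
    refine continuous_of_continuous_comp_injective
      (π := fun (e : E) (ρ : 𝓢(Rn n, ℂ)) => ι.toDist e ρ)
      (continuous_pi fun ρ => ((distEval ρ).comp ι.toDist).continuous)
      (fun a b h => ι.injective (DFunLike.coe_injective h)) L (continuous_pi fun ρ => ?_)
    have : (fun φ => ι.toDist (L φ) ρ) = fun φ => f.1 (convS ρ (reflectS φ)) := by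
      funext φ
      change ι.toDist (ι.distConv f φ) ρ = _
      rw [toDist_distConv, convD_apply, convS_comm]
    change Continuous (fun φ => ι.toDist (L φ) ρ)
    rw [this]
    exact (f.1 : 𝓢(Rn n, ℂ) →L[ℂ] ℂ).continuous.comp ((convS ρ).continuous.comp reflectS.continuous)
  exact exists_norm_map_le_schwartzNorm (⟨L, hL⟩ : 𝓢(Rn n, ℂ) →L[ℂ] E)

/-- The discretization estimate: for `f ∈ D'_E` the distribution `∑ₖ f(T_k θ) T_k φ` belongs to `E`.
By Poisson summation it equals `∑ⱼ M_j (f * (θˇ * M_{-j} φ))`. -/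
theorem exists_discretization [CompleteSpace E] {ι : DistInclusion n E} (hι : IsConvModBounded ι) :
    ∃ (K : ℕ) (C : ℝ), 0 ≤ C ∧ ∀ (f : ι.DistSpace) (θ φ : 𝓢(Rn n, ℂ)), ∃ e : E,
      HasSum (fun k : Fin n → ℤ => f.1 (latticeShift k θ) • schwartzToDist (latticeShift k φ))
        (ι.toDist e) ∧
      ∀ A, (∀ j : Fin n → ℤ, latticeWeight j ^ K *
        ‖ι.distConv f (convS (reflectS θ) (modulateS (-latticePt j) φ))‖ ≤ A) → ‖e‖ ≤ C * A := by
  obtain ⟨K, D, hD, hmod⟩ := hι.modulate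
  have hw : 0 ≤ ∑' k : Fin n → ℤ, (latticeWeight k ^ (2 * n))⁻¹ :=
    tsum_nonneg fun k => inv_nonneg.2 (pow_nonneg (latticeWeight_pos k).le _)
  refine ⟨2 * n + K, D * ∑' k : Fin n → ℤ, (latticeWeight k ^ (2 * n))⁻¹, by positivity,
    fun f θ φ => ?_⟩
  set ω : (Fin n → ℤ) → 𝓢(Rn n, ℂ) := fun j => convS (reflectS θ) (modulateS (-latticePt j) φ) with hω
  choose e he hen using fun j => hmod (latticePt j) (ι.distConv f (ω j))
  have hsum : ∀ A, (∀ j : Fin n → ℤ, latticeWeight j ^ (2 * n + K) * ‖ι.distConv f (ω j)‖ ≤ A) →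
      (Summable fun j => ‖e j‖) ∧
        ∑' j, ‖e j‖ ≤ D * A * ∑' k : Fin n → ℤ, (latticeWeight k ^ (2 * n))⁻¹ := by
    intro A hA
    refine summable_of_latticeWeight_pow_mul_le (fun _ => norm_nonneg _) fun j => ?_
    have hj := latticeWeight_pos j
    calc latticeWeight j ^ (2 * n) * ‖e j‖
        ≤ latticeWeight j ^ (2 * n) * (D * latticeWeight j ^ K * ‖ι.distConv f (ω j)‖) := by
          gcongr
          exact hen j
      _ = D * (latticeWeight j ^ (2 * n + K) * ‖ι.distConv f (ω j)‖) := by rw [pow_add]; ring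
      _ ≤ D * A := by gcongr; exact hA j
  have hex : ∃ A, ∀ j : Fin n → ℤ, latticeWeight j ^ (2 * n + K) * ‖ι.distConv f (ω j)‖ ≤ A := by
    obtain ⟨M, C, hC, hf⟩ := exists_distConv_bound ι f
    obtain ⟨M', C', hC', hω'⟩ := exists_schwartzNorm_convS_modulateS_le n (2 * n + K) M
    refine ⟨C * (C' * schwartzNorm M' φ * schwartzNorm M' (reflectS θ)), fun j => ?_⟩
    have h1 := hω' (-latticePt j) φ (reflectS θ)
    rw [norm_neg, convS_comm] at h1
    have hj := latticeWeight_pos j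
    calc latticeWeight j ^ (2 * n + K) * ‖ι.distConv f (ω j)‖
        ≤ latticeWeight j ^ (2 * n + K) * (C * schwartzNorm M (ω j)) := by
          gcongr
          exact hf _
      _ = C * (latticeWeight j ^ (2 * n + K) * schwartzNorm M (ω j)) := by ring
      _ ≤ _ := by gcongr _ * ?_; exact h1
  obtain ⟨A₀, hA₀⟩ := hex
  have hs := (hsum A₀ hA₀).1
  refine ⟨∑' j, e j, ?_, fun A hA => ?_⟩
  · rw [hasSum_dist_iff]
    intro ρ
    set g := convS (reflectS φ) ρ with hg
    have h1 : HasSum (fun j => f.1 (convS θ (modulateS (latticePt j) g))) (ι.toDist (∑' j, e j) ρ) := by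
      refine hasSum_of_eq (fun j => ?_) (hs.of_norm.hasSum.mapL ((distEval ρ).comp ι.toDist))
      rw [ContinuousLinearMap.comp_apply, he, toDist_distConv, distEval_apply, modulateD_apply,
        convD_apply, hω, reflectS_convS, reflectS_reflectS, reflectS_modulateS, neg_neg, hg,
        modulateS_convS, ← convS_assoc]
    have h2 := (hasSum_convS_modulateS θ g).mapL (f.1 : 𝓢(Rn n, ℂ) →L[ℂ] ℂ)
    rw [h1.unique h2]
    refine hasSum_of_eq (fun k => ?_) ((hasSum_latticeConv θ g).mapL (f.1 : 𝓢(Rn n, ℂ) →L[ℂ] ℂ))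
    change f.1 (latticeShift k θ) * schwartzToDist (latticeShift k φ) ρ = f.1 (_ • _)
    rw [map_smul, ← convS_reflectS_apply, mul_comm]
    rfl
  · obtain ⟨h1, h2⟩ := hsum A hA
    exact (norm_tsum_le_tsum_norm h1).trans (h2.trans (le_of_eq (by ring)))

/-- `E` is contained in `D'_E`. -/
theorem exists_distSpace_of_mem {ι : DistInclusion n E} (hι : IsConvModBounded ι) (e : E) :
    ∃ f : ι.DistSpace, f.1 = ι.toDist e := by
  obtain ⟨M, C, hC, h⟩ := hι.conv
  refine ⟨⟨ι.toDist e, (Submodule.mem_iInf _).2 fun φ => ?_⟩, rfl⟩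
  obtain ⟨e', he', -⟩ := h φ e
  exact ⟨e', he'⟩

theorem exists_discretization_of_mem [CompleteSpace E] {ι : DistInclusion n E}
    (hι : IsConvModBounded ι) :
    ∃ M C, 0 ≤ C ∧ ∀ (x : E) (θ φ : 𝓢(Rn n, ℂ)), ∃ e : E,
      HasSum (fun k : Fin n → ℤ =>
        ι.toDist x (latticeShift k θ) • schwartzToDist (latticeShift k φ)) (ι.toDist e) ∧
      ‖e‖ ≤ C * schwartzNorm M θ * schwartzNorm M φ * ‖x‖ := by
  obtain ⟨K, C, hC, h⟩ := exists_discretization hι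
  obtain ⟨M, D, hD, hconv⟩ := hι.conv
  obtain ⟨M', C', hC', hω⟩ := exists_schwartzNorm_convS_modulateS_le n K M
  obtain ⟨L, C'', hC'', hr⟩ := exists_schwartzNorm_map_le (reflectS (n := n)) M'
  refine ⟨max M' L, C * (D * C' * C''), by positivity, fun x θ φ => ?_⟩
  obtain ⟨f, hf⟩ := exists_distSpace_of_mem hι x
  obtain ⟨e, he, hen⟩ := h f θ φ
  rw [hf] at he
  refine ⟨e, he, (hen (D * C' * C'' * schwartzNorm (max M' L) θ * schwartzNorm (max M' L) φ * ‖x‖)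
    fun j => ?_).trans (le_of_eq (by ring))⟩
  obtain ⟨e', he', hen'⟩ := hconv (convS (reflectS θ) (modulateS (-latticePt j) φ)) x
  have h1 : ι.distConv f (convS (reflectS θ) (modulateS (-latticePt j) φ)) = e' :=
    ι.injective (by rw [toDist_distConv, hf, he'])
  have h2 := hω (-latticePt j) φ (reflectS θ)
  rw [norm_neg, convS_comm] at h2
  have hj := latticeWeight_pos j
  have h3 := schwartzNorm_nonneg M' φ
  have h4 := schwartzNorm_nonneg L θ
  have h5 := schwartzNorm_nonneg (max M' L) θ
  rw [h1]
  calc latticeWeight j ^ K * ‖e'‖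
      ≤ latticeWeight j ^ K *
        (D * schwartzNorm M (convS (reflectS θ) (modulateS (-latticePt j) φ)) * ‖x‖) := by gcongr
    _ = D * ‖x‖ * (latticeWeight j ^ K *
        schwartzNorm M (convS (reflectS θ) (modulateS (-latticePt j) φ))) := by ring
    _ ≤ D * ‖x‖ * (C' * schwartzNorm M' φ * schwartzNorm M' (reflectS θ)) := by gcongr _ * ?_; exact h2
    _ ≤ D * ‖x‖ * (C' * schwartzNorm M' φ * (C'' * schwartzNorm L θ)) := by gcongr; exact hr θ
    _ ≤ D * ‖x‖ * (C' * schwartzNorm (max M' L) φ * (C'' * schwartzNorm (max M' L) θ)) := by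
        gcongr
        · exact schwartzNorm_mono (le_max_left _ _) φ
        · exact schwartzNorm_mono (le_max_right _ _) θ
    _ = _ := by ring

end DistInclusion

/-! ### The discrete space -/

section DualWindow

variable {n : ℕ}

theorem schwartzToDist_latticeShift_self (χ η : 𝓢(Rn n, ℂ)) (k : Fin n → ℤ) :
    schwartzToDist (latticeShift k χ) (latticeShift k η) = schwartzToDist χ η := by
  rw [← translateD_schwartzToDist, translateD_apply, translateS_translateS]
  simp [translateS_zero]

/-- A window `χ` with disjoint lattice translates has a biorthogonal window: its normalized complex
conjugate. -/
theorem IsDiscreteWindow.exists_dual {U : Set (Rn n)} {χ : 𝓢(Rn n, ℂ)} (hχ : IsDiscreteWindow U χ) :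
    ∃ η : 𝓢(Rn n, ℂ), ∀ k l : Fin n → ℤ,
      schwartzToDist (latticeShift k χ) (latticeShift l η) = if k = l then 1 else 0 := by
  set η₀ : 𝓢(Rn n, ℂ) := χ.postcompCLM (Complex.conjCLE : ℂ →L[ℝ] ℂ) with hη₀
  have hη : ∀ x, η₀ x = (starRingEnd ℂ) (χ x) := fun x => rfl
  set I : ℝ := ∫ x, ‖χ x‖ ^ 2 with hI
  have hIpos : 0 < I := by
    obtain ⟨x, hx⟩ : ∃ x, χ x ≠ 0 := by
      by_contra! h
      exact hχ.ne_zero (by ext x; simpa using h x)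
    refine Continuous.integral_pos_of_hasCompactSupport_nonneg_nonzero (x := x)
      (χ.continuous.norm.pow 2) ?_ (fun _ => by positivity) (by simpa using hx)
    exact hχ.hasCompactSupport.comp_left (g := fun z => ‖z‖ ^ 2) (by simp)
  have hself : schwartzToDist χ η₀ = I := by
    rw [schwartzToDist_apply, hI, ← integral_complex_ofReal]
    congr 1
    ext x
    rw [hη, mul_comm, Complex.mul_conj, Complex.normSq_eq_norm_sq]
  refine ⟨(I : ℂ)⁻¹ • η₀, fun k l => ?_⟩
  rw [latticeShift, latticeShift, map_smul, map_smul]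
  split_ifs with hkl
  · subst hkl
    rw [schwartzToDist_latticeShift_self, hself, smul_eq_mul, inv_mul_cancel₀]
    exact_mod_cast hIpos.ne'
  · rw [schwartzToDist_apply]
    have : ∀ x, translateS (latticePt l) η₀ x * translateS (latticePt k) χ x = 0 := by
      intro x
      by_contra hx
      have hx1 := left_ne_zero_of_mul hx
      have hx2 := right_ne_zero_of_mul hx
      rw [translateS_apply] at hx1 hx2
      rw [hη, map_ne_zero] at hx1
      exact Set.disjoint_iff.1 (hχ.pairwise_disjoint hkl)
        ⟨⟨_, hχ.support_subset (subset_tsupport _ hx2), add_sub_cancel _ x⟩,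
          ⟨_, hχ.support_subset (subset_tsupport _ hx1), add_sub_cancel _ x⟩⟩
    simp [this]

end DualWindow

namespace DistInclusion

variable {n : ℕ} {E : Type*} [NormedAddCommGroup E] [NormedSpace ℂ E]

noncomputable instance (ι : DistInclusion n E) (χ : 𝓢(Rn n, ℂ)) : NormedSpace ℂ (ι.DiscreteSpace χ) :=
  NormedSpace.induced ℂ (ι.DiscreteSpace χ) E (ι.discreteSynthesis χ)

theorem norm_discreteSynthesis (ι : DistInclusion n E) (χ : 𝓢(Rn n, ℂ)) (c : ι.DiscreteSpace χ) :
    ‖ι.discreteSynthesis χ c‖ = ‖c‖ := rfl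

variable {ι : DistInclusion n E} {χ η : 𝓢(Rn n, ℂ)}

/-- A sequence `a` with `∑ₖ aₖ T_k χ ∈ E`, as an element of `E_d`. -/
theorem exists_discreteSpace_of_hasSum {a : (Fin n → ℤ) → ℂ} {e : E}
    (h : HasSum (fun k => a k • schwartzToDist (latticeShift k χ)) (ι.toDist e)) :
    ∃ c : ι.DiscreteSpace χ, c.1 = a ∧ ‖c‖ = ‖e‖ := by
  let c : ι.DiscreteSpace χ := ⟨a, e, h⟩
  refine ⟨c, rfl, ?_⟩
  have : ι.discreteSynthesis χ c = e := ι.injective ((hasSum_discreteSynthesis ι χ c).unique h)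
  rw [← norm_discreteSynthesis, this]

/-- The coefficients of `c ∈ E_d` are recovered from `S_χ c` by pairing with the dual window. -/
theorem toDist_discreteSynthesis_latticeShift
    (hη : ∀ k l : Fin n → ℤ,
      schwartzToDist (latticeShift k χ) (latticeShift l η) = if k = l then 1 else 0)
    (c : ι.DiscreteSpace χ) (l : Fin n → ℤ) :
    ι.toDist (ι.discreteSynthesis χ c) (latticeShift l η) = c.1 l := by
  refine (hasSum_dist_iff.1 (hasSum_discreteSynthesis ι χ c) (latticeShift l η)).unique ?_
  refine hasSum_of_eq (g := fun k => if k = l then c.1 l else 0) (fun k => ?_) (hasSum_ite_eq l _)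
  change c.1 k * schwartzToDist _ _ = _
  rw [hη]
  split_ifs with h
  · rw [h, mul_one]
  · rw [mul_zero]

/-- The value `⟨∑ₖ cₖ T_k φ, ρ⟩`, expressed through `S_χ c`. -/
theorem hasSum_coeff_mul_schwartzToDist
    (hη : ∀ k l : Fin n → ℤ,
      schwartzToDist (latticeShift k χ) (latticeShift l η) = if k = l then 1 else 0)
    (c : ι.DiscreteSpace χ) (φ ρ : 𝓢(Rn n, ℂ)) :
    HasSum (fun k => c.1 k * schwartzToDist (latticeShift k φ) ρ)
      (ι.toDist (ι.discreteSynthesis χ c) (latticeConv η (convS (reflectS φ) ρ))) := by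
  refine hasSum_of_eq (fun k => ?_) ((hasSum_latticeConv η (convS (reflectS φ) ρ)).mapL
    (ι.toDist (ι.discreteSynthesis χ c) : 𝓢(Rn n, ℂ) →L[ℂ] ℂ))
  rw [convS_reflectS_apply, ← toDist_discreteSynthesis_latticeShift hη c k, mul_comm]
  exact (map_smul (ι.toDist (ι.discreteSynthesis χ c)) _ _).symm

variable [CompleteSpace E]

/-- The synthesis operators `c ↦ ∑ₖ cₖ T_k φ` from `E_d` to `E`, for arbitrary windows `φ`. -/
theorem exists_synthesis (hι : IsConvModBounded ι) (hχ : ∃ η : 𝓢(Rn n, ℂ), ∀ k l : Fin n → ℤ,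
      schwartzToDist (latticeShift k χ) (latticeShift l η) = if k = l then 1 else 0) :
    ∃ M C, 0 ≤ C ∧ ∀ (φ : 𝓢(Rn n, ℂ)) (c : ι.DiscreteSpace χ), ∃ e : E,
      HasSum (fun k => c.1 k • schwartzToDist (latticeShift k φ)) (ι.toDist e) ∧
      ‖e‖ ≤ C * schwartzNorm M φ * ‖c‖ := by
  obtain ⟨M, C, hC, h⟩ := exists_discretization_of_mem hι
  obtain ⟨η, hη⟩ := hχ
  have h0 := schwartzNorm_nonneg M η
  refine ⟨M, C * schwartzNorm M η, by positivity, fun φ c => ?_⟩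
  obtain ⟨e, he, hen⟩ := h (ι.discreteSynthesis χ c) η φ
  simp only [toDist_discreteSynthesis_latticeShift hη] at he
  exact ⟨e, he, hen⟩

/-- The analysis operators `x ↦ (⟨x, T_k θ⟩)ₖ` from `E` to `E_d`. -/
theorem exists_analysis (hι : IsConvModBounded ι) (χ : 𝓢(Rn n, ℂ)) :
    ∃ M C, 0 ≤ C ∧ ∀ (θ : 𝓢(Rn n, ℂ)) (x : E), ∃ c : ι.DiscreteSpace χ,
      (∀ k, c.1 k = ι.toDist x (latticeShift k θ)) ∧ ‖c‖ ≤ C * schwartzNorm M θ * ‖x‖ := by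
  obtain ⟨M, C, hC, h⟩ := exists_discretization_of_mem hι
  have h0 := schwartzNorm_nonneg M χ
  refine ⟨M, C * schwartzNorm M χ, by positivity, fun θ x => ?_⟩
  obtain ⟨e, he, hen⟩ := h x θ χ
  obtain ⟨c, hc, hcn⟩ := exists_discreteSpace_of_hasSum he
  refine ⟨c, fun k => by rw [hc], ?_⟩
  rw [hcn]
  exact hen.trans (le_of_eq (by ring))

/-- The analysis operators `f ↦ (⟨f, T_k θ⟩)ₖ` from `D'_E` to `E_d`. -/
theorem exists_analysis_distSpace (hι : IsConvModBounded ι) (χ : 𝓢(Rn n, ℂ)) :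
    ∃ (K : ℕ) (C : ℝ), 0 ≤ C ∧ ∀ (θ : 𝓢(Rn n, ℂ)) (f : ι.DistSpace), ∃ c : ι.DiscreteSpace χ,
      (∀ k, c.1 k = f.1 (latticeShift k θ)) ∧
      ∀ A, (∀ j : Fin n → ℤ, latticeWeight j ^ K *
        ‖ι.distConv f (convS (reflectS θ) (modulateS (-latticePt j) χ))‖ ≤ A) → ‖c‖ ≤ C * A := by
  obtain ⟨K, C, hC, h⟩ := exists_discretization hι
  refine ⟨K, C, hC, fun θ f => ?_⟩
  obtain ⟨e, he, hen⟩ := h f θ χ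
  obtain ⟨c, hc, hcn⟩ := exists_discreteSpace_of_hasSum he
  refine ⟨c, fun k => by rw [hc], fun A hA => ?_⟩
  rw [hcn]
  exact hen A hA

omit [CompleteSpace E] in
theorem t0Space_discreteSpace (hχ : ∃ η : 𝓢(Rn n, ℂ), ∀ k l : Fin n → ℤ,
      schwartzToDist (latticeShift k χ) (latticeShift l η) = if k = l then 1 else 0) :
    T0Space (ι.DiscreteSpace χ) := by
  obtain ⟨η, hη⟩ := hχ
  refine ⟨fun c d hcd => ?_⟩
  rw [Metric.inseparable_iff, dist_eq_norm, ← norm_discreteSynthesis, norm_eq_zero, map_sub,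
    sub_eq_zero] at hcd
  refine Subtype.ext (funext fun l => ?_)
  rw [← toDist_discreteSynthesis_latticeShift hη, ← toDist_discreteSynthesis_latticeShift hη, hcd]

/-- `E_d` is complete, being a retract of `E`. -/
theorem completeSpace_discreteSpace (hι : IsConvModBounded ι)
    (hχ : ∃ η : 𝓢(Rn n, ℂ), ∀ k l : Fin n → ℤ,
      schwartzToDist (latticeShift k χ) (latticeShift l η) = if k = l then 1 else 0) :
    CompleteSpace (ι.DiscreteSpace χ) := by
  obtain ⟨η, hη⟩ := hχ
  obtain ⟨M, C, hC, h⟩ := exists_analysis hι χ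
  choose D hD hDn using h η
  have hDS : ∀ c, D (ι.discreteSynthesis χ c) = c := fun c =>
    Subtype.ext (funext fun l => by rw [hD, toDist_discreteSynthesis_latticeShift hη])
  have hDsub : ∀ x y, D x - D y = D (x - y) := fun x y => Subtype.ext (funext fun l => by
    rw [hD, map_sub]
    change (D x).1 l - (D y).1 l = _
    rw [hD, hD]
    rfl)
  refine Metric.complete_of_cauchySeq_tendsto fun u hu => ?_
  have hS : CauchySeq fun i => ι.discreteSynthesis χ (u i) := by
    rw [Metric.cauchySeq_iff] at hu ⊢
    intro ε hε
    obtain ⟨N, hN⟩ := hu ε hε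
    refine ⟨N, fun i hi j hj => ?_⟩
    rw [dist_eq_norm, ← map_sub, norm_discreteSynthesis, ← dist_eq_norm]
    exact hN i hi j hj
  obtain ⟨e, he⟩ := cauchySeq_tendsto_of_complete hS
  refine ⟨D e, ?_⟩
  rw [tendsto_iff_norm_sub_tendsto_zero] at he ⊢
  have h0 := schwartzNorm_nonneg M η
  refine squeeze_zero (fun _ => norm_nonneg _) (fun i => ?_)
    (by simpa using he.const_mul (C * schwartzNorm M η))
  rw [← hDS (u i), hDsub, hDS]
  exact hDn _

end DistInclusion

/-! ### Weighted spaces of vector valued sequences -/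

section WeightedSeq

variable {I : Type*}

/-- The families `a : I → B` for which `r m * ‖a m‖` is bounded for all weights `r` of the set
`R`. -/
def weightedSeqSubmodule (R : Set (I → ℝ)) (B : Type*) [SeminormedAddCommGroup B] [NormedSpace ℂ B] :
    Submodule ℂ (I → B) where
  carrier := {a | ∀ r ∈ R, ∃ C, ∀ m, |r m| * ‖a m‖ ≤ C}
  add_mem' := by
    intro a b ha hb r hr
    obtain ⟨C, hC⟩ := ha r hr
    obtain ⟨D, hD⟩ := hb r hr
    refine ⟨C + D, fun m => ?_⟩
    calc |r m| * ‖a m + b m‖ ≤ |r m| * (‖a m‖ + ‖b m‖) := by gcongr; exact norm_add_le _ _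
      _ ≤ C + D := by rw [mul_add]; exact add_le_add (hC m) (hD m)
  zero_mem' := fun r _ => ⟨0, fun m => by simp⟩
  smul_mem' := by
    intro z a ha r hr
    obtain ⟨C, hC⟩ := ha r hr
    refine ⟨‖z‖ * C, fun m => ?_⟩
    rw [Pi.smul_apply, norm_smul, mul_left_comm]
    gcongr
    exact hC m

/-- The space of the families `a : I → B` for which `r m * ‖a m‖` is bounded for all weights
`r ∈ R`, with the topology given by the seminorms `supₘ |r m| * ‖a m‖`, `r ∈ R`. -/
def WeightedSeq (R : Set (I → ℝ)) (B : Type*) [SeminormedAddCommGroup B] [NormedSpace ℂ B] : Type _ :=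
  ↥(weightedSeqSubmodule R B)

namespace WeightedSeq

variable {R : Set (I → ℝ)} {B : Type*} [SeminormedAddCommGroup B] [NormedSpace ℂ B]

instance : AddCommGroup (WeightedSeq R B) := inferInstanceAs (AddCommGroup ↥(weightedSeqSubmodule R B))

instance : Module ℂ (WeightedSeq R B) := inferInstanceAs (Module ℂ ↥(weightedSeqSubmodule R B))

/-- The coordinates of an element of a weighted sequence space. -/
def coord (m : I) : WeightedSeq R B →ₗ[ℂ] B :=
  (LinearMap.proj m).comp (weightedSeqSubmodule R B).subtype

theorem ext_coord {a b : WeightedSeq R B} (h : ∀ m, coord m a = coord m b) : a = b :=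
  Subtype.ext (funext h)

/-- The element of a weighted sequence space with given coordinates. -/
def mk (a : I → B) (h : ∀ r ∈ R, ∃ C, ∀ m, |r m| * ‖a m‖ ≤ C) : WeightedSeq R B := ⟨a, h⟩

theorem exists_mul_norm_coord_le (a : WeightedSeq R B) (r : R) : ∃ C, ∀ m, |r.1 m| * ‖coord m a‖ ≤ C :=
  a.2 r.1 r.2

/-- The seminorm `supₘ |r m| * ‖a m‖`. -/
noncomputable def seminorm (r : R) : Seminorm ℂ (WeightedSeq R B) :=
  Seminorm.of (fun a => ⨆ m, |r.1 m| * ‖coord m a‖)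
    (fun a b => by
      obtain ⟨C, hC⟩ := exists_mul_norm_coord_le a r
      obtain ⟨D, hD⟩ := exists_mul_norm_coord_le b r
      refine Real.iSup_le (fun m => ?_) (add_nonneg (Real.iSup_nonneg fun m => by positivity)
        (Real.iSup_nonneg fun m => by positivity))
      rw [map_add]
      calc |r.1 m| * ‖coord m a + coord m b‖ ≤ |r.1 m| * ‖coord m a‖ + |r.1 m| * ‖coord m b‖ := by
            rw [← mul_add]; gcongr; exact norm_add_le _ _
        _ ≤ _ := add_le_add (le_ciSup (f := fun m => |r.1 m| * ‖coord m a‖) ⟨C, by rintro _ ⟨m, rfl⟩; exact hC m⟩ m)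
            (le_ciSup (f := fun m => |r.1 m| * ‖coord m b‖) ⟨D, by rintro _ ⟨m, rfl⟩; exact hD m⟩ m))
    (fun z a => by
      rw [Real.mul_iSup_of_nonneg (norm_nonneg z)]
      congr 1
      funext m
      rw [map_smul, norm_smul, mul_left_comm])

theorem mul_norm_coord_le_seminorm (a : WeightedSeq R B) (r : R) (m : I) :
    |r.1 m| * ‖coord m a‖ ≤ seminorm r a := by
  obtain ⟨C, hC⟩ := exists_mul_norm_coord_le a r
  exact le_ciSup (f := fun m => |r.1 m| * ‖coord m a‖) ⟨C, by rintro _ ⟨m, rfl⟩; exact hC m⟩ m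

theorem seminorm_le {a : WeightedSeq R B} {r : R} {C : ℝ} (hC : 0 ≤ C)
    (h : ∀ m, |r.1 m| * ‖coord m a‖ ≤ C) : seminorm r a ≤ C :=
  Real.iSup_le h hC

noncomputable instance : TopologicalSpace (WeightedSeq R B) :=
  SeminormFamily.moduleFilterBasis (𝕜 := ℂ) (fun r : R => seminorm (B := B) r) |>.topology

theorem withSeminorms : WithSeminorms (fun r : R => seminorm (B := B) r) := ⟨rfl⟩

instance : IsTopologicalAddGroup (WeightedSeq R B) := withSeminorms.topologicalAddGroup

instance : ContinuousSMul ℂ (WeightedSeq R B) := withSeminorms.continuousSMul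

instance : LocallyConvexSpace ℝ (WeightedSeq R B) :=
  withSeminorms.toLocallyConvexSpace

noncomputable instance : UniformSpace (WeightedSeq R B) := IsTopologicalAddGroup.rightUniformSpace _

instance : IsUniformAddGroup (WeightedSeq R B) := isUniformAddGroup_of_addCommGroup

theorem t0Space [T0Space B] (hR : ∀ m, ∃ r ∈ R, r m ≠ 0) : T0Space (WeightedSeq R B) := by
  have : T1Space (WeightedSeq R B) := by
    refine withSeminorms.T1_of_separating fun a ha => ?_
    by_contra! h
    refine ha (ext_coord fun m => ?_)
    obtain ⟨r, hr, hrm⟩ := hR m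
    have h1 := (mul_norm_coord_le_seminorm a ⟨r, hr⟩ m).trans (h ⟨r, hr⟩).le
    have h2 : ‖coord m a‖ ≤ 0 := by
      by_contra! h3
      exact absurd h1 (not_le.2 (mul_pos (abs_pos.2 hrm) h3))
    have h3 : ‖coord m a - 0‖ = 0 := by rw [sub_zero]; exact le_antisymm h2 (norm_nonneg _)
    rw [map_zero]
    exact (Metric.inseparable_iff.2 (by rw [dist_eq_norm]; exact h3)).eq
  infer_instance

theorem completeSpace [CompleteSpace B] (hR : ∀ m, ∃ r ∈ R, r m ≠ 0) :
    CompleteSpace (WeightedSeq R B) := by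
  refine ⟨fun {F} hF => ?_⟩
  have := hF.1
  have hsmall : ∀ (r : R) (ε : ℝ), 0 < ε → ∃ t ∈ F, ∀ x ∈ t, ∀ y ∈ t, seminorm r (x - y) < ε := by
    intro r ε hε
    have h1 : {p : WeightedSeq R B × WeightedSeq R B | seminorm r (p.1 - p.2) < ε}
        ∈ uniformity (WeightedSeq R B) := by
      rw [uniformity_eq_comap_nhds_zero_swapped]
      refine ⟨{x | seminorm r x < ε}, ?_, fun p hp => hp⟩
      exact (withSeminorms.continuous_seminorm r).continuousAt.eventually_lt continuousAt_const
        (by rw [map_zero]; exact hε)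
    obtain ⟨t, ht, htt⟩ := mem_prod_same_iff.1 (hF.2 h1)
    exact ⟨t, ht, fun x hx y hy => htt (Set.mk_mem_prod hx hy)⟩
  have hlim : ∀ m, ∃ b, Tendsto (fun x => coord m x) F (𝓝 b) := by
    intro m
    obtain ⟨r, hr, hrm⟩ := hR m
    refine CompleteSpace.complete (f := map (fun x : WeightedSeq R B => coord m x) F) ?_
    rw [Metric.cauchy_iff]
    refine ⟨inferInstance, fun ε hε => ?_⟩
    obtain ⟨t, ht, htt⟩ := hsmall ⟨r, hr⟩ (|r m| * ε) (mul_pos (abs_pos.2 hrm) hε)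
    refine ⟨_, image_mem_map ht, ?_⟩
    rintro _ ⟨x, hx, rfl⟩ _ ⟨y, hy, rfl⟩
    have h1 := (mul_norm_coord_le_seminorm (x - y) ⟨r, hr⟩ m).trans_lt (htt x hx y hy)
    rw [dist_eq_norm]
    rw [map_sub] at h1
    exact lt_of_mul_lt_mul_left h1 (abs_nonneg _)
  choose b hb using hlim
  have hclose : ∀ (r : R) (ε : ℝ), 0 < ε → ∃ t ∈ F, ∀ x ∈ t, ∀ m, |r.1 m| * ‖coord m x - b m‖ ≤ ε := by
    intro r ε hε
    obtain ⟨t, ht, htt⟩ := hsmall r ε hε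
    refine ⟨t, ht, fun x hx m => ?_⟩
    refine le_of_tendsto (((hb m).const_sub (coord m x)).norm.const_mul |r.1 m|) ?_
    filter_upwards [ht] with y hy
    rw [← map_sub]
    exact (mul_norm_coord_le_seminorm (x - y) r m).trans (htt x hx y hy).le
  let a : WeightedSeq R B := ⟨b, fun r hr => by
    obtain ⟨t, ht, htt⟩ := hclose ⟨r, hr⟩ 1 one_pos
    obtain ⟨x, hx⟩ := Filter.nonempty_of_mem ht
    obtain ⟨C, hC⟩ := exists_mul_norm_coord_le x ⟨r, hr⟩
    refine ⟨C + 1, fun m => ?_⟩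
    calc |r m| * ‖b m‖ ≤ |r m| * (‖coord m x‖ + ‖coord m x - b m‖) := by
          gcongr
          have := norm_sub_norm_le (b m) (coord m x)
          rw [norm_sub_rev] at this
          linarith
      _ ≤ C + 1 := by rw [mul_add]; exact add_le_add (hC m) (htt x hx m)⟩
  refine ⟨a, ?_⟩
  change Tendsto id F (𝓝 a)
  rw [withSeminorms.tendsto_nhds]
  intro r ε hε
  obtain ⟨t, ht, htt⟩ := hclose r (ε / 2) (half_pos hε)
  filter_upwards [ht] with x hx
  refine (seminorm_le (half_pos hε).le fun m => ?_).trans_lt (half_lt_self hε)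
  rw [map_sub]
  exact htt x hx m

end WeightedSeq

end WeightedSeq

/-! ### Tensor products with a nuclear sequence space -/

section NuclearSeq

variable {I : Type*}

/-- `S` is a sequence space over `I`, with coordinate functionals `ev` and unit vectors `δ`, the
topology of which is given by the set of weights `R` and which is nuclear, as every weight is
dominated by the product of a summable family and another weight.

The topology is compared with the weights from both sides: by `weight_continuous`, multiplication by a
weight is continuous into `ℓ^∞`, and by `unit_mem`, every neighbourhood of zero contains all unit
vectors divided by a suitable weight. The latter suffices for a bound from above, as the expansion in
unit vectors can be summed by `dominated`. -/
structure IsNuclearSeqSpace (R : Set (I → ℝ)) (S : Type*) [AddCommGroup S] [Module ℂ S]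
    [TopologicalSpace S] (ev : I → S →ₗ[ℂ] ℂ) (δ : I → S) : Prop where
  ev_self : ∀ m, ev m (δ m) = 1
  ev_of_ne : ∀ l m, l ≠ m → ev l (δ m) = 0
  hasSum : ∀ c, HasSum (fun m => ev m c • δ m) c
  weight_continuous : ∀ r ∈ R, ∃ T : S →ₗ[ℂ] lp (fun _ : I => ℂ) ∞, Continuous T ∧
    ∀ c m, T c m = r m * ev m c
  unit_mem : ∀ V ∈ 𝓝 (0 : S), ∃ r ∈ R, ∀ m, 0 < r m ∧ ((r m : ℂ)⁻¹) • δ m ∈ V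
  dominated : ∀ r ∈ R, ∃ r' ∈ R, ∃ ε : I → ℝ, Summable ε ∧ ∀ m, 0 ≤ ε m ∧ |r m| ≤ ε m * |r' m|

variable {R : Set (I → ℝ)} {S : Type*} [AddCommGroup S] [Module ℂ S] [TopologicalSpace S]
  {ev : I → S →ₗ[ℂ] ℂ} {δ : I → S}
  {B : Type*} [SeminormedAddCommGroup B] [NormedSpace ℂ B]

namespace IsNuclearSeqSpace

theorem exists_ne_zero (hS : IsNuclearSeqSpace R S ev δ) (m : I) : ∃ r ∈ R, r m ≠ 0 := by
  obtain ⟨r, hr, h⟩ := hS.unit_mem _ Filter.univ_mem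
  exact ⟨r, hr, (h m).1.ne'⟩

theorem exists_weight_mul_norm_ev_le (hS : IsNuclearSeqSpace R S ev δ) {r : I → ℝ} (hr : r ∈ R) (c : S) :
    ∃ C, ∀ m, |r m| * ‖ev m c‖ ≤ C := by
  obtain ⟨T, -, hT⟩ := hS.weight_continuous r hr
  refine ⟨‖T c‖, fun m => ?_⟩
  have := lp.norm_apply_le_norm (by simp) (T c) m
  rwa [hT, norm_mul, Complex.norm_real] at this

variable (B) in
/-- The linear map from `B ⊗ S` to the `B`-valued sequences with `b ⊗ c ↦ (cₘ b)ₘ`. -/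
noncomputable def tensorSeq (hS : IsNuclearSeqSpace R S ev δ) : B ⊗[ℂ] S →ₗ[ℂ] WeightedSeq R B :=
  TensorProduct.lift <| LinearMap.mk₂ ℂ
    (fun b c => WeightedSeq.mk (fun m => ev m c • b) fun r hr => by
      obtain ⟨C, hC⟩ := hS.exists_weight_mul_norm_ev_le hr c
      refine ⟨C * ‖b‖, fun m => ?_⟩
      rw [norm_smul, ← mul_assoc]
      gcongr
      exact hC m)
    (fun a b c => WeightedSeq.ext_coord fun m => smul_add (ev m c) a b)
    (fun z b c => WeightedSeq.ext_coord fun m => smul_comm (ev m c) z b)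
    (fun b c d => WeightedSeq.ext_coord fun m => by
      change ev m (c + d) • b = ev m c • b + ev m d • b
      rw [map_add, add_smul])
    (fun z b c => WeightedSeq.ext_coord fun m => by
      change ev m (z • c) • b = z • ev m c • b
      rw [map_smul, smul_eq_mul, mul_smul])

theorem coord_tensorSeq_tmul (hS : IsNuclearSeqSpace R S ev δ) (m : I) (b : B) (c : S) :
    WeightedSeq.coord m (hS.tensorSeq B (b ⊗ₜ c)) = ev m c • b := rfl

/-- Finitely supported sequences are images of finite sums `∑ aₘ ⊗ δₘ`, and they are dense because
every weighted sequence tends to zero, being bounded with respect to a larger weight. -/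
theorem denseRange_tensorSeq (hS : IsNuclearSeqSpace R S ev δ) : DenseRange (hS.tensorSeq B) := by
  classical
  intro a
  have hmem : ∀ F : Finset I, hS.tensorSeq B (∑ m ∈ F, WeightedSeq.coord m a ⊗ₜ δ m) ∈
      Set.range (hS.tensorSeq B) := fun F => ⟨_, rfl⟩
  refine mem_closure_of_tendsto (f := fun F : Finset I =>
    hS.tensorSeq B (∑ m ∈ F, WeightedSeq.coord m a ⊗ₜ δ m)) (b := atTop) ?_ (Eventually.of_forall hmem)
  have hcoord : ∀ (F : Finset I) l,
      WeightedSeq.coord l (hS.tensorSeq B (∑ m ∈ F, WeightedSeq.coord m a ⊗ₜ δ m) - a)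
        = if l ∈ F then 0 else -WeightedSeq.coord l a := by
    intro F l
    rw [map_sub, map_sum, map_sum]
    simp only [coord_tensorSeq_tmul]
    have : ∀ m ∈ F, ev l (δ m) • WeightedSeq.coord m a =
        if l = m then WeightedSeq.coord l a else 0 := by
      intro m _
      split_ifs with h
      · rw [h, hS.ev_self, one_smul]
      · rw [hS.ev_of_ne l m h, zero_smul]
    rw [Finset.sum_congr rfl this, Finset.sum_ite_eq]
    split_ifs <;> simp
  rw [WeightedSeq.withSeminorms.tendsto_nhds]
  intro r η hη
  obtain ⟨r', hr', ε, hε, hrr⟩ := hS.dominated r.1 r.2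
  obtain ⟨C, hC⟩ := WeightedSeq.exists_mul_norm_coord_le a ⟨r', hr'⟩
  have h0 : Tendsto (fun m => ε m * max C 0) cofinite (𝓝 0) := by
    simpa using hε.tendsto_cofinite_zero.mul_const (max C 0)
  have h1 : ∀ᶠ m in cofinite, ε m * max C 0 < η / 2 := h0.eventually_lt_const (half_pos hη)
  have h2 : {m | ¬ ε m * max C 0 < η / 2}.Finite := h1
  filter_upwards [Filter.eventually_ge_atTop h2.toFinset] with F hF
  refine (WeightedSeq.seminorm_le (half_pos hη).le fun m => ?_).trans_lt (half_lt_self hη)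
  rw [hcoord]
  split_ifs with hm
  · rw [norm_zero, mul_zero]
    exact (half_pos hη).le
  · have h3 : ε m * max C 0 < η / 2 := by
      by_contra h
      exact hm (hF (h2.mem_toFinset.2 h))
    rw [norm_neg]
    calc |r.1 m| * ‖WeightedSeq.coord m a‖ ≤ ε m * |r' m| * ‖WeightedSeq.coord m a‖ := by
          gcongr
          exact (hrr m).2
      _ = ε m * (|r' m| * ‖WeightedSeq.coord m a‖) := mul_assoc _ _ _
      _ ≤ ε m * max C 0 := by
          have := (hrr m).1
          gcongr
          exact (hC m).trans (le_max_left _ _)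
      _ ≤ η / 2 := h3.le

/-- If a sublinear functional `p` on `B` is bounded by `a` on the ball of radius `d`, then
`p x ≤ d⁻¹ a ‖x‖`. -/
theorem _root_.Seminorm.le_of_le_on_ball {p : Seminorm ℂ B} {d a : ℝ} (hd : 0 < d)
    (h : ∀ x, ‖x‖ < d → p x ≤ a) (x : B) : p x ≤ d⁻¹ * a * ‖x‖ := by
  have ha : 0 ≤ a := (apply_nonneg p 0).trans (h 0 (by simpa using hd))
  have h1 : ∀ s > ‖x‖, p x ≤ d⁻¹ * a * s := by
    intro s hs
    have hs0 : 0 < s := (norm_nonneg x).trans_lt hs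
    have h2 := h (((d / s : ℝ) : ℂ) • x) (by
      rw [norm_smul, Complex.norm_real, Real.norm_eq_abs, abs_of_pos (div_pos hd hs0), div_mul_eq_mul_div,
        div_lt_iff₀ hs0]
      gcongr)
    rw [map_smul_eq_mul, Complex.norm_real, Real.norm_eq_abs, abs_of_pos (div_pos hd hs0),
      div_mul_eq_mul_div, div_le_iff₀ hs0] at h2
    rw [mul_assoc, inv_mul_eq_div, le_div_iff₀ hd, mul_comm]
    exact h2
  refine le_of_forall_pos_le_add fun η hη => ?_
  have h3 : 0 ≤ d⁻¹ * a := by positivity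
  refine (h1 (‖x‖ + η / (d⁻¹ * a + 1)) (by linarith [show 0 < η / (d⁻¹ * a + 1) by positivity])).trans ?_
  rw [mul_add]
  gcongr
  rw [mul_div_assoc', div_le_iff₀ (by positivity)]
  nlinarith

/-- The summation underlying the comparison of the topologies: nonnegative terms `b m` dominated by
`r m * ‖a m‖` have a sum dominated by a seminorm of `a`. -/
theorem exists_sum_le_seminorm (hS : IsNuclearSeqSpace R S ev δ) {r : I → ℝ} (hr : r ∈ R) {D : ℝ}
    (hD : 0 ≤ D) :
    ∃ (r' : R) (C : ℝ), 0 ≤ C ∧ ∀ (a : WeightedSeq R B) (b : I → ℝ), (∀ m, 0 ≤ b m) →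
      (∀ m, b m ≤ D * |r m| * ‖WeightedSeq.coord m a‖) →
        Summable b ∧ ∑' m, b m ≤ C * WeightedSeq.seminorm r' a := by
  obtain ⟨r', hr', ε, hε, hrr⟩ := hS.dominated r hr
  refine ⟨⟨r', hr'⟩, D * ∑' m, ε m, mul_nonneg hD (tsum_nonneg fun m => (hrr m).1),
    fun a b hb hba => ?_⟩
  have h1 : ∀ m, b m ≤ ε m * (D * WeightedSeq.seminorm ⟨r', hr'⟩ a) := by
    intro m
    have h2 := WeightedSeq.mul_norm_coord_le_seminorm a ⟨r', hr'⟩ m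
    have h3 := (hrr m).1
    calc b m ≤ D * |r m| * ‖WeightedSeq.coord m a‖ := hba m
      _ ≤ D * (ε m * |r' m|) * ‖WeightedSeq.coord m a‖ := by gcongr; exact (hrr m).2
      _ = ε m * (D * (|r' m| * ‖WeightedSeq.coord m a‖)) := by ring
      _ ≤ _ := by gcongr
  have h2 := hε.mul_right (D * WeightedSeq.seminorm ⟨r', hr'⟩ a)
  have h3 := Summable.of_nonneg_of_le hb h1 h2
  refine ⟨h3, (h3.tsum_le_tsum h1 h2).trans (le_of_eq ?_)⟩
  rw [tsum_mul_right]
  ring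

/-- The functionals `r m • ev m` are equicontinuous, since their supremum is a continuous seminorm. -/
theorem equicontinuous_weight_mul_ev (hS : IsNuclearSeqSpace R S ev δ) {r : I → ℝ} (hr : r ∈ R) :
    ∃ g : I → S →L[ℂ] ℂ, (∀ m c, g m c = r m * ev m c) ∧
      Equicontinuous (fun (h : Set.range g) (c : S) => h.1 c) := by
  obtain ⟨T, hT, hTr⟩ := hS.weight_continuous r hr
  refine ⟨fun m => ⟨(r m : ℂ) • ev m, ?_⟩, fun m c => rfl, ?_⟩
  · have : (fun c => ((r m : ℂ) • ev m) c) = fun c => T c m := by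
      funext c
      exact (hTr c m).symm
    change Continuous fun c => ((r m : ℂ) • ev m) c
    rw [this]
    exact (lp.lipschitzWith_one_eval ∞ m).continuous.comp hT
  · intro c₀
    rw [Metric.equicontinuousAt_iff_right]
    intro η hη
    have h1 : ∀ᶠ c in 𝓝 c₀, ‖T c - T c₀‖ < η := by
      have := (hT.continuousAt (x := c₀)).eventually (Metric.ball_mem_nhds _ hη)
      simpa only [Metric.mem_ball, dist_eq_norm] using this
    filter_upwards [h1] with c hc
    rintro ⟨_, m, rfl⟩
    change dist ((r m : ℂ) * ev m c₀) ((r m : ℂ) * ev m c) < η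
    rw [← hTr, ← hTr, dist_comm, dist_eq_norm]
    exact (lp.norm_apply_le_norm (by simp) (T c - T c₀) m).trans_lt hc

end IsNuclearSeqSpace

end NuclearSeq

/-! ### The projective and the injective topology -/

section NuclearTensor

variable {I : Type*} {R : Set (I → ℝ)} {S : Type*} [AddCommGroup S] [Module ℂ S] [TopologicalSpace S]
  {ev : I → S →ₗ[ℂ] ℂ} {δ : I → S}
  {B : Type*} [SeminormedAddCommGroup B] [NormedSpace ℂ B]

theorem IsLocallyConvexTopology.induced {V W : Type*} [AddCommGroup V] [Module ℂ V] [AddCommGroup W]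
    [Module ℂ W] {t : TopologicalSpace W} (ht : IsLocallyConvexTopology W t) (f : V →ₗ[ℂ] W) :
    IsLocallyConvexTopology V (t.induced f) where
  isTopologicalAddGroup := by
    have := ht.isTopologicalAddGroup
    exact topologicalAddGroup_induced f
  continuousSMul := by
    have := ht.continuousSMul
    exact continuousSMul_induced f
  locallyConvexSpace := by
    have := ht.locallyConvexSpace
    exact LocallyConvexSpace.induced (f.restrictScalars ℝ)

theorem ProjTensor.continuous_mk (X Y : Type*) [AddCommGroup X] [Module ℂ X] [TopologicalSpace X]
    [AddCommGroup Y] [Module ℂ Y] [TopologicalSpace Y] : Continuous (ProjTensor.mk X Y) :=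
  continuous_sInf_rng.2 fun _ ht => ht.2

/-- `c ↦ b ⊗ c` as a linear map. -/
def ProjTensor.mkRight {X : Type*} (Y : Type*) [AddCommGroup X] [Module ℂ X] [AddCommGroup Y] [Module ℂ Y]
    (b : X) : Y →ₗ[ℂ] ProjTensor X Y where
  toFun c := ProjTensor.mk X Y (b, c)
  map_add' := TensorProduct.tmul_add b
  map_smul' z c := TensorProduct.tmul_smul z b c

/-- `b ↦ b ⊗ c` as a linear map. -/
def ProjTensor.mkLeft (X : Type*) {Y : Type*} [AddCommGroup X] [Module ℂ X] [AddCommGroup Y] [Module ℂ Y]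
    (c : Y) : X →ₗ[ℂ] ProjTensor X Y where
  toFun b := ProjTensor.mk X Y (b, c)
  map_add' a b := TensorProduct.add_tmul a b c
  map_smul' z b := TensorProduct.smul_tmul' z b c

theorem ProjTensor.induction {X Y : Type*} [AddCommGroup X] [Module ℂ X] [AddCommGroup Y] [Module ℂ Y]
    {motive : ProjTensor X Y → Prop} (zero : motive 0) (mk : ∀ p, motive (ProjTensor.mk X Y p))
    (add : ∀ u v, motive u → motive v → motive (u + v)) (u : ProjTensor X Y) : motive u :=
  TensorProduct.induction_on (motive := motive) u zero (fun b c => mk (b, c)) add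

/-- The elementary tensor `b ⊗ c`. -/
def InjTensor.tmul {X Y : Type*} [AddCommGroup X] [Module ℂ X] [AddCommGroup Y] [Module ℂ Y]
    (b : X) (c : Y) : InjTensor X Y := b ⊗ₜ[ℂ] c

theorem InjTensor.induction {X Y : Type*} [AddCommGroup X] [Module ℂ X] [AddCommGroup Y] [Module ℂ Y]
    {motive : InjTensor X Y → Prop} (zero : motive 0) (tmul : ∀ b c, motive (InjTensor.tmul b c))
    (add : ∀ u v, motive u → motive v → motive (u + v)) (u : InjTensor X Y) : motive u :=
  TensorProduct.induction_on (motive := motive) u zero tmul add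

/-- A linear map is inducing when it is continuous and every continuous seminorm on its domain is
dominated by a continuous seminorm of its values. -/
theorem isInducing_of_seminorm_le {V : Type*} [AddCommGroup V] [Module ℂ V] [TopologicalSpace V]
    [PolynormableSpace ℂ V] {f : V →ₗ[ℂ] WeightedSeq R B} (hf : Continuous f)
    (h : ∀ p : Seminorm ℂ V, Continuous p →
      ∃ (r : R) (C : ℝ), ∀ u, p u ≤ C * WeightedSeq.seminorm r (f u)) : IsInducing f := by
  rw [isInducing_iff_nhds]
  refine fun u => le_antisymm (map_le_iff_le_comap.1 (hf.tendsto u)) ?_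
  change Tendsto id (comap f (𝓝 (f u))) (𝓝 u)
  rw [(PolynormableSpace.withSeminorms ℂ V).tendsto_nhds]
  intro p η hη
  obtain ⟨r, C, hC⟩ := h p.1 p.2
  have h1 : Tendsto (fun v => C * WeightedSeq.seminorm r (f v - f u)) (comap f (𝓝 (f u))) (𝓝 0) := by
    have h2 : Continuous fun a => C * WeightedSeq.seminorm r (a - f u) :=
      continuous_const.mul ((WeightedSeq.withSeminorms.continuous_seminorm r).comp
        (continuous_id.sub continuous_const))
    have h3 := h2.tendsto (f u)
    rw [sub_self, map_zero, mul_zero] at h3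
    exact h3.comp tendsto_comap
  filter_upwards [h1.eventually_lt_const hη] with v hv
  exact (hC (v - u)).trans_lt (by rwa [map_sub])

open scoped ComplexOrder

namespace IsNuclearSeqSpace

/-- The map `b ⊗ c ↦ (cₘ b)ₘ` on the projective tensor product. -/
noncomputable def projTensorSeq (hS : IsNuclearSeqSpace R S ev δ) (B : Type*) [SeminormedAddCommGroup B]
    [NormedSpace ℂ B] : ProjTensor B S →ₗ[ℂ] WeightedSeq R B := hS.tensorSeq B

/-- The map `b ⊗ c ↦ (cₘ b)ₘ` on the injective tensor product. -/
noncomputable def injTensorSeq (hS : IsNuclearSeqSpace R S ev δ) (B : Type*) [SeminormedAddCommGroup B]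
    [NormedSpace ℂ B] : InjTensor B S →ₗ[ℂ] WeightedSeq R B := hS.tensorSeq B

theorem coord_projTensorSeq_mk (hS : IsNuclearSeqSpace R S ev δ) (m : I) (p : B × S) :
    WeightedSeq.coord m (hS.projTensorSeq B (ProjTensor.mk B S p)) = ev m p.2 • p.1 := rfl

theorem continuous_projTensorSeq (hS : IsNuclearSeqSpace R S ev δ) : Continuous (hS.projTensorSeq B) := by
  rw [continuous_iff_le_induced]
  refine sInf_le ⟨IsLocallyConvexTopology.induced ⟨inferInstance, inferInstance, inferInstance⟩ _, ?_⟩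
  rw [continuous_induced_rng, continuous_iff_continuousAt]
  rintro ⟨b₀, c₀⟩
  rw [ContinuousAt, WeightedSeq.withSeminorms.tendsto_nhds]
  intro r η hη
  obtain ⟨T, hT, hTr⟩ := hS.weight_continuous r.1 r.2
  have h1 : ∀ p : B × S, WeightedSeq.seminorm r (hS.projTensorSeq B (ProjTensor.mk B S p) -
      hS.projTensorSeq B (ProjTensor.mk B S (b₀, c₀))) ≤ ‖T p.2 - T c₀‖ * ‖p.1‖ + ‖T c₀‖ * ‖p.1 - b₀‖ := by
    intro p
    refine WeightedSeq.seminorm_le (by positivity) fun m => ?_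
    rw [map_sub, coord_projTensorSeq_mk, coord_projTensorSeq_mk]
    have h2 : (r.1 m : ℂ) • (ev m p.2 • p.1 - ev m c₀ • b₀)
        = (T p.2 - T c₀) m • p.1 + T c₀ m • (p.1 - b₀) := by
      rw [lp.coeFn_sub, Pi.sub_apply, hTr, hTr, smul_sub, smul_smul, smul_smul, sub_smul, smul_sub]
      abel
    have h3 : |r.1 m| * ‖ev m p.2 • p.1 - ev m c₀ • b₀‖
        = ‖(r.1 m : ℂ) • (ev m p.2 • p.1 - ev m c₀ • b₀)‖ := by
      rw [norm_smul, Complex.norm_real, Real.norm_eq_abs]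
    change |r.1 m| * ‖ev m p.2 • p.1 - ev m c₀ • b₀‖ ≤ _
    rw [h3, h2]
    refine (norm_add_le _ _).trans ?_
    rw [norm_smul, norm_smul]
    gcongr
    · exact lp.norm_apply_le_norm (by simp) _ m
    · exact lp.norm_apply_le_norm (by simp) _ m
  have h2 : Tendsto (fun p : B × S => ‖T p.2 - T c₀‖ * ‖p.1‖ + ‖T c₀‖ * ‖p.1 - b₀‖) (𝓝 (b₀, c₀)) (𝓝 0) := by
    have h3 : Continuous fun p : B × S => ‖T p.2 - T c₀‖ * ‖p.1‖ + ‖T c₀‖ * ‖p.1 - b₀‖ := by fun_prop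
    have h4 := h3.tendsto (b₀, c₀)
    simpa using h4
  filter_upwards [h2.eventually_lt_const hη] with p hp
  exact (h1 p).trans_lt hp

theorem hasSum_projTensor (hS : IsNuclearSeqSpace R S ev δ) (u : ProjTensor B S) :
    HasSum (fun m => ProjTensor.mk B S (WeightedSeq.coord m (hS.projTensorSeq B u), δ m)) u := by
  induction u using ProjTensor.induction with
  | zero =>
    refine hasSum_of_eq (fun m => ?_) hasSum_zero
    rw [map_zero, map_zero]
    exact TensorProduct.zero_tmul _ _
  | mk p =>
    have h1 : Continuous (ProjTensor.mkRight S p.1) :=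
      (ProjTensor.continuous_mk B S).comp (Continuous.prodMk_right p.1)
    refine hasSum_of_eq (fun m => ?_) ((hS.hasSum p.2).map (ProjTensor.mkRight S p.1) h1)
    rw [Function.comp_apply, map_smul]
    exact map_smul (ProjTensor.mkLeft B (δ m)) (ev m p.2) p.1
  | add u v hu hv =>
    refine hasSum_of_eq (fun m => ?_) (hu.add hv)
    rw [map_add, map_add]
    exact TensorProduct.add_tmul _ _ _

/-- A continuous seminorm `p` of the projective topology satisfies `p (b ⊗ δₘ) ≤ C r m ‖b‖` for some
weight `r`. Summing over the expansion of a tensor in unit vectors bounds `p` by a weighted seminorm. -/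
theorem isInducing_projTensorSeq (hS : IsNuclearSeqSpace R S ev δ) : IsInducing (hS.projTensorSeq B) := by
  have := (ProjTensor.isLocallyConvexTopology B S).locallyConvexSpace
  have : ContinuousSMul ℝ (ProjTensor B S) := IsScalarTower.continuousSMul ℂ
  have : LocallyConvexSpace ℂ (ProjTensor B S) :=
    ⟨fun x => by
      simpa only [convex_RCLike_iff_convex_real] using LocallyConvexSpace.convex_basis (𝕜 := ℝ) x⟩
  have : PolynormableSpace ℂ (ProjTensor B S) := LocallyConvexSpace.toPolynormableSpace
  refine isInducing_of_seminorm_le hS.continuous_projTensorSeq fun p hp => ?_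
  have h1 : {q : B × S | p (ProjTensor.mk B S q) < 1} ∈ 𝓝 ((0 : B), (0 : S)) := by
    have h2 : ContinuousAt (fun q : B × S => p (ProjTensor.mk B S q)) ((0 : B), (0 : S)) :=
      (hp.comp (ProjTensor.continuous_mk B S)).continuousAt
    refine h2.eventually_lt continuousAt_const ?_
    have : ProjTensor.mk B S ((0 : B), (0 : S)) = 0 := TensorProduct.zero_tmul _ _
    rw [this, map_zero]
    exact one_pos
  obtain ⟨W, hW, V, hV, hWV⟩ := mem_nhds_prod_iff.1 h1
  obtain ⟨d, hd, hdW⟩ := Metric.mem_nhds_iff.1 hW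
  obtain ⟨r, hr, hrV⟩ := hS.unit_mem V hV
  have h2 : ∀ m (x : B), p (ProjTensor.mk B S (x, δ m)) ≤ d⁻¹ * |r m| * ‖x‖ := by
    intro m x
    let P : Seminorm ℂ B := p.comp (ProjTensor.mkLeft B (δ m))
    refine Seminorm.le_of_le_on_ball (p := P) hd (fun y hy => ?_) x
    obtain ⟨hrm, hm⟩ := hrV m
    have h3 : p (ProjTensor.mk B S (y, ((r m : ℂ)⁻¹) • δ m)) < 1 :=
      hWV (Set.mk_mem_prod (hdW (by simpa using hy)) hm)
    have h4 : ProjTensor.mk B S (y, ((r m : ℂ)⁻¹) • δ m) = ((r m : ℂ)⁻¹) • ProjTensor.mk B S (y, δ m) :=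
      TensorProduct.tmul_smul _ _ _
    rw [h4, map_smul_eq_mul, norm_inv, Complex.norm_real, Real.norm_eq_abs,
      inv_mul_lt_iff₀ (abs_pos.2 hrm.ne'), mul_one] at h3
    exact h3.le
  obtain ⟨r', C, hC, hsum⟩ := hS.exists_sum_le_seminorm (B := B) hr (inv_nonneg.2 hd.le)
  refine ⟨r', C, fun u => ?_⟩
  obtain ⟨h3, h4⟩ := hsum (hS.projTensorSeq B u) _ (fun m => apply_nonneg p _) (fun m => h2 m _)
  refine le_trans ?_ h4
  refine le_of_tendsto' ((hp.tendsto u).comp (hS.hasSum_projTensor u)) fun F => ?_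
  exact (Finset.le_sum_of_subadditive p (map_zero _).le (map_add_le_add _) F _).trans
    (h3.sum_le_tsum F fun m _ => apply_nonneg p _)

theorem toForm_tmul (b : B) (c : S) (p : (B →L[ℂ] ℂ) × (S →L[ℂ] ℂ)) :
    UniformOnFun.toFun _ (InjTensor.toForm B S (InjTensor.tmul b c)) p = p.1 b * p.2 c := rfl

theorem toForm_add (u v : InjTensor B S) (p : (B →L[ℂ] ℂ) × (S →L[ℂ] ℂ)) :
    UniformOnFun.toFun _ (InjTensor.toForm B S (u + v)) p =
      UniformOnFun.toFun _ (InjTensor.toForm B S u) p + UniformOnFun.toFun _ (InjTensor.toForm B S v) p := by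
  rw [map_add]
  rfl

/-- The form associated to a tensor, evaluated on a pair of functionals, is the sum over the
coordinates of the tensor. -/
theorem hasSum_toForm (hS : IsNuclearSeqSpace R S ev δ) (u : InjTensor B S)
    (p : (B →L[ℂ] ℂ) × (S →L[ℂ] ℂ)) :
    HasSum (fun m => p.1 (WeightedSeq.coord m (hS.injTensorSeq B u)) * p.2 (δ m))
      (UniformOnFun.toFun _ (InjTensor.toForm B S u) p) := by
  induction u using InjTensor.induction with
  | zero =>
    rw [map_zero]
    refine hasSum_of_eq (fun m => ?_) hasSum_zero
    rw [map_zero, map_zero]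
    exact zero_mul _
  | tmul b c =>
    rw [toForm_tmul]
    refine hasSum_of_eq (fun m => ?_) (((hS.hasSum c).mapL p.2).mul_left (p.1 b))
    change p.1 (ev m c • b) * p.2 (δ m) = _
    rw [map_smul, map_smul, smul_eq_mul, smul_eq_mul]
    ring
  | add u v hu hv =>
    rw [toForm_add]
    refine hasSum_of_eq (fun m => ?_) (hu.add hv)
    rw [map_add, map_add, map_add, add_mul]

theorem toForm_weight_ev (hS : IsNuclearSeqSpace R S ev δ) {r : I → ℝ} {g : I → S →L[ℂ] ℂ}
    (hg : ∀ m c, g m c = r m * ev m c) (u : InjTensor B S) (f : B →L[ℂ] ℂ) (m : I) :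
    UniformOnFun.toFun _ (InjTensor.toForm B S u) (f, g m)
      = r m * f (WeightedSeq.coord m (hS.injTensorSeq B u)) := by
  refine (hS.hasSum_toForm u (f, g m)).unique ?_
  have h1 := hasSum_single (f := fun l => f (WeightedSeq.coord l (hS.injTensorSeq B u)) * g m (δ l)) m
    fun l hl => by rw [hg, hS.ev_of_ne m l hl.symm, mul_zero, mul_zero]
  rwa [hg, hS.ev_self, mul_one, mul_comm] at h1

/-- The injective topology is finer than the one induced by the weighted sequences by the Hahn–Banach
theorem, testing with the products of the unit ball of the dual of `B` and the functionals `r m • ev m`.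
It is coarser since, on a product of equicontinuous sets, the form of a tensor `u` is at most
`C ∑ₘ r m ‖aₘ‖`, where `a` is the sequence of coordinates of `u`. -/
theorem isInducing_injTensorSeq (hS : IsNuclearSeqSpace R S ev δ) : IsInducing (hS.injTensorSeq B) := by
  have htend : ∀ {K : Type _} {l : Filter K} (F : K → InjTensor B S) (u : InjTensor B S),
      Tendsto F l (𝓝 u) ↔ ∀ s ∈ equicontinuousProducts B S, TendstoUniformlyOn
        (fun k => UniformOnFun.toFun _ (InjTensor.toForm B S (F k)))
        (UniformOnFun.toFun _ (InjTensor.toForm B S u)) l s := by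
    intro K l F u
    rw [nhds_induced, tendsto_comap_iff, UniformOnFun.tendsto_iff_tendstoUniformlyOn]
    rfl
  rw [isInducing_iff_nhds]
  refine fun u => le_antisymm (map_le_iff_le_comap.1 ?_) ?_
  · change Tendsto (hS.injTensorSeq B) (𝓝 u) _
    rw [WeightedSeq.withSeminorms.tendsto_nhds]
    intro r η hη
    obtain ⟨g, hg, hgeq⟩ := hS.equicontinuous_weight_mul_ev r.2
    have hA : Equicontinuous (fun (f : {f : B →L[ℂ] ℂ | ‖f‖ ≤ 1}) (x : B) => f.1 x) := by
      refine Metric.equicontinuous_of_continuity_modulus (fun t => t) tendsto_id _ fun x y f => ?_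
      rw [dist_eq_norm, dist_eq_norm, ← map_sub]
      exact f.1.le_of_opNorm_le f.2 _ |>.trans_eq (one_mul _)
    have h1 := (htend id u).1 tendsto_id _ ⟨_, _, hA, hgeq, rfl⟩
    rw [Metric.tendstoUniformlyOn_iff] at h1
    filter_upwards [h1 (η / 2) (half_pos hη)] with v hv
    refine (WeightedSeq.seminorm_le (half_pos hη).le fun m => ?_).trans_lt (half_lt_self hη)
    obtain ⟨f, hf, hfx⟩ := exists_dual_vector'' ℂ
      (WeightedSeq.coord m (hS.injTensorSeq B v - hS.injTensorSeq B u))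
    have h2 := hv (f, g m) (Set.mk_mem_prod hf ⟨m, rfl⟩)
    rw [dist_comm, dist_eq_norm, id, toForm_weight_ev hS hg, toForm_weight_ev hS hg, ← mul_sub, ← map_sub,
      ← map_sub, hfx, norm_mul, Complex.norm_real] at h2
    rw [Real.norm_eq_abs] at h2
    simpa using h2.le
  · change Tendsto id (comap (hS.injTensorSeq B) (𝓝 (hS.injTensorSeq B u))) (𝓝 u)
    rw [htend]
    rintro _ ⟨A, G, hA, hG, rfl⟩
    obtain ⟨d, hd, hdA⟩ := Metric.equicontinuousAt_iff.1 (hA 0) 1 one_pos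
    have hG0 := (Metric.equicontinuousAt_iff_right.1 (hG 0)) 1 one_pos
    obtain ⟨r, hr, hrV⟩ := hS.unit_mem _ hG0
    obtain ⟨r', C, hC, hsum⟩ := hS.exists_sum_le_seminorm (B := B) hr (inv_nonneg.2 hd.le)
    have hbound : ∀ w : InjTensor B S, ∀ p ∈ A ×ˢ G,
        ‖UniformOnFun.toFun _ (InjTensor.toForm B S w) p‖ ≤ C * WeightedSeq.seminorm r' (hS.injTensorSeq B w) := by
      rintro w ⟨f, g⟩ ⟨hf, hg⟩
      have h1 : ∀ x : B, ‖f x‖ ≤ d⁻¹ * 1 * ‖x‖ := by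
        refine Seminorm.le_of_le_on_ball (p := (normSeminorm ℂ ℂ).comp (f : B →ₗ[ℂ] ℂ)) hd fun y hy => ?_
        have := hdA y (by simpa using hy) ⟨f, hf⟩
        simp only [map_zero, dist_zero_left] at this
        exact this.le
      have h2 : ∀ m, ‖g (δ m)‖ ≤ |r m| := by
        intro m
        obtain ⟨hrm, hm⟩ := hrV m
        have := hm ⟨g, hg⟩
        simp only [map_zero, dist_zero_left, map_smul, smul_eq_mul, norm_mul, norm_inv, Complex.norm_real,
          Real.norm_eq_abs] at this
        rw [inv_mul_lt_iff₀ (abs_pos.2 hrm.ne'), mul_one] at this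
        exact this.le
      obtain ⟨h3, h4⟩ := hsum (hS.injTensorSeq B w)
        (fun m => ‖f (WeightedSeq.coord m (hS.injTensorSeq B w)) * g (δ m)‖) (fun m => norm_nonneg _) (by
          intro m
          rw [norm_mul]
          calc _ ≤ (d⁻¹ * 1 * ‖WeightedSeq.coord m (hS.injTensorSeq B w)‖) * |r m| := by
                gcongr
                · exact h1 _
                · exact h2 m
            _ = _ := by ring)
      rw [← (hS.hasSum_toForm w (f, g)).tsum_eq]
      exact (norm_tsum_le_tsum_norm h3).trans h4
    rw [Metric.tendstoUniformlyOn_iff]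
    intro η hη
    have h1 : Tendsto (fun v => C * WeightedSeq.seminorm r' (hS.injTensorSeq B v - hS.injTensorSeq B u))
        (comap (hS.injTensorSeq B) (𝓝 (hS.injTensorSeq B u))) (𝓝 0) := by
      have h2 : Continuous fun a => C * WeightedSeq.seminorm r' (a - hS.injTensorSeq B u) :=
        continuous_const.mul ((WeightedSeq.withSeminorms.continuous_seminorm r').comp
          (continuous_id.sub continuous_const))
      have h3 := h2.tendsto (hS.injTensorSeq B u)
      rw [sub_self, map_zero, mul_zero] at h3
      exact h3.comp tendsto_comap
    filter_upwards [h1.eventually_lt_const hη] with v hv p hp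
    have h2 := (hbound (v - u) p hp).trans_lt (by rwa [map_sub])
    rw [map_sub] at h2
    rw [dist_comm, dist_eq_norm]
    exact h2

end IsNuclearSeqSpace

/-- A complete separated space into which `V` maps with dense range and the induced topology is
isomorphic to the completion of `V`. -/
theorem nonempty_completion_equiv {V W : Type*} [AddCommGroup V] [Module ℂ V] [UniformSpace V]
    [IsUniformAddGroup V] [UniformContinuousConstSMul ℂ V] [AddCommGroup W] [Module ℂ W] [UniformSpace W]
    [IsUniformAddGroup W] [ContinuousSMul ℂ W] [CompleteSpace W] [T0Space W] (f : V →ₗ[ℂ] W)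
    (hf : IsInducing f) (hd : DenseRange f) : Nonempty (W ≃L[ℂ] UniformSpace.Completion V) := by
  let pkg : AbstractCompletion V :=
    ⟨W, f, inferInstance, inferInstance, inferInstance,
      AddMonoidHom.isUniformInducing_of_isInducing hf, hd⟩
  let e : UniformSpace.Completion V ≃ᵤ W := (UniformSpace.Completion.cPkg (α := V)).compareEquiv pkg
  have he : ∀ v : V, e (v : UniformSpace.Completion V) = f v := fun v =>
    (UniformSpace.Completion.cPkg (α := V)).compare_coe pkg v
  have hec : Continuous e := e.continuous
  refine ⟨ContinuousLinearEquiv.symm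
    { toFun := e
      invFun := e.symm
      map_add' := fun x y => ?_
      map_smul' := fun z x => ?_
      left_inv := e.left_inv
      right_inv := e.right_inv
      continuous_toFun := e.continuous
      continuous_invFun := e.symm.continuous }⟩
  · induction x, y using UniformSpace.Completion.induction_on₂ with
    | hp => exact isClosed_eq (hec.comp continuous_add) ((hec.comp continuous_fst).add (hec.comp continuous_snd))
    | ih a b => rw [← UniformSpace.Completion.coe_add, he, he, he, map_add]
  · induction x using UniformSpace.Completion.induction_on with
    | hp => exact isClosed_eq (hec.comp (continuous_const_smul z)) (hec.const_smul z)
    | ih a => rw [← UniformSpace.Completion.coe_smul, he, he, map_smul, RingHom.id_apply]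

namespace IsNuclearSeqSpace

theorem nonempty_equiv_completedProjTensor [CompleteSpace B] [T0Space B]
    (hS : IsNuclearSeqSpace R S ev δ) :
    Nonempty (WeightedSeq R B ≃L[ℂ] CompletedProjTensor B S) := by
  have := WeightedSeq.completeSpace (B := B) hS.exists_ne_zero
  have := WeightedSeq.t0Space (B := B) hS.exists_ne_zero
  exact nonempty_completion_equiv _ hS.isInducing_projTensorSeq hS.denseRange_tensorSeq

theorem nonempty_equiv_completedInjTensor [CompleteSpace B] [T0Space B]
    (hS : IsNuclearSeqSpace R S ev δ) :
    Nonempty (WeightedSeq R B ≃L[ℂ] CompletedInjTensor B S) := by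
  have := WeightedSeq.completeSpace (B := B) hS.exists_ne_zero
  have := WeightedSeq.t0Space (B := B) hS.exists_ne_zero
  exact nonempty_completion_equiv _ hS.isInducing_injTensorSeq hS.denseRange_tensorSeq

end IsNuclearSeqSpace

end NuclearTensor

/-! ### The sequence spaces `s` and `s'` as nuclear sequence spaces -/

namespace WeightedBounded

variable {I : Type*} {w : I → ℝ}

theorem mul_norm_le (c : WeightedBounded w) (k : I) : |w k| * ‖c.1 k‖ ≤ ‖c‖ := by
  have h := lp.norm_apply_le_norm (by simp) (toBounded w c) k
  change ‖(w k : ℂ) * c.1 k‖ ≤ ‖c‖ at h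
  rwa [norm_mul, Complex.norm_real] at h

theorem norm_le {c : WeightedBounded w} {C : ℝ} (hC : 0 ≤ C) (h : ∀ k, |w k| * ‖c.1 k‖ ≤ C) :
    ‖c‖ ≤ C := by
  refine lp.norm_le_of_forall_le (f := toBounded w c) hC fun k => ?_
  change ‖(w k : ℂ) * c.1 k‖ ≤ C
  rw [norm_mul, Complex.norm_real]
  exact h k

theorem _root_.mem_weightedBoundedSubmodule_iff {c : I → ℂ} :
    c ∈ weightedBoundedSubmodule w ↔ ∃ C, ∀ k, |w k| * ‖c k‖ ≤ C := by
  change Memℓp (fun k => (w k : ℂ) * c k) ∞ ↔ _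
  rw [memℓp_infty_iff]
  simp only [BddAbove, upperBounds, Set.Nonempty, Set.mem_ofPred_eq, Set.forall_mem_range, norm_mul,
    Complex.norm_real, Real.norm_eq_abs]

theorem _root_.single_mem_weightedBoundedSubmodule [DecidableEq I] (m : I) :
    (Pi.single m 1 : I → ℂ) ∈ weightedBoundedSubmodule w := by
  refine mem_weightedBoundedSubmodule_iff.2 ⟨|w m|, fun k => ?_⟩
  by_cases h : k = m
  · simp [h]
  · simp [h]

/-- The unit vectors of `ℓ^∞_w`. -/
def unit [DecidableEq I] (w : I → ℝ) (m : I) : WeightedBounded w :=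
  ⟨Pi.single m 1, single_mem_weightedBoundedSubmodule m⟩

/-- The coordinates of an element of `ℓ^∞_w`. -/
def coord (w : I → ℝ) (k : I) : WeightedBounded w →ₗ[ℂ] ℂ :=
  (LinearMap.proj k).comp (weightedBoundedSubmodule w).subtype

theorem norm_smul_unit_le [DecidableEq I] (z : ℂ) (m : I) : ‖z • unit w m‖ ≤ |w m| * ‖z‖ := by
  refine norm_le (by positivity) fun k => ?_
  change |w k| * ‖z * (Pi.single m 1 : I → ℂ) k‖ ≤ _
  by_cases h : k = m
  · simp [h]
  · simp only [ne_eq, h, not_false_eq_true, Pi.single_eq_of_ne, mul_zero, norm_zero]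
    positivity

/-- The finite sections of a sequence converge in `ℓ^∞_w` if its weighted entries tend to zero. -/
theorem hasSum_unit [DecidableEq I] (c : WeightedBounded w)
    (h : Tendsto (fun m => |w m| * ‖c.1 m‖) cofinite (𝓝 0)) :
    HasSum (fun m => c.1 m • unit w m) c := by
  have hcoord : ∀ (F : Finset I) l,
      coord w l (∑ m ∈ F, c.1 m • unit w m - c) = if l ∈ F then 0 else -c.1 l := by
    intro F l
    rw [map_sub, map_sum]
    have : ∀ m ∈ F, coord w l (c.1 m • unit w m) = if l = m then c.1 l else 0 := by
      intro m _
      rw [map_smul]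
      change c.1 m * (Pi.single m 1 : I → ℂ) l = _
      split_ifs with h
      · simp [h]
      · simp [h]
    rw [Finset.sum_congr rfl this, Finset.sum_ite_eq]
    change _ - c.1 l = _
    split_ifs <;> simp
  rw [HasSum, SummationFilter.unconditional_filter, tendsto_iff_norm_sub_tendsto_zero]
  rw [Metric.tendsto_nhds]
  intro η hη
  have h2 : {m | ¬ |w m| * ‖c.1 m‖ < η / 2}.Finite := h.eventually_lt_const (half_pos hη)
  filter_upwards [Filter.eventually_ge_atTop h2.toFinset] with F hF
  rw [Real.dist_0_eq_abs, abs_norm]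
  refine (norm_le (half_pos hη).le fun m => ?_).trans_lt (half_lt_self hη)
  change |w m| * ‖coord w m (∑ b ∈ F, c.1 b • unit w b - c)‖ ≤ _
  rw [hcoord]
  split_ifs with hm
  · rw [norm_zero, mul_zero]
    exact (half_pos hη).le
  · rw [norm_neg]
    by_contra! hcon
    exact hm (hF (h2.mem_toFinset.2 (not_lt.2 hcon.le)))

/-- Multiplication by `r` is continuous from `ℓ^∞_w` to `ℓ^∞` if `r` is bounded by a multiple of `w`. -/
theorem exists_weight_mul {r : I → ℝ} {C : ℝ} (h : ∀ m, |r m| ≤ C * |w m|) :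
    ∃ T : WeightedBounded w →ₗ[ℂ] lp (fun _ : I => ℂ) ∞, Continuous T ∧
      ∀ c m, T c m = r m * c.1 m := by
  have hb : ∀ (c : WeightedBounded w) m, ‖(r m : ℂ) * c.1 m‖ ≤ max C 0 * ‖c‖ := by
    intro c m
    rw [norm_mul, Complex.norm_real, Real.norm_eq_abs]
    calc |r m| * ‖c.1 m‖ ≤ (max C 0 * |w m|) * ‖c.1 m‖ := by
          gcongr
          exact (h m).trans (by gcongr; exact le_max_left _ _)
      _ = max C 0 * (|w m| * ‖c.1 m‖) := mul_assoc _ _ _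
      _ ≤ _ := by gcongr; exact mul_norm_le c m
  let T : WeightedBounded w →ₗ[ℂ] lp (fun _ : I => ℂ) ∞ :=
    { toFun := fun c => ⟨fun m => (r m : ℂ) * c.1 m, memℓp_infty ⟨_, by rintro _ ⟨m, rfl⟩; exact hb c m⟩⟩
      map_add' := fun a b => by
        ext k
        exact mul_add _ _ _
      map_smul' := fun z a => by
        ext k
        exact mul_left_comm _ _ _ }
  refine ⟨T, AddMonoidHomClass.continuous_of_bound T (max C 0) fun c => ?_, fun c m => rfl⟩
  exact lp.norm_le_of_forall_le (by positivity) (hb c)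

end WeightedBounded

section Weights

variable {n : ℕ}

theorem abs_polyWeight (N : ℤ) (k : Fin n → ℤ) : |polyWeight n N k| = latticeWeight k ^ N :=
  abs_of_pos (zpow_pos (latticeWeight_pos k) N)

theorem abs_polyWeight_natCast (N : ℕ) (k : Fin n → ℤ) : |polyWeight n N k| = latticeWeight k ^ N := by
  rw [abs_polyWeight, zpow_natCast]

theorem abs_polyWeight_neg (N : ℕ) (k : Fin n → ℤ) :
    |polyWeight n (-(N : ℤ)) k| = (latticeWeight k ^ N)⁻¹ := by
  rw [abs_polyWeight, zpow_neg, zpow_natCast]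

/-- The weights of polynomial growth on `ℤⁿ`. -/
def polyGrowthWeights (n : ℕ) : Set ((Fin n → ℤ) → ℝ) :=
  {r | ∃ (N : ℕ) (C : ℝ), ∀ m, |r m| ≤ C * latticeWeight m ^ N}

/-- The rapidly decreasing weights on `ℤⁿ`. -/
def rapidDecayWeights (n : ℕ) : Set ((Fin n → ℤ) → ℝ) :=
  {r | ∀ N : ℕ, ∃ C : ℝ, ∀ m, latticeWeight m ^ N * |r m| ≤ C}

theorem tendsto_inv_latticeWeight_pow (n : ℕ) (C : ℝ) :
    Tendsto (fun m : Fin n → ℤ => C * (latticeWeight m ^ (2 * n))⁻¹) cofinite (𝓝 0) := by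
  simpa using (summable_inv_latticeWeight_pow n).tendsto_cofinite_zero.const_mul C

namespace RapidSeq

theorem tendsto_nhds_iff {K : Type*} {l : Filter K} {F : K → RapidSeq n} {c : RapidSeq n} :
    Tendsto F l (𝓝 c) ↔ ∀ N, Tendsto (fun k => toStep N (F k)) l (𝓝 (toStep N c)) := by
  rw [nhds_iInf, tendsto_iInf]
  refine forall_congr' fun N => ?_
  rw [nhds_induced, tendsto_comap_iff]
  rfl

/-- The inclusion of `s` into `ℓ^∞_{(1 + |·|)^N}` as a linear map. -/
noncomputable def toStepLinear (N : ℕ) : RapidSeq n →ₗ[ℂ] WeightedBounded (polyWeight n N) where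
  toFun := toStep N
  map_add' _ _ := rfl
  map_smul' _ _ := rfl

/-- The coordinates of an element of `s`. -/
noncomputable def coord (k : Fin n → ℤ) : RapidSeq n →ₗ[ℂ] ℂ := (LinearMap.proj k).comp (rapidSubmodule n).subtype

/-- The unit vectors of `s`. -/
noncomputable def unit (m : Fin n → ℤ) : RapidSeq n :=
  ⟨Pi.single m 1, (Submodule.mem_iInf _).2 fun _ => single_mem_weightedBoundedSubmodule m⟩

/-- The norms of the steps increase with `N`, so a single one determines a neighbourhood contained in
a given one. -/
theorem exists_step_of_mem_nhds_zero {V : Set (RapidSeq n)} (hV : V ∈ 𝓝 0) :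
    ∃ N : ℕ, ∃ ε > 0, ∀ c : RapidSeq n, ‖toStep N c‖ < ε → c ∈ V := by
  by_contra! h
  choose c hc hcV using fun N : ℕ => h N (((N : ℝ) + 1)⁻¹) (by positivity)
  have h1 : Tendsto c atTop (𝓝 0) := by
    rw [tendsto_nhds_iff]
    intro N
    rw [tendsto_iff_norm_sub_tendsto_zero]
    refine squeeze_zero' (Eventually.of_forall fun _ => norm_nonneg _) ?_
      (tendsto_one_div_add_atTop_nhds_zero_nat (𝕜 := ℝ))
    filter_upwards [eventually_ge_atTop N] with M hM
    have h2 : toStep N (c M) - toStep N (0 : RapidSeq n) = toStep N (c M) := sub_zero _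
    rw [h2, one_div]
    refine le_trans ?_ (hc M).le
    refine WeightedBounded.norm_le (norm_nonneg _) fun k => ?_
    refine le_trans ?_ (WeightedBounded.mul_norm_le (toStep M (c M)) k)
    rw [abs_polyWeight_natCast, abs_polyWeight_natCast]
    change latticeWeight k ^ N * ‖(c M).1 k‖ ≤ latticeWeight k ^ M * ‖(c M).1 k‖
    have := one_le_latticeWeight k
    gcongr
  obtain ⟨N, hN⟩ := (h1.eventually hV).exists
  exact hcV N hN

theorem isNuclearSeqSpace (n : ℕ) :
    IsNuclearSeqSpace (polyGrowthWeights n) (RapidSeq n) coord unit where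
  ev_self m := by
    change (Pi.single m 1 : (Fin n → ℤ) → ℂ) m = 1
    simp
  ev_of_ne l m h := by
    change (Pi.single m 1 : (Fin n → ℤ) → ℂ) l = 0
    simp [h]
  hasSum c := by
    rw [HasSum, SummationFilter.unconditional_filter, tendsto_nhds_iff]
    intro N
    have h1 : Tendsto (fun m => |polyWeight n N m| * ‖(toStep N c).1 m‖) cofinite (𝓝 0) := by
      refine squeeze_zero (fun _ => by positivity) (fun m => ?_)
        (tendsto_inv_latticeWeight_pow n ‖toStep (N + 2 * n) c‖)
      have h2 := WeightedBounded.mul_norm_le (toStep (N + 2 * n) c) m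
      have hw := latticeWeight_pos m
      rw [abs_polyWeight_natCast, pow_add] at h2
      rw [abs_polyWeight_natCast, ← div_eq_mul_inv, le_div_iff₀ (by positivity)]
      refine le_trans (le_of_eq ?_) h2
      change latticeWeight m ^ N * ‖c.1 m‖ * latticeWeight m ^ (2 * n) =
        latticeWeight m ^ N * latticeWeight m ^ (2 * n) * ‖c.1 m‖
      ring
    refine (WeightedBounded.hasSum_unit (toStep N c) h1).congr fun F => ?_
    change _ = toStepLinear N _
    rw [map_sum]
    rfl
  weight_continuous := by
    rintro r ⟨N, C, hr⟩
    obtain ⟨T, hT, hTr⟩ := WeightedBounded.exists_weight_mul (w := polyWeight n N) (C := C)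
      (fun m => (hr m).trans_eq (by rw [abs_polyWeight_natCast]))
    refine ⟨T ∘ₗ toStepLinear N, hT.comp ?_, fun c m => hTr _ m⟩
    exact continuous_iInf_dom (i := N) continuous_induced_dom
  unit_mem V hV := by
    obtain ⟨N, ε, hε, h⟩ := exists_step_of_mem_nhds_zero hV
    refine ⟨fun m => 2 / ε * latticeWeight m ^ N, ⟨N, |2 / ε|, fun m => ?_⟩, fun m => ⟨?_, ?_⟩⟩
    · rw [abs_mul, abs_of_pos (pow_pos (latticeWeight_pos m) N)]
    · exact mul_pos (by positivity) (pow_pos (latticeWeight_pos m) N)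
    · have hw := latticeWeight_pos m
      refine h _ ((WeightedBounded.norm_smul_unit_le _ m).trans_lt ?_)
      rw [abs_polyWeight_natCast, norm_inv, Complex.norm_real, Real.norm_eq_abs,
        abs_of_pos (by positivity)]
      have : latticeWeight m ^ N * (2 / ε * latticeWeight m ^ N)⁻¹ = ε / 2 := by field_simp
      rw [this]
      exact half_lt_self hε
  dominated := by
    rintro r ⟨N, C, hr⟩
    refine ⟨fun m => C * latticeWeight m ^ (N + 2 * n), ⟨N + 2 * n, |C|, fun m => ?_⟩, _,
      summable_inv_latticeWeight_pow n, fun m => ⟨?_, ?_⟩⟩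
    · rw [abs_mul, abs_of_pos (pow_pos (latticeWeight_pos m) _)]
    · exact inv_nonneg.2 (pow_nonneg (latticeWeight_pos m).le _)
    · have hw := latticeWeight_pos m
      rw [abs_mul, abs_of_pos (pow_pos hw _), pow_add]
      have : (latticeWeight m ^ (2 * n))⁻¹ * (|C| * (latticeWeight m ^ N * latticeWeight m ^ (2 * n)))
          = |C| * latticeWeight m ^ N := by field_simp
      rw [this]
      exact (hr m).trans (by gcongr; exact le_abs_self C)

end RapidSeq

namespace SlowSeq

theorem continuous_ofStep (N : ℕ) : Continuous (ofStep (n := n) N) :=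
  continuous_sInf_rng.2 fun _ ht => ht.2 N

/-- A linear map from `s'` to a locally convex space is continuous if its restrictions to the steps
are. -/
theorem continuous_of_step {W : Type*} [AddCommGroup W] [Module ℂ W] {t : TopologicalSpace W}
    (ht : IsLocallyConvexTopology W t) (T : SlowSeq n →ₗ[ℂ] W)
    (h : ∀ N, Continuous fun c => T (ofStep N c)) : Continuous T :=
  continuous_iff_le_induced.2 <|
    sInf_le ⟨ht.induced T, fun N => continuous_induced_rng.2 (h N)⟩

/-- The inclusion of `ℓ^∞_{(1 + |·|)^{-N}}` into `s'` as a linear map. -/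
noncomputable def ofStepLinear (N : ℕ) : WeightedBounded (polyWeight n (-(N : ℤ))) →ₗ[ℂ] SlowSeq n where
  toFun := ofStep N
  map_add' _ _ := rfl
  map_smul' _ _ := rfl

/-- The coordinates of an element of `s'`. -/
noncomputable def coord (k : Fin n → ℤ) : SlowSeq n →ₗ[ℂ] ℂ := (LinearMap.proj k).comp (slowSubmodule n).subtype

/-- The unit vectors of `s'`. -/
noncomputable def unit (m : Fin n → ℤ) : SlowSeq n :=
  ⟨Pi.single m 1, mem_slowSubmodule.2 ⟨0, single_mem_weightedBoundedSubmodule m⟩⟩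

theorem exists_norm_coord_le (c : SlowSeq n) : ∃ (N : ℕ) (C : ℝ), ∀ m,
    ‖coord m c‖ ≤ C * latticeWeight m ^ N := by
  obtain ⟨N, hN⟩ := mem_slowSubmodule.1 c.2
  obtain ⟨C, hC⟩ := mem_weightedBoundedSubmodule_iff.1 hN
  refine ⟨N, C, fun m => ?_⟩
  have h1 := hC m
  rw [abs_polyWeight_neg, inv_mul_le_iff₀ (pow_pos (latticeWeight_pos m) N), mul_comm] at h1
  exact h1

/-- A weight adapted to the ball radii `ε N` in the steps of the inductive limit: at each `m`, it is the
minimum of `(1 + |m|)^(-N) / ε N` over the finitely many `N ≤ 1 + |m|`. The minimum is attained, and every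
`N` takes part in it for all but finitely many `m`, which makes the weight rapidly decreasing. -/
theorem exists_rapidDecay_weight {ε : ℕ → ℝ} (hε : ∀ N, 0 < ε N) :
    ∃ r ∈ rapidDecayWeights n, ∀ m, 0 < r m ∧ ∃ N, (latticeWeight m ^ N)⁻¹ / ε N = r m := by
  have h1 : ∀ m : Fin n → ℤ, ∃ N, ∀ K ≤ ⌊latticeWeight m⌋₊,
      (latticeWeight m ^ N)⁻¹ / ε N ≤ (latticeWeight m ^ K)⁻¹ / ε K := by
    intro m
    obtain ⟨N, -, hN⟩ := Finset.exists_min_image (Finset.range (⌊latticeWeight m⌋₊ + 1))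
      (fun N => (latticeWeight m ^ N)⁻¹ / ε N) ⟨0, by simp⟩
    exact ⟨N, fun K hK => hN K (by simpa [Nat.lt_succ_iff] using hK)⟩
  choose N hN using h1
  have hpos : ∀ m : Fin n → ℤ, 0 < (latticeWeight m ^ N m)⁻¹ / ε (N m) := fun m =>
    div_pos (inv_pos.2 (pow_pos (latticeWeight_pos m) _)) (hε _)
  refine ⟨fun m => (latticeWeight m ^ N m)⁻¹ / ε (N m), fun K => ⟨max (ε K)⁻¹ ((K : ℝ) ^ K / ε 0), fun m => ?_⟩,
    fun m => ⟨hpos m, N m, rfl⟩⟩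
  have hw := latticeWeight_pos m
  rw [abs_of_pos (hpos m)]
  by_cases hK : K ≤ ⌊latticeWeight m⌋₊
  · refine le_trans ?_ (le_max_left _ _)
    calc latticeWeight m ^ K * ((latticeWeight m ^ N m)⁻¹ / ε (N m))
        ≤ latticeWeight m ^ K * ((latticeWeight m ^ K)⁻¹ / ε K) := by gcongr _ * ?_; exact hN m K hK
      _ = (ε K)⁻¹ := by field_simp
  · refine le_trans ?_ (le_max_right _ _)
    have h2 : latticeWeight m ≤ K := by
      rw [not_le, Nat.floor_lt hw.le] at hK
      exact hK.le
    have h3 := hN m 0 (Nat.zero_le _)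
    have h4 := hε 0
    rw [pow_zero, inv_one, one_div] at h3
    calc latticeWeight m ^ K * ((latticeWeight m ^ N m)⁻¹ / ε (N m))
        ≤ (K : ℝ) ^ K * (ε 0)⁻¹ := by
          have := (hpos m).le
          gcongr
      _ = _ := by rw [div_eq_mul_inv]

theorem isNuclearSeqSpace (n : ℕ) :
    IsNuclearSeqSpace (rapidDecayWeights n) (SlowSeq n) coord unit where
  ev_self m := by
    change (Pi.single m 1 : (Fin n → ℤ) → ℂ) m = 1
    simp
  ev_of_ne l m h := by
    change (Pi.single m 1 : (Fin n → ℤ) → ℂ) l = 0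
    simp [h]
  hasSum c := by
    obtain ⟨N, C, hC⟩ := exists_norm_coord_le c
    have h0 : ∀ m, (latticeWeight m ^ (N + 2 * n))⁻¹ * ‖c.1 m‖ ≤ C * (latticeWeight m ^ (2 * n))⁻¹ := by
      intro m
      have hw := latticeWeight_pos m
      rw [inv_mul_le_iff₀ (by positivity), pow_add]
      refine (hC m).trans (le_of_eq ?_)
      field_simp
    have hmem : c.1 ∈ weightedBoundedSubmodule (polyWeight n (-((N + 2 * n : ℕ) : ℤ))) := by
      refine mem_weightedBoundedSubmodule_iff.2 ⟨|C|, fun m => ?_⟩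
      rw [abs_polyWeight_neg]
      refine (h0 m).trans ?_
      have h1 : (latticeWeight m ^ (2 * n))⁻¹ ≤ 1 := inv_le_one_of_one_le₀ (one_le_pow₀ (one_le_latticeWeight m))
      have h2 : 0 ≤ (latticeWeight m ^ (2 * n))⁻¹ := inv_nonneg.2 (pow_nonneg (latticeWeight_pos m).le _)
      calc C * (latticeWeight m ^ (2 * n))⁻¹ ≤ |C| * 1 := by
            gcongr
            exact le_abs_self C
        _ = |C| := mul_one _
    have h1 : Tendsto (fun m => |polyWeight n (-((N + 2 * n : ℕ) : ℤ)) m| * ‖c.1 m‖) cofinite (𝓝 0) := by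
      refine squeeze_zero (fun _ => by positivity) (fun m => ?_) (tendsto_inv_latticeWeight_pow n C)
      rw [abs_polyWeight_neg]
      exact h0 m
    have h2 := (WeightedBounded.hasSum_unit (w := polyWeight n (-((N + 2 * n : ℕ) : ℤ))) ⟨c.1, hmem⟩ h1).map
      (ofStepLinear (N + 2 * n)) (continuous_ofStep _)
    exact h2
  weight_continuous := by
    intro r hr
    have hb : ∀ c : SlowSeq n, ∃ C, ∀ m, ‖(r m : ℂ) * coord m c‖ ≤ C := by
      intro c
      obtain ⟨N, C, hC⟩ := exists_norm_coord_le c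
      obtain ⟨D, hD⟩ := hr N
      refine ⟨|C| * D, fun m => ?_⟩
      have hw := latticeWeight_pos m
      rw [norm_mul, Complex.norm_real, Real.norm_eq_abs]
      calc |r m| * ‖coord m c‖ ≤ |r m| * (|C| * latticeWeight m ^ N) := by
            gcongr
            exact (hC m).trans (by gcongr; exact le_abs_self C)
        _ = |C| * (latticeWeight m ^ N * |r m|) := by ring
        _ ≤ |C| * D := by gcongr; exact hD m
    let T : SlowSeq n →ₗ[ℂ] lp (fun _ : Fin n → ℤ => ℂ) ∞ :=
      { toFun := fun c => ⟨fun m => (r m : ℂ) * coord m c,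
          memℓp_infty ((hb c).imp fun C hC => by rintro _ ⟨m, rfl⟩; exact hC m)⟩
        map_add' := fun a b => by
          ext k
          exact mul_add _ _ _
        map_smul' := fun z a => by
          ext k
          exact mul_left_comm _ _ _ }
    refine ⟨T, continuous_of_step ⟨inferInstance, inferInstance, NormedSpace.toLocallyConvexSpace' ℂ⟩ T
      fun N => ?_, fun c m => rfl⟩
    obtain ⟨D, hD⟩ := hr N
    obtain ⟨T', hT', hTr⟩ := WeightedBounded.exists_weight_mul (w := polyWeight n (-(N : ℤ))) (r := r) (C := D)
      (fun m => by
        rw [abs_polyWeight_neg, ← div_eq_mul_inv, le_div_iff₀ (pow_pos (latticeWeight_pos m) N), mul_comm]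
        exact hD m)
    have : (fun c => T (ofStep N c)) = T' := by
      funext c
      ext m
      exact (hTr c m).symm
    rw [this]
    exact hT'
  unit_mem V hV := by
    have h1 : ∀ N : ℕ, ∃ ε > 0, ∀ c : WeightedBounded (polyWeight n (-(N : ℤ))), ‖c‖ ≤ ε → ofStep N c ∈ V := by
      intro N
      have h2 : ofStep (n := n) N ⁻¹' V ∈ 𝓝 0 := (continuous_ofStep N).continuousAt.preimage_mem_nhds hV
      obtain ⟨ε, hε, h⟩ := Metric.nhds_basis_closedBall.mem_iff.1 h2
      exact ⟨ε, hε, fun c hc => h (by simpa using hc)⟩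
    choose ε hε h using h1
    obtain ⟨r, hr, hrm⟩ := exists_rapidDecay_weight (n := n) hε
    refine ⟨r, hr, fun m => ⟨(hrm m).1, ?_⟩⟩
    obtain ⟨hpos, N, hN⟩ := hrm m
    refine h N (((r m : ℂ)⁻¹) • WeightedBounded.unit _ m) ((WeightedBounded.norm_smul_unit_le _ m).trans ?_)
    have hw := latticeWeight_pos m
    have hεN := hε N
    rw [abs_polyWeight_neg, norm_inv, Complex.norm_real, Real.norm_eq_abs, abs_of_pos hpos, ← hN]
    refine le_of_eq ?_
    field_simp
  dominated := by
    intro r hr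
    refine ⟨fun m => latticeWeight m ^ (2 * n) * r m, fun N => ?_, _,
      summable_inv_latticeWeight_pow n, fun m => ⟨?_, ?_⟩⟩
    · obtain ⟨C, hC⟩ := hr (N + 2 * n)
      refine ⟨C, fun m => le_trans (le_of_eq ?_) (hC m)⟩
      rw [abs_mul, abs_of_pos (pow_pos (latticeWeight_pos m) _), pow_add, mul_assoc]
    · exact inv_nonneg.2 (pow_nonneg (latticeWeight_pos m).le _)
    · have hw := latticeWeight_pos m
      rw [abs_mul, abs_of_pos (pow_pos hw _), inv_mul_cancel_left₀ (by positivity)]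

end SlowSeq

end Weights

/-! ### The local cosine basis on the line -/

section LocalCosine

open Real MeasureTheory

theorem Real.smoothTransition_one_sub (x : ℝ) : smoothTransition (1 - x) = 1 - smoothTransition x := by
  have h := smoothTransition.pos_denom x
  rw [smoothTransition, smoothTransition, sub_sub_cancel, eq_sub_iff_add_eq,
    add_comm (expNegInvGlue (1 - x)), ← add_div, add_comm, div_self h.ne']

/-- A smooth bell function supported in `[-1/2, 3/2]`, symmetric about `1/2`, the squares of the
integer translates of which add up to `1`. -/
noncomputable def bell (t : ℝ) : ℝ :=
  sin (π / 2 * smoothTransition (t + 1 / 2)) * cos (π / 2 * smoothTransition (t - 1 / 2))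

theorem contDiff_bell : ContDiff ℝ ((⊤ : ℕ∞) : WithTop ℕ∞) bell := by
  have h : ContDiff ℝ ((⊤ : ℕ∞) : WithTop ℕ∞) smoothTransition := smoothTransition.contDiff
  have h1 : ContDiff ℝ ((⊤ : ℕ∞) : WithTop ℕ∞) fun t : ℝ => smoothTransition (t + 1 / 2) :=
    h.comp (contDiff_id.add contDiff_const)
  have h2 : ContDiff ℝ ((⊤ : ℕ∞) : WithTop ℕ∞) fun t : ℝ => smoothTransition (t - 1 / 2) :=
    h.comp (contDiff_id.sub contDiff_const)
  exact (contDiff_sin.comp (contDiff_const.mul h1)).mul (contDiff_cos.comp (contDiff_const.mul h2))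

theorem continuous_bell : Continuous bell := contDiff_bell.continuous

theorem bell_of_le {t : ℝ} (ht : t ≤ -(1 / 2)) : bell t = 0 := by
  rw [bell, smoothTransition.zero_of_nonpos (by linarith), mul_zero, sin_zero, zero_mul]

theorem bell_of_ge {t : ℝ} (ht : 3 / 2 ≤ t) : bell t = 0 := by
  rw [bell, smoothTransition.one_of_one_le (x := t - 1 / 2) (by linarith), mul_one, cos_pi_div_two,
    mul_zero]

theorem bell_one_sub (t : ℝ) : bell (1 - t) = bell t := by
  have h1 : (1 : ℝ) - t + 1 / 2 = 1 - (t - 1 / 2) := by ring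
  have h2 : (1 : ℝ) - t - 1 / 2 = 1 - (t + 1 / 2) := by ring
  have h3 : ∀ s : ℝ, π / 2 * (1 - s) = π / 2 - π / 2 * s := fun s => by ring
  rw [bell, h1, h2, smoothTransition_one_sub, smoothTransition_one_sub, h3, h3, sin_pi_div_two_sub,
    cos_pi_div_two_sub, mul_comm, bell]

theorem bell_sq_add_bell_neg_sq {t : ℝ} (h : |t| ≤ 1 / 2) : bell t ^ 2 + bell (-t) ^ 2 = 1 := by
  obtain ⟨h1, h2⟩ := abs_le.1 h
  have h3 : -t + 1 / 2 = 1 - (t + 1 / 2) := by ring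
  rw [bell, bell, smoothTransition.zero_of_nonpos (x := t - 1 / 2) (by linarith),
    smoothTransition.zero_of_nonpos (x := -t - 1 / 2) (by linarith), h3, smoothTransition_one_sub,
    mul_sub, mul_one, sin_pi_div_two_sub, mul_zero, cos_zero, mul_one, mul_one]
  exact sin_sq_add_cos_sq _

theorem integral_eq_intervalIntegral_fold {F : Type*} [NormedAddCommGroup F] [NormedSpace ℝ F]
    {g : ℝ → F} (hg : Continuous g) (h0 : ∀ t ≤ -(1 / 2), g t = 0) (h1 : ∀ t, 3 / 2 ≤ t → g t = 0) :
    ∫ t, g t = ∫ t in (0 : ℝ)..1, (g t + g (-t) + g (2 - t)) := by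
  have hsupp : Function.support g ⊆ Set.Ioc (-1) 2 := by
    intro t ht
    constructor
    · by_contra! h
      exact ht (h0 t (by linarith))
    · by_contra! h
      exact ht (h1 t (by linarith))
  have hi : ∀ a b : ℝ, IntervalIntegrable g volume a b := fun a b => hg.intervalIntegrable a b
  have hn : IntervalIntegrable (fun t => g (-t)) volume 0 1 :=
    (hg.comp continuous_neg).intervalIntegrable _ _
  have h2 : IntervalIntegrable (fun t => g (2 - t)) volume 0 1 :=
    (hg.comp (continuous_const.sub continuous_id)).intervalIntegrable _ _
  rw [← intervalIntegral.integral_eq_integral_of_support_subset hsupp,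
    ← intervalIntegral.integral_add_adjacent_intervals (hi (-1) 0) (hi 0 2),
    ← intervalIntegral.integral_add_adjacent_intervals (hi 0 1) (hi 1 2),
    intervalIntegral.integral_add ((hi 0 1).add hn) h2, intervalIntegral.integral_add (hi 0 1) hn,
    intervalIntegral.integral_comp_neg, intervalIntegral.integral_comp_sub_left]
  norm_num
  abel

theorem cos_half_odd_two_sub (m : ℕ) (t : ℝ) :
    cos (π * (m + 1 / 2) * (2 - t)) = -cos (π * (m + 1 / 2) * t) := by
  have : π * (m + 1 / 2) * (2 - t) = π - π * (m + 1 / 2) * t + m * (2 * π) := by ring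
  rw [this, cos_add_nat_mul_two_pi, cos_pi_sub]

/-- The local cosine functions on the line. -/
noncomputable def localCosine1 (m : ℕ) (t : ℝ) : ℝ := √2 * bell t * cos (π * (m + 1 / 2) * t)

theorem continuous_localCosine1 (m : ℕ) : Continuous (localCosine1 m) := by
  unfold localCosine1
  have := continuous_bell
  fun_prop

theorem localCosine1_of_le (m : ℕ) {t : ℝ} (ht : t ≤ -(1 / 2)) : localCosine1 m t = 0 := by
  rw [localCosine1, bell_of_le ht, mul_zero, zero_mul]

theorem localCosine1_of_ge (m : ℕ) {t : ℝ} (ht : 3 / 2 ≤ t) : localCosine1 m t = 0 := by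
  rw [localCosine1, bell_of_ge ht, mul_zero, zero_mul]

theorem integral_cos_pi_mul {N : ℤ} (hN : N ≠ 0) : ∫ t in (0 : ℝ)..1, cos (π * N * t) = 0 := by
  have h : π * N ≠ 0 := mul_ne_zero pi_ne_zero (by exact_mod_cast hN)
  rw [intervalIntegral.integral_comp_mul_left (fun t => cos t) h, integral_cos, mul_one, mul_zero,
    sin_zero, sub_zero, mul_comm, sin_int_mul_pi, smul_zero]

theorem integral_cos_mul_cos (m l : ℕ) :
    ∫ t in (0 : ℝ)..1, 2 * (cos (π * (m + 1 / 2) * t) * cos (π * (l + 1 / 2) * t)) =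
      if m = l then 1 else 0 := by
  have h1 : ∀ t : ℝ, 2 * (cos (π * (m + 1 / 2) * t) * cos (π * (l + 1 / 2) * t)) =
      cos (π * ((m - l : ℤ) : ℝ) * t) + cos (π * ((m + l + 1 : ℤ) : ℝ) * t) := by
    intro t
    rw [← mul_assoc, two_mul_cos_mul_cos]
    push_cast
    congr 2 <;> ring
  simp only [h1]
  rw [intervalIntegral.integral_add (by apply Continuous.intervalIntegrable; fun_prop)
    (by apply Continuous.intervalIntegrable; fun_prop), integral_cos_pi_mul (N := m + l + 1) (by omega),
    add_zero]
  split_ifs with h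
  · simp [h]
  · exact integral_cos_pi_mul (by omega)

theorem integral_localCosine1_mul_self (m l : ℕ) :
    ∫ t, localCosine1 m t * localCosine1 l t = if m = l then 1 else 0 := by
  rw [integral_eq_intervalIntegral_fold (g := fun t => localCosine1 m t * localCosine1 l t) ((continuous_localCosine1 m).mul (continuous_localCosine1 l))
    (fun t ht => by rw [localCosine1_of_le m ht, zero_mul])
    (fun t ht => by rw [localCosine1_of_ge m ht, zero_mul]), ← integral_cos_mul_cos m l]
  refine intervalIntegral.integral_congr fun t ht => ?_
  rw [Set.uIcc_of_le zero_le_one] at ht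
  have hb : bell t ^ 2 + bell (-t) ^ 2 + bell (2 - t) ^ 2 = 1 := by
    rcases le_total t (1 / 2) with h | h
    · rw [bell_of_ge (t := 2 - t) (by linarith), bell_sq_add_bell_neg_sq (abs_le.2 ⟨by linarith [ht.1], h⟩)]
      ring
    · have h1 : bell t = bell (-(t - 1)) := by rw [← bell_one_sub t]; congr 1; ring
      have h2 : bell (2 - t) = bell (t - 1) := by rw [← bell_one_sub]; congr 1; ring
      rw [bell_of_le (t := -t) (by linarith), h1, h2, add_comm (_ + _), ← add_assoc,
        bell_sq_add_bell_neg_sq (abs_le.2 ⟨by linarith, by linarith [ht.2]⟩)]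
      ring
  have h2 : √2 * √2 = (2 : ℝ) := mul_self_sqrt zero_le_two
  simp only [localCosine1, cos_half_odd_two_sub, mul_neg, cos_neg]
  calc _ = (√2 * √2) * (cos (π * (m + 1 / 2) * t) * cos (π * (l + 1 / 2) * t)) *
        (bell t ^ 2 + bell (-t) ^ 2 + bell (2 - t) ^ 2) := by ring
    _ = _ := by rw [hb, h2, mul_one, mul_assoc]

theorem integral_localCosine1_mul_sub_one (m l : ℕ) :
    ∫ t, localCosine1 m t * localCosine1 l (t - 1) = 0 := by
  have h1 : ∀ t, localCosine1 m (2 - t) * localCosine1 l (2 - t - 1) =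
      -(localCosine1 m t * localCosine1 l (t - 1)) := by
    intro t
    have h2 : bell (2 - t) = bell (t - 1) := by rw [← bell_one_sub]; congr 1; ring
    have h3 : bell (2 - t - 1) = bell t := by rw [← bell_one_sub t]; congr 1; ring
    have h4 : cos (π * (l + 1 / 2) * (2 - t - 1)) = cos (π * (l + 1 / 2) * (t - 1)) := by
      rw [← cos_neg]
      congr 1
      ring
    rw [localCosine1, localCosine1, localCosine1, localCosine1, h2, h3, h4, cos_half_odd_two_sub]
    ring
  have h2 := integral_sub_left_eq_self (fun t => localCosine1 m t * localCosine1 l (t - 1)) volume 2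
  simp only [h1] at h2
  rw [integral_neg] at h2
  linarith

/-- The integer translates of the local cosine functions are orthonormal. -/
theorem integral_localCosine1_sub_mul_sub (m l : ℕ) (j k : ℤ) :
    ∫ t, localCosine1 m (t - j) * localCosine1 l (t - k) = if j = k ∧ m = l then 1 else 0 := by
  have h1 : ∫ t, localCosine1 m (t - j) * localCosine1 l (t - k) =
      ∫ t, localCosine1 m t * localCosine1 l (t - (k - j : ℤ)) := by
    rw [← integral_sub_right_eq_self (fun t => localCosine1 m t * localCosine1 l (t - (k - j : ℤ))) (j : ℝ)]
    congr 1
    ext t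
    push_cast
    congr 2
    ring
  rw [h1]
  rcases lt_trichotomy j k with h | h | h
  · rw [if_neg (fun h' => h.ne h'.1)]
    by_cases h2 : k - j = 1
    · rw [h2]
      exact_mod_cast integral_localCosine1_mul_sub_one m l
    · have h3 : (2 : ℝ) ≤ (k - j : ℤ) := by exact_mod_cast (by omega : (2 : ℤ) ≤ k - j)
      refine (integral_congr_ae (Eventually.of_forall fun t => ?_)).trans (integral_zero _ _)
      rcases le_total t (3 / 2) with ht | ht
      · rw [localCosine1_of_le l (by linarith), mul_zero]
      · rw [localCosine1_of_ge m ht, zero_mul]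
  · subst h
    simpa using integral_localCosine1_mul_self m l
  · rw [if_neg (fun h' => h.ne' h'.1)]
    by_cases h2 : k - j = -1
    · rw [h2, ← integral_sub_right_eq_self _ (1 : ℝ), ← integral_localCosine1_mul_sub_one l m]
      congr 1
      ext t
      push_cast
      rw [mul_comm]
      congr 2
      ring
    · have h3 : ((k - j : ℤ) : ℝ) ≤ -2 := by exact_mod_cast (by omega : k - j ≤ (-2 : ℤ))
      refine (integral_congr_ae (Eventually.of_forall fun t => ?_)).trans (integral_zero _ _)
      rcases le_total t (-(1 / 2)) with ht | ht
      · rw [localCosine1_of_le m ht, zero_mul]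
      · rw [localCosine1_of_ge l (by linarith), mul_zero]

/-- A continuous function on `[0, 1]` that is orthogonal to the functions `cos (π (m + 1/2) t)`
vanishes on `[0, 1)`. Multiplied by `cos (π t / 2)` and extended evenly, it has vanishing Fourier
coefficients. -/
theorem eq_zero_of_integral_mul_cos_eq_zero {K : ℝ → ℂ} (hK : Continuous K)
    (h : ∀ m : ℕ, ∫ t in (0 : ℝ)..1, K t * (cos (π * (m + 1 / 2) * t) : ℝ) = 0) {t : ℝ} (h0 : 0 ≤ t)
    (h1 : t < 1) : K t = 0 := by
  set L : ℝ → ℂ := fun t => K |t| * (cos (π / 2 * t) : ℝ) with hL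
  have hLc : Continuous L := by
    have : Continuous fun t : ℝ => cos (π / 2 * t) := by fun_prop
    exact (hK.comp continuous_abs).mul (Complex.continuous_ofReal.comp this)
  have hLneg : ∀ t, L (-t) = L t := fun t => by simp [hL]
  have : Fact ((0 : ℝ) < 2) := ⟨two_pos⟩
  have hlift : Continuous (AddCircle.liftIco (2 : ℝ) (-1) L) :=
    AddCircle.liftIco_continuous (by rw [hLneg]; congr 1; norm_num) hLc.continuousOn
  have hK' : ∀ n : ℤ, ∫ t in (0 : ℝ)..1, K t * (cos (π * (n + 1 / 2) * t) : ℝ) = 0 := by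
    intro n
    obtain ⟨m, rfl | rfl⟩ := n.eq_nat_or_neg
    · exact_mod_cast h m
    · rcases m with _ | m
      · simpa using h 0
      · rw [← h m]
        congr 1
        ext t
        rw [← cos_neg]
        push_cast
        congr 3
        ring
  have hcoef : ∀ n : ℤ, fourierCoeff (AddCircle.liftIco (2 : ℝ) (-1) L) n = 0 := by
    intro n
    rw [fourierCoeff_liftIco_eq, fourierCoeffOn_eq_integral]
    have hi : ∀ a b, IntervalIntegrable (fun x : ℝ => fourier (-n) (x : AddCircle (-1 + 2 - -1 : ℝ)) • L x)
        volume a b := by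
      intro a b
      apply Continuous.intervalIntegrable
      exact ((map_continuous (fourier (-n))).comp (AddCircle.continuous_mk' _)).smul hLc
    have h3 : ∫ x in (-1 : ℝ)..(-1 + 2), fourier (-n) (x : AddCircle (-1 + 2 - -1 : ℝ)) • L x = 0 := by
      have h4 : (-1 + 2 : ℝ) = 1 := by norm_num
      rw [← intervalIntegral.integral_add_adjacent_intervals (hi (-1) 0) (hi 0 (-1 + 2))]
      have h5 : ∫ x in (-1 : ℝ)..0, fourier (-n) (x : AddCircle (-1 + 2 - -1 : ℝ)) • L x =
          ∫ x in (0 : ℝ)..1, fourier (-n) ((-x : ℝ) : AddCircle (-1 + 2 - -1 : ℝ)) • L (-x) := by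
        rw [intervalIntegral.integral_comp_neg (fun x : ℝ =>
          fourier (-n) (x : AddCircle (-1 + 2 - -1 : ℝ)) • L x), neg_zero]
      rw [h5, h4, ← intervalIntegral.integral_add]
      · calc _ = ∫ x in (0 : ℝ)..1, (K x * (cos (π * (n + 1 / 2) * x) : ℝ) +
              K x * (cos (π * ((-n : ℤ) + 1 / 2) * x) : ℝ)) := by
              refine intervalIntegral.integral_congr fun x hx => ?_
              rw [Set.uIcc_of_le zero_le_one] at hx
              simp only [hLneg, smul_eq_mul, fourier_coe_apply]
              rw [← add_mul, hL]
              simp only [abs_of_nonneg hx.1]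
              rw [← mul_add, mul_left_comm]
              congr 1
              have h6 : Complex.exp (2 * π * Complex.I * (-n : ℤ) * ((-x : ℝ) : ℂ) / ((1 - -1 : ℝ) : ℂ)) =
                  Complex.exp ((π * n * x : ℝ) * Complex.I) := by
                congr 1; push_cast; ring
              have h7 : Complex.exp (2 * π * Complex.I * (-n : ℤ) * (x : ℂ) / ((1 - -1 : ℝ) : ℂ)) =
                  Complex.exp (-(π * n * x : ℝ) * Complex.I) := by
                congr 1; push_cast; ring
              rw [h6, h7, ← Complex.two_cos, ← Complex.ofReal_cos]
              norm_cast
              rw [two_mul_cos_mul_cos, ← cos_neg (π * ((-n : ℤ) + 1 / 2) * x), add_comm]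
              push_cast
              congr 2 <;> ring
          _ = 0 := by
              have hc : ∀ n : ℤ, IntervalIntegrable (fun x : ℝ => K x * (cos (π * (n + 1 / 2) * x) : ℝ))
                  volume 0 1 := by
                intro n
                apply Continuous.intervalIntegrable
                have : Continuous fun t : ℝ => cos (π * (n + 1 / 2) * t) := by fun_prop
                exact hK.mul (Complex.continuous_ofReal.comp this)
              rw [intervalIntegral.integral_add (hc n) (hc (-n)), hK', hK', add_zero]
      · apply Continuous.intervalIntegrable
        exact ((map_continuous (fourier (-n))).comp ((AddCircle.continuous_mk' _).comp continuous_neg)).smul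
          (hLc.comp continuous_neg)
      · apply Continuous.intervalIntegrable
        exact ((map_continuous (fourier (-n))).comp (AddCircle.continuous_mk' _)).smul hLc
    rw [h3, smul_zero]
  have hsum := has_pointwise_sum_fourier_series_of_summable
    (f := ⟨AddCircle.liftIco (2 : ℝ) (-1) L, hlift⟩) (by
      have : fourierCoeff (⟨AddCircle.liftIco (2 : ℝ) (-1) L, hlift⟩ : C(AddCircle (2 : ℝ), ℂ)) = 0 :=
        funext hcoef
      rw [this]
      exact summable_zero) (t : AddCircle (2 : ℝ))
  have hz : AddCircle.liftIco (2 : ℝ) (-1) L (t : AddCircle (2 : ℝ)) = 0 := by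
    refine hsum.unique (hasSum_of_eq (fun i => ?_) hasSum_zero)
    have : fourierCoeff (⟨AddCircle.liftIco (2 : ℝ) (-1) L, hlift⟩ : C(AddCircle (2 : ℝ), ℂ)) i = 0 := hcoef i
    rw [this, zero_smul]
  rw [AddCircle.liftIco_coe_apply ⟨by linarith, by linarith⟩, hL] at hz
  simp only [abs_of_nonneg h0] at hz
  refine (mul_eq_zero.1 hz).resolve_right ?_
  have hpos : 0 < cos (π / 2 * t) :=
    cos_pos_of_mem_Ioo ⟨by nlinarith [pi_pos], by nlinarith [pi_pos]⟩
  exact_mod_cast hpos.ne'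

end LocalCosine

/-! ### Completeness of the local cosine functions -/

section LocalCosineComplete

open Real MeasureTheory

/-- The integer translates of the local cosine functions are complete. Folding the function at the
ends of the unit intervals reduces this to the completeness of the cosines. -/
theorem eq_zero_of_integral_mul_localCosine1_eq_zero {f : ℝ → ℂ} (hf : Continuous f)
    (h : ∀ (m : ℕ) (k : ℤ), ∫ t, f t * (localCosine1 m (t - k) : ℝ) = 0) (t : ℝ) : f t = 0 := by
  have key : ∀ (k : ℤ) (u : ℝ), 0 ≤ u → u < 1 →
      f (k + u) * (bell u : ℝ) + f (k - u) * (bell (-u) : ℝ) - f (k + (2 - u)) * (bell (2 - u) : ℝ) = 0 := by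
    intro k u h0 h1
    set F : ℝ → ℂ := fun u => f (k + u) * (bell u : ℝ) with hF
    have hFc : Continuous F :=
      (hf.comp (continuous_const.add continuous_id)).mul (Complex.continuous_ofReal.comp continuous_bell)
    have hz := eq_zero_of_integral_mul_cos_eq_zero (K := fun t => F t + F (-t) - F (2 - t))
      ((hFc.add (hFc.comp continuous_neg)).sub (hFc.comp (continuous_const.sub continuous_id)))
      (fun m => ?_) h0 h1
    · simpa [hF, sub_eq_add_neg] using hz
    have hcos : Continuous fun t : ℝ => cos (π * (m + 1 / 2) * t) := by fun_prop
    have hfold := integral_eq_intervalIntegral_fold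
      (g := fun t => F t * (cos (π * (m + 1 / 2) * t) : ℝ))
      (hFc.mul (Complex.continuous_ofReal.comp hcos))
      (fun t ht => by simp [hF, bell_of_le ht]) (fun t ht => by simp [hF, bell_of_ge ht])
    have hm := h m k
    rw [← integral_add_right_eq_self _ (k : ℝ)] at hm
    have h2 : ∀ t : ℝ, f (t + k) * (localCosine1 m (t + k - k) : ℝ) =
        (√2 : ℝ) * (F t * (cos (π * (m + 1 / 2) * t) : ℝ)) := by
      intro t
      rw [add_sub_cancel_right, localCosine1, hF]
      simp only [add_comm (k : ℝ)]
      push_cast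
      ring
    simp only [h2] at hm
    rw [integral_const_mul, mul_eq_zero] at hm
    have hm' := hm.resolve_left (by
      rw [Complex.ofReal_eq_zero, sqrt_eq_zero zero_le_two]
      exact two_ne_zero)
    rw [← hm', hfold]
    refine intervalIntegral.integral_congr fun t _ => ?_
    simp only [cos_half_odd_two_sub, mul_neg, cos_neg, Complex.ofReal_neg]
    ring
  have key2 : ∀ (k : ℤ) (u : ℝ), 0 ≤ u → u ≤ 1 / 2 → f (k + u) = 0 ∧ f (k - u) = 0 := by
    intro k u h0 h1
    have hA := key k u h0 (by linarith)
    rw [bell_of_ge (t := 2 - u) (by linarith)] at hA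
    have hB : f (k - u) * (bell u : ℝ) = f (k + u) * (bell (-u) : ℝ) := by
      rcases h0.eq_or_lt with rfl | h0
      · simp
      have h3 := key (k - 1) (1 - u) (by linarith) (by linarith)
      have e1 : bell (2 - (1 - u)) = bell (-u) := by rw [← bell_one_sub (-u)]; congr 1; ring
      have e2 : ((k - 1 : ℤ) : ℝ) + (1 - u) = k - u := by push_cast; ring
      have e3 : ((k - 1 : ℤ) : ℝ) + (2 - (1 - u)) = k + u := by push_cast; ring
      rw [bell_one_sub, bell_of_le (t := -(1 - u)) (by linarith), e1, e2, e3] at h3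
      simpa [sub_eq_zero] using h3
    have hsq : (bell u : ℂ) ^ 2 + (bell (-u) : ℂ) ^ 2 = 1 := by
      exact_mod_cast bell_sq_add_bell_neg_sq (abs_le.2 ⟨by linarith, h1⟩)
    simp only [Complex.ofReal_zero, mul_zero, sub_zero] at hA
    constructor
    · linear_combination (-f (k + u)) * hsq + (bell u : ℂ) * hA - (bell (-u) : ℂ) * hB
    · linear_combination (-f (k - u)) * hsq + (bell (-u) : ℂ) * hA + (bell u : ℂ) * hB
  have hr := abs_sub_round t
  rcases le_total 0 (t - round t) with h0 | h0
  · have := (key2 (round t) (t - round t) h0 (by rwa [abs_of_nonneg h0] at hr)).1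
    rwa [add_sub_cancel] at this
  · have := (key2 (round t) (-(t - round t)) (by linarith) (by rwa [abs_of_nonpos h0] at hr)).2
    rwa [sub_neg_eq_add, add_sub_cancel] at this

theorem prod_localCosine1_eq_zero {n : ℕ} (m : Fin n → ℕ) (k : Fin n → ℤ) {y : Fin n → ℝ}
    (hy : y ∉ Set.univ.pi fun i => Set.Icc ((k i : ℝ) - 1 / 2) (k i + 3 / 2)) :
    ∏ i, localCosine1 (m i) (y i - k i) = 0 := by
  simp only [Set.mem_univ_pi, not_forall, Set.mem_Icc, not_and_or, not_le] at hy
  obtain ⟨i, hi⟩ := hy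
  refine Finset.prod_eq_zero (Finset.mem_univ i) ?_
  rcases hi with hi | hi
  · exact localCosine1_of_le _ (by linarith)
  · exact localCosine1_of_ge _ (by linarith)

theorem continuous_prod_localCosine1 {n : ℕ} (m : Fin n → ℕ) (k : Fin n → ℤ) :
    Continuous fun y : Fin n → ℝ => ∏ i, localCosine1 (m i) (y i - k i) :=
  continuous_finsetProd _ fun i _ =>
    (continuous_localCosine1 (m i)).comp ((continuous_apply i).sub continuous_const)

/-- Completeness of the tensor products of the translated local cosine functions. -/
theorem eq_zero_of_integral_mul_prod_localCosine1_eq_zero {n : ℕ} {f : (Fin n → ℝ) → ℂ}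
    (hf : Continuous f) (h : ∀ (m : Fin n → ℕ) (k : Fin n → ℤ),
      ∫ t, f t * (∏ i, localCosine1 (m i) (t i - k i) : ℝ) = 0) (t : Fin n → ℝ) : f t = 0 := by
  induction n with
  | zero =>
    have := h 0 0
    rw [volume_pi, Measure.pi_of_empty _ t, integral_dirac] at this
    simpa using this
  | succ n ih =>
    have hcons : Continuous fun x : ℝ × (Fin n → ℝ) => f (Fin.cons x.1 x.2) :=
      hf.comp (Continuous.finCons continuous_fst continuous_snd)
    have key : ∀ (m : Fin n → ℕ) (k : Fin n → ℤ) (s : ℝ),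
        ∫ y, f (Fin.cons s y) * (∏ i, localCosine1 (m i) (y i - k i) : ℝ) = 0 := by
      intro m k
      have hS : IsCompact (Set.univ.pi fun i : Fin n => Set.Icc ((k i : ℝ) - 1 / 2) (k i + 3 / 2)) :=
        isCompact_univ_pi fun i => isCompact_Icc
      have hcont : Continuous fun x : ℝ × (Fin n → ℝ) =>
          f (Fin.cons x.1 x.2) * (∏ i, localCosine1 (m i) (x.2 i - k i) : ℝ) :=
        hcons.mul (Complex.continuous_ofReal.comp ((continuous_prod_localCosine1 m k).comp continuous_snd))
      refine eq_zero_of_integral_mul_localCosine1_eq_zero ?_ fun m₀ k₀ => ?_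
      · have := continuous_parametric_integral_of_continuous (μ := (volume : Measure (Fin n → ℝ)))
          (f := fun (s : ℝ) (y : Fin n → ℝ) => f (Fin.cons s y) * (∏ i, localCosine1 (m i) (y i - k i) : ℝ))
          hcont hS
        refine this.congr fun s => ?_
        refine setIntegral_eq_integral_of_forall_compl_eq_zero fun y hy => ?_
        rw [prod_localCosine1_eq_zero m k hy, Complex.ofReal_zero, mul_zero]
      · have h1 := h (Fin.cons m₀ m) (Fin.cons k₀ k)
        have hmp := (volume_preserving_piFinSuccAbove (fun _ : Fin (n + 1) => ℝ) 0).symm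
        rw [← hmp.integral_comp (MeasurableEquiv.measurableEmbedding _)] at h1
        have h2 : ∀ x : ℝ × (Fin n → ℝ), f ((MeasurableEquiv.piFinSuccAbove (fun _ : Fin (n + 1) => ℝ) 0).symm x) *
            (∏ i, localCosine1 ((Fin.cons m₀ m : Fin (n + 1) → ℕ) i)
              ((MeasurableEquiv.piFinSuccAbove (fun _ : Fin (n + 1) => ℝ) 0).symm x i -
                ((Fin.cons k₀ k : Fin (n + 1) → ℤ) i : ℝ)) : ℝ) =
            f (Fin.cons x.1 x.2) * (∏ i, localCosine1 (m i) (x.2 i - k i) : ℝ) *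
              (localCosine1 m₀ (x.1 - k₀) : ℝ) := by
          intro x
          have h3 : (MeasurableEquiv.piFinSuccAbove (fun _ : Fin (n + 1) => ℝ) 0).symm x =
              Fin.cons x.1 x.2 := by
            simp [MeasurableEquiv.piFinSuccAbove]
            rfl
          rw [h3, Fin.prod_univ_succ]
          simp only [Fin.cons_zero, Fin.cons_succ]
          push_cast
          ring
        simp only [h2] at h1
        rw [Measure.volume_eq_prod, integral_prod] at h1
        · rw [← h1]
          congr 1
          funext s
          rw [← integral_mul_const]
        · refine Continuous.integrable_of_hasCompactSupport ?_ ?_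
          · exact hcont.mul (Complex.continuous_ofReal.comp
              ((continuous_localCosine1 m₀).comp (continuous_fst.sub continuous_const)))
          · refine HasCompactSupport.intro ((isCompact_Icc (a := (k₀ : ℝ) - 1 / 2)
              (b := (k₀ : ℝ) + 3 / 2)).prod hS) fun x hx => ?_
            rw [Set.mem_prod, not_and_or] at hx
            rcases hx with hx | hx
            · have : localCosine1 m₀ (x.1 - k₀) = 0 := by
                rw [Set.mem_Icc, not_and_or, not_le, not_le] at hx
                rcases hx with hx | hx
                · exact localCosine1_of_le _ (by linarith)
                · exact localCosine1_of_ge _ (by linarith)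
              rw [this, Complex.ofReal_zero, mul_zero]
            · rw [prod_localCosine1_eq_zero m k hx, Complex.ofReal_zero, mul_zero, zero_mul]
    have := ih (f := fun y => f (Fin.cons (t 0) y)) (hcons.comp (Continuous.prodMk_right (t 0)))
      (fun m k => key m k (t 0)) (Fin.tail t)
    rwa [Fin.cons_self_tail] at this

end LocalCosineComplete

/-! ### The local cosine basis of `ℝⁿ` -/

section LocalCosineSchwartz

open Real MeasureTheory

variable {n : ℕ}

/-- The tensor product of bell functions as a Schwartz function. -/
noncomputable def bellS (n : ℕ) : 𝓢(Rn n, ℂ) :=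
  HasCompactSupport.toSchwartzMap (f := fun t : Rn n => ((∏ i, bell (t i) : ℝ) : ℂ))
    (by
      have hS : IsCompact ((WithLp.toLp 2 : (Fin n → ℝ) → Rn n) ''
          Set.univ.pi fun _ : Fin n => Set.Icc (-1 / 2 : ℝ) (3 / 2)) :=
        (isCompact_univ_pi fun _ => isCompact_Icc).image (PiLp.continuous_toLp 2 _)
      refine HasCompactSupport.intro hS fun t ht => ?_
      by_contra h0
      rw [Complex.ofReal_eq_zero, Finset.prod_eq_zero_iff] at h0
      push Not at h0
      refine ht ⟨WithLp.ofLp t, fun i _ => ⟨?_, ?_⟩, rfl⟩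
      · by_contra! h
        exact h0 i (Finset.mem_univ i) (bell_of_le (by linarith))
      · by_contra! h
        exact h0 i (Finset.mem_univ i) (bell_of_ge h.le))
    (by
      have h : ContDiff ℝ ((⊤ : ℕ∞) : WithTop ℕ∞) fun t : Rn n => ∏ i, bell (t i) :=
        contDiff_prod fun i _ => contDiff_bell.comp (EuclideanSpace.proj (𝕜 := ℝ) i).contDiff
      exact Complex.ofRealCLM.contDiff.comp h)

theorem bellS_apply (t : Rn n) : bellS n t = ((∏ i, bell (t i) : ℝ) : ℂ) := rfl

theorem intEquivNat_ofNat (j : ℕ) : Equiv.intEquivNat (Int.ofNat j) = 2 * j := by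
  change Equiv.natSumNatEquivNat (Sum.inl j) = _
  rw [Equiv.natSumNatEquivNat_apply, Sum.elim_inl]

theorem intEquivNat_negSucc (j : ℕ) : Equiv.intEquivNat (Int.negSucc j) = 2 * j + 1 := by
  change Equiv.natSumNatEquivNat (Sum.inr j) = _
  rw [Equiv.natSumNatEquivNat_apply, Sum.elim_inr]

theorem abs_le_intEquivNat (j : ℤ) : |(j : ℝ)| ≤ (Equiv.intEquivNat j : ℕ) := by
  rcases j with j | j
  · rw [intEquivNat_ofNat, Int.ofNat_eq_natCast, Int.cast_natCast, Nat.abs_cast]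
    push_cast
    linarith [(Nat.cast_nonneg j : (0 : ℝ) ≤ j)]
  · rw [intEquivNat_negSucc, Int.cast_negSucc, abs_neg, abs_of_nonneg (by positivity)]
    push_cast
    linarith [(Nat.cast_nonneg j : (0 : ℝ) ≤ j)]

theorem intEquivNat_le_two_mul_abs (j : ℤ) : ((Equiv.intEquivNat j : ℕ) : ℝ) ≤ 2 * |(j : ℝ)| := by
  rcases j with j | j
  · rw [intEquivNat_ofNat, Int.ofNat_eq_natCast, Int.cast_natCast, Nat.abs_cast]
    push_cast
    linarith [(Nat.cast_nonneg j : (0 : ℝ) ≤ j)]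
  · rw [intEquivNat_negSucc, Int.cast_negSucc, abs_neg, abs_of_nonneg (by positivity)]
    push_cast
    linarith

/-- The frequencies of the local cosine function with index `m`, one for each choice `ε` of
signs. -/
noncomputable def localCosineFreq (m : Fin n → ℤ) (ε : Fin n → Bool) : Rn n :=
  WithLp.toLp 2 fun i => (if ε i then 1 else -1) * (((Equiv.intEquivNat (m i) : ℕ) + 1 / 2) / 2)

theorem abs_localCosineFreq (m : Fin n → ℤ) (ε : Fin n → Bool) (i : Fin n) :
    |localCosineFreq m ε i| = ((Equiv.intEquivNat (m i) : ℕ) + 1 / 2) / 2 := by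
  rw [localCosineFreq]
  change |(if ε i then (1 : ℝ) else -1) * _| = _
  rw [abs_mul, abs_of_nonneg (a := (_ + _) / 2) (by positivity)]
  split_ifs <;> simp

theorem one_add_norm_localCosineFreq_le (m : Fin n → ℤ) (ε : Fin n → Bool) :
    1 + ‖localCosineFreq m ε‖ ≤ (n + 1) * latticeWeight m := by
  have h1 : ‖localCosineFreq m ε‖ ≤ n * latticeWeight m := by
    refine abs_le_of_sq_le_sq' ?_ (mul_nonneg n.cast_nonneg (latticeWeight_pos m).le) |>.2
    rw [EuclideanSpace.norm_sq_eq]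
    calc ∑ i, ‖localCosineFreq m ε i‖ ^ 2 ≤ ∑ _i : Fin n, latticeWeight m ^ 2 := by
          refine Finset.sum_le_sum fun i _ => ?_
          have h2 := one_add_abs_le_latticeWeight m i
          have h3 := intEquivNat_le_two_mul_abs (m i)
          rw [Real.norm_eq_abs, abs_localCosineFreq]
          gcongr
          linarith
      _ = n * latticeWeight m ^ 2 := by simp
      _ ≤ (n * latticeWeight m) ^ 2 := by
          rw [mul_pow]
          gcongr
          rcases n with _ | n
          · simp
          · push_cast
            nlinarith [(Nat.cast_nonneg n : (0 : ℝ) ≤ n)]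
  linarith [one_le_latticeWeight m]

theorem latticeWeight_le_one_add_norm_localCosineFreq (m : Fin n → ℤ) (ε : Fin n → Bool) :
    latticeWeight m ≤ 2 * (1 + ‖localCosineFreq m ε‖) := by
  have h1 : ‖latticePt m‖ ≤ 2 * ‖localCosineFreq m ε‖ := by
    refine abs_le_of_sq_le_sq' ?_ (by positivity) |>.2
    rw [mul_pow, EuclideanSpace.norm_sq_eq, EuclideanSpace.norm_sq_eq, Finset.mul_sum]
    refine Finset.sum_le_sum fun i _ => ?_
    rw [← mul_pow]
    have h2 := abs_le_intEquivNat (m i)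
    gcongr
    rw [Real.norm_eq_abs, Real.norm_eq_abs, abs_localCosineFreq]
    change |(m i : ℝ)| ≤ _
    linarith
  rw [latticeWeight]
  linarith

/-- The local cosine functions on `ℝⁿ`: tensor products of the local cosine functions on the line,
indexed by `ℤⁿ` through an enumeration of `ℤ`. They are written as sums of modulations of one
function. -/
noncomputable def localCosine (m : Fin n → ℤ) : 𝓢(Rn n, ℂ) :=
  ((√2 / 2 : ℝ) : ℂ) ^ n • ∑ ε : Fin n → Bool, modulateS (localCosineFreq m ε) (bellS n)

theorem localCosine_apply (m : Fin n → ℤ) (t : Rn n) :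
    localCosine m t = ((∏ i, localCosine1 (Equiv.intEquivNat (m i)) (t i) : ℝ) : ℂ) := by
  have h1 : ∀ ε : Fin n → Bool, modulateS (localCosineFreq m ε) (bellS n) t =
      (∏ i, (bell (t i) : ℂ)) * ∏ i, Complex.exp ((if ε i then (1 : ℂ) else -1) *
        ((π * ((Equiv.intEquivNat (m i) : ℕ) + 1 / 2) * t i : ℝ) : ℂ) * Complex.I) := by
    intro ε
    rw [modulateS_apply, bellS_apply, ← Complex.exp_sum, mul_comm]
    push_cast
    congr 2
    rw [PiLp.inner_apply]
    push_cast
    rw [Finset.mul_sum]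
    refine Finset.sum_congr rfl fun i _ => ?_
    simp only [localCosineFreq, RCLike.inner_apply, conj_trivial]
    split_ifs <;> (push_cast; ring)
  have h2 : ∑ ε : Fin n → Bool, ∏ i, Complex.exp ((if ε i then (1 : ℂ) else -1) *
        ((π * ((Equiv.intEquivNat (m i) : ℕ) + 1 / 2) * t i : ℝ) : ℂ) * Complex.I) =
      ∏ i, (2 * cos (π * ((Equiv.intEquivNat (m i) : ℕ) + 1 / 2) * t i) : ℝ) := by
    have h3 := Finset.prod_univ_sum (fun _ : Fin n => (Finset.univ : Finset Bool))
      fun (i : Fin n) (b : Bool) => Complex.exp ((if b then (1 : ℂ) else -1) *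
        ((π * ((Equiv.intEquivNat (m i) : ℕ) + 1 / 2) * t i : ℝ) : ℂ) * Complex.I)
    rw [Fintype.piFinset_univ] at h3
    rw [← h3]
    push_cast
    refine Finset.prod_congr rfl fun i _ => ?_
    rw [Fintype.sum_bool, Complex.two_cos]
    simp
  rw [localCosine, smul_apply, sum_apply]
  simp only [h1]
  rw [← Finset.mul_sum, h2, smul_eq_mul]
  have h4 : ((√2 / 2 : ℝ) : ℂ) ^ n = ∏ _i : Fin n, ((√2 / 2 : ℝ) : ℂ) := by
    rw [Finset.prod_const, Finset.card_univ, Fintype.card_fin]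
  rw [h4]
  push_cast
  rw [← Finset.prod_mul_distrib, ← Finset.prod_mul_distrib]
  refine Finset.prod_congr rfl fun i _ => ?_
  rw [localCosine1]
  push_cast
  ring

theorem schwartzToDist_localCosine_apply (m : Fin n → ℤ) (k : Fin n → ℤ) (ψ : 𝓢(Rn n, ℂ)) :
    schwartzToDist ψ (latticeShift k (localCosine m)) =
      ∫ t : Fin n → ℝ, ψ (WithLp.toLp 2 t) *
        (∏ i, localCosine1 (Equiv.intEquivNat (m i)) (t i - k i) : ℝ) := by
  rw [schwartzToDist_apply, ← (PiLp.volume_preserving_toLp (Fin n)).integral_comp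
    (MeasurableEquiv.toLp 2 (Fin n → ℝ)).measurableEmbedding]
  congr 1
  funext t
  rw [translateS_apply, localCosine_apply, mul_comm]
  rfl

/-- The lattice translates of the local cosine functions are orthonormal. -/
theorem schwartzToDist_latticeShift_localCosine (m l j k : Fin n → ℤ) :
    schwartzToDist (latticeShift j (localCosine m)) (latticeShift k (localCosine l)) =
      if j = k ∧ m = l then 1 else 0 := by
  rw [schwartzToDist_localCosine_apply]
  have h1 : ∀ t : Fin n → ℝ, latticeShift j (localCosine m) (WithLp.toLp 2 t) *
      (∏ i, localCosine1 (Equiv.intEquivNat (l i)) (t i - k i) : ℝ) =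
      ((∏ i, localCosine1 (Equiv.intEquivNat (m i)) (t i - j i) *
        localCosine1 (Equiv.intEquivNat (l i)) (t i - k i) : ℝ) : ℂ) := by
    intro t
    rw [translateS_apply, localCosine_apply, Finset.prod_mul_distrib]
    push_cast
    rfl
  simp only [h1]
  rw [integral_complex_ofReal, integral_fintype_prod_volume_eq_prod (f := fun i (x : ℝ) =>
    localCosine1 (Equiv.intEquivNat (m i)) (x - j i) * localCosine1 (Equiv.intEquivNat (l i)) (x - k i))]
  simp only [integral_localCosine1_sub_mul_sub]
  split_ifs with h
  · obtain ⟨rfl, rfl⟩ := h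
    simp
  · rw [Complex.ofReal_eq_zero, Finset.prod_eq_zero_iff]
    by_contra! h2
    refine h ⟨funext fun i => ?_, funext fun i => ?_⟩
    · have := h2 i (Finset.mem_univ i)
      rw [ne_eq, ite_eq_right_iff, not_forall] at this
      exact this.1.1
    · have := h2 i (Finset.mem_univ i)
      rw [ne_eq, ite_eq_right_iff, not_forall] at this
      exact Equiv.intEquivNat.injective this.1.2

/-- The lattice translates of the local cosine functions are complete. -/
theorem eq_zero_of_schwartzToDist_latticeShift_localCosine {f : 𝓢(Rn n, ℂ)}
    (h : ∀ m k, schwartzToDist f (latticeShift k (localCosine m)) = 0) : f = 0 := by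
  ext t
  refine eq_zero_of_integral_mul_prod_localCosine1_eq_zero (f := fun t => f (WithLp.toLp 2 t))
    (f.continuous.comp (PiLp.continuous_toLp 2 _)) (fun m k => ?_) (WithLp.ofLp t)
  have := h (fun i => Equiv.intEquivNat.symm (m i)) k
  rw [schwartzToDist_localCosine_apply] at this
  simpa only [Equiv.apply_symm_apply] using this

theorem map_sum_schwartzNorm_le {ι : Type*} (N : ℕ) (s : Finset ι) (f : ι → 𝓢(Rn n, ℂ)) :
    schwartzNorm N (∑ i ∈ s, f i) ≤ ∑ i ∈ s, schwartzNorm N (f i) :=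
  Finset.le_sum_of_subadditive (schwartzNorm N) (map_zero _).le (map_add_le_add _) _ _

theorem exists_schwartzNorm_localCosine_le (n N : ℕ) : ∃ (M : ℕ) (C : ℝ), 0 ≤ C ∧
    ∀ m : Fin n → ℤ, schwartzNorm N (localCosine m) ≤ C * latticeWeight m ^ M := by
  obtain ⟨M, C, hC, h⟩ := exists_schwartzNorm_modulateS_le n N
  refine ⟨M, ‖((√2 / 2 : ℝ) : ℂ) ^ n‖ * ∑ _ε : Fin n → Bool, C * (n + 1) ^ M * schwartzNorm M (bellS n),
    ?_, fun m => ?_⟩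
  · have := schwartzNorm_nonneg M (bellS n)
    positivity
  rw [localCosine, map_smul_eq_mul, mul_assoc, Finset.sum_mul]
  gcongr
  refine (map_sum_schwartzNorm_le N _ _).trans (Finset.sum_le_sum fun ε _ => ?_)
  refine (h _ _).trans ?_
  have h1 := one_add_norm_localCosineFreq_le m ε
  calc C * (1 + ‖localCosineFreq m ε‖) ^ M * schwartzNorm M (bellS n)
      ≤ C * ((n + 1) * latticeWeight m) ^ M * schwartzNorm M (bellS n) := by
        have := schwartzNorm_nonneg M (bellS n)
        gcongr
    _ = _ := by rw [mul_pow]; ring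

theorem exists_schwartzNorm_convS_localCosine_le (n K N : ℕ) : ∃ (M : ℕ) (C : ℝ), 0 ≤ C ∧
    ∀ (m : Fin n → ℤ) (g : 𝓢(Rn n, ℂ)),
      latticeWeight m ^ K * schwartzNorm N (convS (localCosine m) g) ≤ C * schwartzNorm M g := by
  obtain ⟨M, C, hC, h⟩ := exists_schwartzNorm_convS_modulateS_le n K N
  refine ⟨M, ‖((√2 / 2 : ℝ) : ℂ) ^ n‖ * ∑ _ε : Fin n → Bool, 2 ^ K * (C * schwartzNorm M (bellS n)),
    ?_, fun m g => ?_⟩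
  · have := schwartzNorm_nonneg M (bellS n)
    positivity
  have h1 : convS (localCosine m) g = ((√2 / 2 : ℝ) : ℂ) ^ n •
      ∑ ε : Fin n → Bool, convS (modulateS (localCosineFreq m ε) (bellS n)) g := by
    rw [convS_comm, localCosine, map_smul, map_sum]
    simp only [convS_comm g]
  rw [h1, map_smul_eq_mul, mul_left_comm, mul_assoc, Finset.sum_mul]
  gcongr
  refine (mul_le_mul_of_nonneg_left (map_sum_schwartzNorm_le N _ _)
    (pow_nonneg (latticeWeight_pos m).le K)).trans ?_
  rw [Finset.mul_sum]
  refine Finset.sum_le_sum fun ε _ => ?_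
  have h2 := latticeWeight_le_one_add_norm_localCosineFreq m ε
  have h3 := latticeWeight_pos m
  calc latticeWeight m ^ K * schwartzNorm N (convS (modulateS (localCosineFreq m ε) (bellS n)) g)
      ≤ (2 * (1 + ‖localCosineFreq m ε‖)) ^ K *
          schwartzNorm N (convS (modulateS (localCosineFreq m ε) (bellS n)) g) := by
        have := schwartzNorm_nonneg N (convS (modulateS (localCosineFreq m ε) (bellS n)) g)
        gcongr
    _ = 2 ^ K * ((1 + ‖localCosineFreq m ε‖) ^ K *
          schwartzNorm N (convS (modulateS (localCosineFreq m ε) (bellS n)) g)) := by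
        rw [mul_pow, mul_assoc]
    _ ≤ 2 ^ K * (C * schwartzNorm M (bellS n) * schwartzNorm M g) := by
        gcongr _ * ?_
        exact h _ _ _
    _ = _ := by ring

theorem exists_schwartzNorm_convS_reflectS_localCosine_le (n K N : ℕ) : ∃ (M : ℕ) (C : ℝ), 0 ≤ C ∧
    ∀ (m : Fin n → ℤ) (g : 𝓢(Rn n, ℂ)),
      latticeWeight m ^ K * schwartzNorm N (convS (reflectS (localCosine m)) g) ≤
        C * schwartzNorm M g := by
  obtain ⟨N₁, C₁, hC₁, h₁⟩ := exists_schwartzNorm_map_le (reflectS (n := n)) N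
  obtain ⟨M, C, hC, h⟩ := exists_schwartzNorm_convS_localCosine_le n K N₁
  obtain ⟨M₁, C₂, hC₂, h₂⟩ := exists_schwartzNorm_map_le (reflectS (n := n)) M
  refine ⟨M₁, C₁ * (C * C₂), by positivity, fun m g => ?_⟩
  have h3 : convS (reflectS (localCosine m)) g = reflectS (convS (localCosine m) (reflectS g)) := by
    rw [reflectS_convS, reflectS_reflectS]
  have h4 := latticeWeight_pos m
  rw [h3]
  calc latticeWeight m ^ K * schwartzNorm N (reflectS (convS (localCosine m) (reflectS g)))
      ≤ latticeWeight m ^ K * (C₁ * schwartzNorm N₁ (convS (localCosine m) (reflectS g))) := by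
        gcongr _ * ?_
        exact h₁ _
    _ = C₁ * (latticeWeight m ^ K * schwartzNorm N₁ (convS (localCosine m) (reflectS g))) := by ring
    _ ≤ C₁ * (C * (C₂ * schwartzNorm M₁ g)) := by
        gcongr _ * ?_
        refine (h _ _).trans ?_
        gcongr _ * ?_
        exact h₂ _
    _ = _ := by ring

end LocalCosineSchwartz

/-! ### Expansions with respect to the local cosine basis -/

section Expansion

variable {n : ℕ}

theorem dist_map_smul (f : 𝓢'(Rn n, ℂ)) (z : ℂ) (ρ : 𝓢(Rn n, ℂ)) : f (z • ρ) = z * f ρ :=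
  map_smul f z ρ

/-- Every Schwartz function is the sum of its local cosine expansion
`ρ = ∑ₘ ∑ₖ ⟨ρ, T_k w_m⟩ T_k w_m`, with convergence in the Schwartz space. -/
theorem hasSum_localCosine_expansion (ρ : 𝓢(Rn n, ℂ)) :
    HasSum (fun m : Fin n → ℤ =>
      latticeConv (localCosine m) (convS (reflectS (localCosine m)) ρ)) ρ := by
  have hs : Summable fun m : Fin n → ℤ =>
      latticeConv (localCosine m) (convS (reflectS (localCosine m)) ρ) := by
    refine summable_of_summable_schwartzNorm fun N => ?_
    obtain ⟨M, C, hC, h⟩ := exists_schwartzNorm_latticeConv_le n N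
    obtain ⟨L, D, hD, hw⟩ := exists_schwartzNorm_localCosine_le n M
    obtain ⟨M', C', hC', hconv⟩ := exists_schwartzNorm_convS_reflectS_localCosine_le n (2 * n + L) M
    refine (summable_of_latticeWeight_pow_mul_le (C := C * D * (C' * schwartzNorm M' ρ))
      (fun _ => schwartzNorm_nonneg _ _) fun m => ?_).1
    have h0 := latticeWeight_pos m
    have h1 := schwartzNorm_nonneg M (convS (reflectS (localCosine m)) ρ)
    calc _ ≤ latticeWeight m ^ (2 * n) * (C * (D * latticeWeight m ^ L) *
          schwartzNorm M (convS (reflectS (localCosine m)) ρ)) := by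
          gcongr _ * ?_
          refine (h _ _).trans ?_
          gcongr
          exact hw m
      _ = C * D * (latticeWeight m ^ (2 * n + L) *
          schwartzNorm M (convS (reflectS (localCosine m)) ρ)) := by rw [pow_add]; ring
      _ ≤ _ := by gcongr _ * ?_; exact hconv m ρ
  convert hs.hasSum using 1
  set σ := ∑' m : Fin n → ℤ, latticeConv (localCosine m) (convS (reflectS (localCosine m)) ρ) with hσ
  rw [← sub_eq_zero]
  refine eq_zero_of_schwartzToDist_latticeShift_localCosine fun j l => ?_
  rw [schwartzToDist_comm, map_sub, sub_eq_zero]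
  -- both sides have the same coefficients, by orthonormality
  refine HasSum.unique (f := fun m => if m = j then schwartzToDist (latticeShift l (localCosine j)) ρ
    else 0) (hasSum_ite_eq j _) ?_
  refine hasSum_of_eq (fun m => ?_) (hs.hasSum.mapL
    (schwartzToDist (latticeShift l (localCosine j)) : 𝓢(Rn n, ℂ) →L[ℂ] ℂ))
  refine HasSum.unique (f := fun k => if k = l then (if m = j then
    schwartzToDist (latticeShift l (localCosine j)) ρ else 0) else 0) (hasSum_ite_eq l _) ?_
  refine hasSum_of_eq (fun k => ?_) ((hasSum_latticeConv _ _).mapL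
    (schwartzToDist (latticeShift l (localCosine j)) : 𝓢(Rn n, ℂ) →L[ℂ] ℂ))
  change _ = schwartzToDist _ (_ • _)
  rw [dist_map_smul, schwartzToDist_latticeShift_localCosine, convS_reflectS_apply]
  by_cases h1 : k = l
  · subst h1
    by_cases h2 : m = j
    · subst h2
      simp
    · simp [h2, Ne.symm h2]
  · simp [h1, Ne.symm h1]

/-- A tempered distribution is determined by its local cosine coefficients. -/
theorem dist_ext_localCosine {f g : 𝓢'(Rn n, ℂ)}
    (h : ∀ m k, f (latticeShift k (localCosine m)) = g (latticeShift k (localCosine m))) : f = g := by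
  ext ρ
  refine ((hasSum_localCosine_expansion ρ).mapL (f : 𝓢(Rn n, ℂ) →L[ℂ] ℂ)).unique
    (hasSum_of_eq (fun m => ?_) ((hasSum_localCosine_expansion ρ).mapL (g : 𝓢(Rn n, ℂ) →L[ℂ] ℂ)))
  refine ((hasSum_latticeConv _ _).mapL (f : 𝓢(Rn n, ℂ) →L[ℂ] ℂ)).unique
    (hasSum_of_eq (fun k => ?_) ((hasSum_latticeConv _ _).mapL (g : 𝓢(Rn n, ℂ) →L[ℂ] ℂ)))
  change f (_ • _) = g (_ • _)
  rw [dist_map_smul, dist_map_smul, h]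

end Expansion

namespace DistInclusion

variable {n : ℕ} {E : Type*} [NormedAddCommGroup E] [NormedSpace ℂ E]
  {ι : DistInclusion n E} {χ η : 𝓢(Rn n, ℂ)}

/-- The family `S` consists of the synthesis operators `c ↦ ∑ₖ cₖ T_k φ` from `E_d` to `E`. -/
structure IsSynthesis (ι : DistInclusion n E) (χ : 𝓢(Rn n, ℂ))
    (S : 𝓢(Rn n, ℂ) → ι.DiscreteSpace χ →L[ℂ] E) : Prop where
  hasSum : ∀ φ c, HasSum (fun k => c.1 k • schwartzToDist (latticeShift k φ)) (ι.toDist (S φ c))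
  bound : ∃ M C, 0 ≤ C ∧ ∀ φ c, ‖S φ c‖ ≤ C * schwartzNorm M φ * ‖c‖

/-- The family `A` consists of the analysis operators `x ↦ (⟨x, T_k θ⟩)ₖ` from `E` to `E_d`. -/
structure IsAnalysis (ι : DistInclusion n E) (χ : 𝓢(Rn n, ℂ))
    (A : 𝓢(Rn n, ℂ) → E →L[ℂ] ι.DiscreteSpace χ) : Prop where
  coeff : ∀ θ x k, (A θ x).1 k = ι.toDist x (latticeShift k θ)
  bound : ∃ M C, 0 ≤ C ∧ ∀ θ x, ‖A θ x‖ ≤ C * schwartzNorm M θ * ‖x‖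

theorem exists_isSynthesis [CompleteSpace E] (hι : IsConvModBounded ι)
    (hχ : ∃ η : 𝓢(Rn n, ℂ), ∀ k l : Fin n → ℤ,
      schwartzToDist (latticeShift k χ) (latticeShift l η) = if k = l then 1 else 0) :
    ∃ S, IsSynthesis ι χ S := by
  obtain ⟨M, C, hC, h⟩ := exists_synthesis hι hχ
  choose S hS hSn using h
  let T : 𝓢(Rn n, ℂ) → ι.DiscreteSpace χ →ₗ[ℂ] E := fun φ =>
    { toFun := S φ
      map_add' := fun a b => ι.injective (by
        rw [map_add]
        refine (hS φ (a + b)).unique (hasSum_of_eq (fun k => ?_) ((hS φ a).add (hS φ b)))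
        exact add_smul (a.1 k) (b.1 k) (schwartzToDist (latticeShift k φ)))
      map_smul' := fun z a => ι.injective (by
        rw [map_smul]
        refine (hS φ (z • a)).unique (hasSum_of_eq (fun k => ?_) ((hS φ a).const_smul z))
        exact mul_smul z (a.1 k) (schwartzToDist (latticeShift k φ))) }
  exact ⟨fun φ => (T φ).mkContinuous (C * schwartzNorm M φ) (hSn φ), hS, M, C, hC, hSn⟩

theorem exists_isAnalysis [CompleteSpace E] (hι : IsConvModBounded ι) (χ : 𝓢(Rn n, ℂ)) :
    ∃ A, IsAnalysis ι χ A := by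
  obtain ⟨M, C, hC, h⟩ := exists_analysis hι χ
  choose A hA hAn using h
  let T : 𝓢(Rn n, ℂ) → E →ₗ[ℂ] ι.DiscreteSpace χ := fun θ =>
    { toFun := A θ
      map_add' := fun a b => Subtype.ext (funext fun k => by
        change (A θ (a + b)).1 k = (A θ a).1 k + (A θ b).1 k
        rw [hA, hA, hA, map_add]
        rfl)
      map_smul' := fun z a => Subtype.ext (funext fun k => by
        change (A θ (z • a)).1 k = z * (A θ a).1 k
        rw [hA, hA, map_smul]
        rfl) }
  exact ⟨fun θ => (T θ).mkContinuous (C * schwartzNorm M θ) (hAn θ), hA, M, C, hC, hAn⟩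

variable {S : 𝓢(Rn n, ℂ) → ι.DiscreteSpace χ →L[ℂ] E}

/-- The local cosine coefficients of `∑ₘ S_{w_m} a_m`. -/
theorem IsSynthesis.coeff_eq (hS : IsSynthesis ι χ S) {a : (Fin n → ℤ) → ι.DiscreteSpace χ}
    {f : 𝓢'(Rn n, ℂ)} (hf : HasSum (fun j => ι.toDist (S (localCosine j) (a j))) f) (m k : Fin n → ℤ) :
    f (latticeShift k (localCosine m)) = (a m).1 k := by
  refine (hasSum_dist_iff.1 hf (latticeShift k (localCosine m))).unique ?_
  refine hasSum_of_eq (g := fun j => if j = m then (a m).1 k else 0) (fun j => ?_) (hasSum_ite_eq m _)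
  refine (hasSum_dist_iff.1 (hS.hasSum (localCosine j) (a j)) _).unique ?_
  refine hasSum_of_eq (g := fun l => if l = k then (if j = m then (a m).1 k else 0) else 0)
    (fun l => ?_) (hasSum_ite_eq k _)
  change (a j).1 l * schwartzToDist _ _ = _
  rw [schwartzToDist_latticeShift_localCosine]
  by_cases h1 : l = k
  · subst h1
    by_cases h2 : j = m
    · subst h2
      simp
    · simp [h2]
  · simp [h1]

/-- The value of `S_φ c` at a test function, expressed through `S_χ c`. -/
theorem IsSynthesis.toDist_apply (hS : IsSynthesis ι χ S) (hη : ∀ k l : Fin n → ℤ,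
      schwartzToDist (latticeShift k χ) (latticeShift l η) = if k = l then 1 else 0)
    (φ ρ : 𝓢(Rn n, ℂ)) (c : ι.DiscreteSpace χ) :
    ι.toDist (S φ c) ρ = ι.toDist (ι.discreteSynthesis χ c) (latticeConv η (convS (reflectS φ) ρ)) :=
  (hasSum_dist_iff.1 (hS.hasSum φ c) ρ).unique
    (hasSum_coeff_mul_schwartzToDist hη c φ ρ)

end DistInclusion

/-! ### Partial derivatives -/

section PartialDerivatives

variable {n : ℕ}

/-- The partial derivative `∂ᵢ` on Schwartz functions. -/
noncomputable def partialS (i : Fin n) : 𝓢(Rn n, ℂ) →L[ℂ] 𝓢(Rn n, ℂ) :=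
  LineDeriv.lineDerivOpCLM ℂ 𝓢(Rn n, ℂ) (EuclideanSpace.single i (1 : ℝ))

/-- The partial derivative `∂ᵢ` on tempered distributions. -/
noncomputable def partialD (i : Fin n) : 𝓢'(Rn n, ℂ) →L[ℂ] 𝓢'(Rn n, ℂ) :=
  LineDeriv.lineDerivOpCLM ℂ 𝓢'(Rn n, ℂ) (EuclideanSpace.single i (1 : ℝ))

theorem partialS_apply (i : Fin n) (φ : 𝓢(Rn n, ℂ)) (x : Rn n) :
    partialS i φ x = fderiv ℝ φ x (EuclideanSpace.single i 1) := rfl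

theorem partialD_apply (i : Fin n) (f : 𝓢'(Rn n, ℂ)) (ρ : 𝓢(Rn n, ℂ)) :
    partialD i f ρ = -f (partialS i ρ) :=
  map_neg f (partialS i ρ)

theorem partialD_schwartzToDist (i : Fin n) (φ : 𝓢(Rn n, ℂ)) :
    partialD i (schwartzToDist φ) = schwartzToDist (partialS i φ) :=
  TemperedDistribution.lineDerivOp_toTemperedDistributionCLM_eq φ _

theorem partialS_translateS (i : Fin n) (x : Rn n) (φ : 𝓢(Rn n, ℂ)) :
    partialS i (translateS x φ) = translateS x (partialS i φ) := by
  ext t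
  rw [partialS_apply, translateS_apply, partialS_apply]
  have : (translateS x φ : Rn n → ℂ) = fun t => φ (t - x) := rfl
  rw [this, fderiv_comp_sub]

theorem partialS_comm (i j : Fin n) (φ : 𝓢(Rn n, ℂ)) :
    partialS i (partialS j φ) = partialS j (partialS i φ) := by
  ext t
  have h : ∀ i j : Fin n, partialS i (partialS j φ) t =
      fderiv ℝ (fderiv ℝ φ) t (EuclideanSpace.single i 1) (EuclideanSpace.single j 1) := by
    intro i j
    have h1 : (partialS j φ : Rn n → ℂ) = fun t => fderiv ℝ φ t (EuclideanSpace.single j 1) := rfl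
    have h2 : DifferentiableAt ℝ (fderiv ℝ φ) t :=
      ((φ.smooth 2).fderiv_right (m := 1) (by norm_num)).differentiable (by norm_num) t
    rw [partialS_apply, h1, fderiv_clm_apply h2 (differentiableAt_const _)]
    simp
  rw [h, h]
  exact ((φ.smooth 2).contDiffAt.isSymmSndFDerivAt (by simp)).eq _ _

theorem partialD_comm (i j : Fin n) : Commute (partialD i) (partialD j) := by
  ext f ρ
  change partialD i (partialD j f) ρ = partialD j (partialD i f) ρ
  simp only [partialD_apply, partialS_comm i j]

theorem partialS_modulateS (i : Fin n) (ξ : Rn n) (φ : 𝓢(Rn n, ℂ)) :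
    partialS i (modulateS ξ φ) =
      (2 * Real.pi * Complex.I * (ξ i : ℂ)) • modulateS ξ φ + modulateS ξ (partialS i φ) := by
  ext t
  have h1 : (modulateS ξ φ : Rn n → ℂ) = fun t => character ξ t * φ t := by
    funext t
    rw [modulateS_apply]
    rfl
  have h2 : HasFDerivAt (fun t : Rn n => 2 * Real.pi * Complex.I * ((inner ℝ ξ t : ℝ) : ℂ))
      ((2 * Real.pi * Complex.I) • (Complex.ofRealCLM.comp (innerSL ℝ ξ))) t :=
    ((Complex.ofRealCLM.comp (innerSL ℝ ξ)).hasFDerivAt (x := t)).const_mul (2 * Real.pi * Complex.I)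
  have h3 := (h2.cexp).mul φ.differentiableAt.hasFDerivAt
  rw [partialS_apply, h1]
  change fderiv ℝ ((fun t => Complex.exp _) * (φ : Rn n → ℂ)) t _ =
    (2 * Real.pi * Complex.I * (ξ i : ℂ)) * modulateS ξ φ t + modulateS ξ (partialS i φ) t
  rw [h3.fderiv, modulateS_apply, modulateS_apply, partialS_apply]
  simp [EuclideanSpace.inner_single_right]
  ring

/-- The iterated partial derivative `∂^α` on Schwartz functions. -/
noncomputable def derivS (α : Fin n → ℕ) : 𝓢(Rn n, ℂ) →L[ℂ] 𝓢(Rn n, ℂ) :=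
  ((List.finRange n).map fun i => partialS i ^ α i).prod

theorem derivD_eq (α : Fin n → ℕ) :
    derivD α = ((List.finRange n).map fun i => partialD i ^ α i).prod := rfl

theorem partialD_pow_schwartzToDist (i : Fin n) (k : ℕ) (φ : 𝓢(Rn n, ℂ)) :
    (partialD i ^ k) (schwartzToDist φ) = schwartzToDist ((partialS i ^ k) φ) := by
  induction k generalizing φ with
  | zero => rfl
  | succ k ih =>
    rw [pow_succ, pow_succ]
    change (partialD i ^ k) (partialD i _) = schwartzToDist ((partialS i ^ k) (partialS i φ))
    rw [partialD_schwartzToDist, ih]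

theorem derivD_schwartzToDist (α : Fin n → ℕ) (φ : 𝓢(Rn n, ℂ)) :
    derivD α (schwartzToDist φ) = schwartzToDist (derivS α φ) := by
  rw [derivD_eq, derivS]
  induction List.finRange n with
  | nil => rfl
  | cons i l ih =>
    rw [List.map_cons, List.map_cons, List.prod_cons, List.prod_cons]
    change (partialD i ^ α i) (_ : 𝓢'(Rn n, ℂ)) = schwartzToDist ((partialS i ^ α i) _)
    exact (congrArg (partialD i ^ α i) ih).trans (partialD_pow_schwartzToDist _ _ _)

theorem derivS_translateS (α : Fin n → ℕ) (x : Rn n) (φ : 𝓢(Rn n, ℂ)) :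
    derivS α (translateS x φ) = translateS x (derivS α φ) := by
  have h : Commute (derivS α) (translateS x) := by
    refine Commute.list_prod_left _ _ fun A hA => ?_
    obtain ⟨i, -, rfl⟩ := List.mem_map.1 hA
    refine Commute.pow_left ?_ _
    ext φ : 1
    exact partialS_translateS i x φ
  exact DFunLike.congr_fun h.eq φ

theorem List.prod_map_pow_mul_eq {M ι : Type*} [Monoid M] [DecidableEq ι] (d : ι → M)
    (hd : ∀ i j, Commute (d i) (d j)) (α : ι → ℕ) (j : ι) {l : List ι} (hl : l.Nodup) (hj : j ∈ l) :
    (l.map fun i => d i ^ α i).prod * d j =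
      (l.map fun i => d i ^ (α + (Pi.single j 1 : ι → ℕ)) i).prod := by
  induction l with
  | nil => simp at hj
  | cons i l ih =>
    rw [List.nodup_cons] at hl
    rw [List.map_cons, List.map_cons, List.prod_cons, List.prod_cons]
    by_cases h : j = i
    · subst h
      have h1 : (l.map fun i => d i ^ (α + (Pi.single j 1 : ι → ℕ)) i) = l.map fun i => d i ^ α i := by
        refine List.map_congr_left fun i hi => ?_
        have : i ≠ j := fun h => hl.1 (h ▸ hi)
        simp [this]
      have h2 : Commute (l.map fun i => d i ^ α i).prod (d j) := by
        refine Commute.list_prod_left _ _ fun A hA => ?_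
        obtain ⟨i, -, rfl⟩ := List.mem_map.1 hA
        exact (hd i j).pow_left _
      rw [h1, mul_assoc, h2.eq, ← mul_assoc, ← pow_succ]
      simp
    · rw [mul_assoc, ih hl.2 ((List.mem_cons.1 hj).resolve_left h)]
      simp [Ne.symm h]

theorem derivD_partialD (α : Fin n → ℕ) (j : Fin n) (f : 𝓢'(Rn n, ℂ)) :
    derivD α (partialD j f) = derivD (α + Pi.single j 1) f :=
  DFunLike.congr_fun (List.prod_map_pow_mul_eq partialD partialD_comm α j (List.nodup_finRange n)
    (List.mem_finRange j)) f

theorem derivD_zero (f : 𝓢'(Rn n, ℂ)) : derivD 0 f = f := by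
  have : derivD (0 : Fin n → ℕ) = 1 := by
    rw [derivD_eq]
    exact List.prod_eq_one fun A hA => by
      obtain ⟨i, -, rfl⟩ := List.mem_map.1 hA
      rw [Pi.zero_apply, pow_zero]
  rw [this]
  rfl

theorem derivS_zero (φ : 𝓢(Rn n, ℂ)) : derivS 0 φ = φ := by
  have : derivS (0 : Fin n → ℕ) = 1 := List.prod_eq_one fun A hA => by
    obtain ⟨i, -, rfl⟩ := List.mem_map.1 hA
    rw [Pi.zero_apply, pow_zero]
  rw [this]
  rfl

end PartialDerivatives

/-! ### The test function space as a space of sequences -/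

namespace DistInclusion

variable {n : ℕ} {E : Type*} [NormedAddCommGroup E] [NormedSpace ℂ E]
  {ι : DistInclusion n E} {χ : 𝓢(Rn n, ℂ)}

theorem toDist_testDeriv (α : Fin n → ℕ) (f : ι.TestSpace) :
    ι.toDist (ι.testDeriv α f) = derivD α f.1 :=
  ι.toDist_toE _

/-- `f ↦ f^{(α)}` as a linear map from `D_E` to `E`. -/
noncomputable def testDerivLinear (ι : DistInclusion n E) (α : Fin n → ℕ) : ι.TestSpace →ₗ[ℂ] E where
  toFun := ι.testDeriv α
  map_add' f g := ι.injective (by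
    simp only [map_add, toDist_testDeriv]
    exact map_add (derivD α) f.1 g.1)
  map_smul' z f := ι.injective (by
    simp only [map_smul, toDist_testDeriv, RingHom.id_apply]
    exact map_smul (derivD α) z f.1)

theorem continuous_testDeriv (α : Fin n → ℕ) : Continuous (ι.testDeriv α) :=
  continuous_iInf_dom (i := α) continuous_induced_dom

instance (ι : DistInclusion n E) : IsTopologicalAddGroup ι.TestSpace :=
  topologicalAddGroup_iInf fun α => topologicalAddGroup_induced (ι.testDerivLinear α)

/-- The partial derivative `∂ⱼ` on `D_E`. -/
noncomputable def testPartial (ι : DistInclusion n E) (j : Fin n) (f : ι.TestSpace) : ι.TestSpace :=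
  ⟨partialD j f.1, (Submodule.mem_iInf _).2 fun α =>
    ⟨ι.testDeriv (α + Pi.single j 1) f, by
      refine (toDist_testDeriv _ f).trans ?_
      exact (derivD_partialD α j f.1).symm⟩⟩

theorem testDeriv_testPartial (α : Fin n → ℕ) (j : Fin n) (f : ι.TestSpace) :
    ι.testDeriv α (ι.testPartial j f) = ι.testDeriv (α + Pi.single j 1) f :=
  ι.injective (by
    rw [toDist_testDeriv, toDist_testDeriv]
    exact derivD_partialD α j f.1)

theorem continuous_testPartial (j : Fin n) : Continuous (ι.testPartial j) := by
  refine continuous_iInf_rng.2 fun α => continuous_induced_rng.2 ?_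
  have : ι.testDeriv α ∘ ι.testPartial j = ι.testDeriv (α + Pi.single j 1) :=
    funext fun f => testDeriv_testPartial α j f
  rw [this]
  exact continuous_testDeriv _

theorem testPartial_zero (j : Fin n) : ι.testPartial j 0 = 0 :=
  Subtype.ext (map_zero (partialD j))

theorem toDist_testDeriv_zero (f : ι.TestSpace) : ι.toDist (ι.testDeriv 0 f) = f.1 := by
  rw [toDist_testDeriv, derivD_zero]

theorem _root_.norm_le_sum_abs (x : Rn n) : ‖x‖ ≤ ∑ j, |x j| := by
  calc ‖x‖ = ‖∑ j, x j • EuclideanSpace.single j (1 : ℝ)‖ := by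
        congr 1
        have := (EuclideanSpace.basisFun (Fin n) ℝ).sum_repr x
        simpa using this.symm
    _ ≤ ∑ j, ‖x j • EuclideanSpace.single j (1 : ℝ)‖ := norm_sum_le _ _
    _ = _ := by simp [norm_smul]

section Analysis

variable {A : 𝓢(Rn n, ℂ) → E →L[ℂ] ι.DiscreteSpace χ}

theorem IsAnalysis.map_add (hA : IsAnalysis ι χ A) (θ φ : 𝓢(Rn n, ℂ)) (x : E) :
    A (θ + φ) x = A θ x + A φ x := Subtype.ext (funext fun k => by
  change (A (θ + φ) x).1 k = (A θ x).1 k + (A φ x).1 k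
  rw [hA.coeff, hA.coeff, hA.coeff, latticeShift, _root_.map_add]
  exact _root_.map_add (ι.toDist x) _ _)

theorem IsAnalysis.map_smul (hA : IsAnalysis ι χ A) (z : ℂ) (θ : 𝓢(Rn n, ℂ)) (x : E) :
    A (z • θ) x = z • A θ x := Subtype.ext (funext fun k => by
  change (A (z • θ) x).1 k = z * (A θ x).1 k
  rw [hA.coeff, hA.coeff, latticeShift, _root_.map_smul, dist_map_smul])

/-- The analysis operators as linear functions of the window. -/
noncomputable def IsAnalysis.linear (hA : IsAnalysis ι χ A) (x : E) :
    𝓢(Rn n, ℂ) →ₗ[ℂ] ι.DiscreteSpace χ where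
  toFun θ := A θ x
  map_add' θ φ := hA.map_add θ φ x
  map_smul' z θ := hA.map_smul z θ x

/-- Integration by parts. -/
theorem IsAnalysis.partialS_eq (hA : IsAnalysis ι χ A) (j : Fin n) (θ : 𝓢(Rn n, ℂ)) (f : ι.TestSpace) :
    A (partialS j θ) (ι.testDeriv 0 f) = -A θ (ι.testDeriv 0 (ι.testPartial j f)) :=
  Subtype.ext (funext fun k => by
    change (A (partialS j θ) (ι.testDeriv 0 f)).1 k = -(A θ (ι.testDeriv 0 (ι.testPartial j f))).1 k
    rw [hA.coeff, hA.coeff, toDist_testDeriv_zero, toDist_testDeriv_zero, latticeShift,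
      ← partialS_translateS]
    change _ = -(partialD j f.1 _)
    rw [partialD_apply, neg_neg])

/-- For a test function, the analysis coefficients decay rapidly in the frequency of the window. -/
theorem IsAnalysis.exists_modulateS_le (hA : IsAnalysis ι χ A) : ∃ L : ℕ, ∀ N : ℕ,
    ∃ (M : ℕ) (p : ι.TestSpace → ℝ), Continuous p ∧ p 0 = 0 ∧ (∀ f, 0 ≤ p f) ∧ ∀ ξ ψ f,
      (1 + ‖ξ‖) ^ N * ‖A (modulateS ξ ψ) (ι.testDeriv 0 f)‖ ≤
        schwartzNorm M ψ * (1 + ‖ξ‖) ^ L * p f := by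
  obtain ⟨M₀, C, hC, hAn⟩ := hA.bound
  obtain ⟨L, D, hD, hmod⟩ := exists_schwartzNorm_modulateS_le n M₀
  refine ⟨L, fun N => ?_⟩
  induction N with
  | zero =>
    refine ⟨L, fun f => C * D * ‖ι.testDeriv 0 f‖, continuous_const.mul (continuous_testDeriv 0).norm,
      ?_, fun f => by positivity, fun ξ ψ f => ?_⟩
    · change C * D * ‖ι.testDerivLinear 0 0‖ = 0
      rw [_root_.map_zero, norm_zero, mul_zero]
    · rw [pow_zero, one_mul]
      calc _ ≤ C * schwartzNorm M₀ (modulateS ξ ψ) * ‖ι.testDeriv 0 f‖ := hAn _ _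
        _ ≤ C * (D * (1 + ‖ξ‖) ^ L * schwartzNorm L ψ) * ‖ι.testDeriv 0 f‖ := by
            gcongr
            exact hmod ξ ψ
        _ = _ := by ring
  | succ N ih =>
    obtain ⟨M, p, hp, hp0, hpn, h⟩ := ih
    choose M₁ D₁ hD₁ hpart using fun j : Fin n => exists_schwartzNorm_map_le (partialS j) M
    set M' := M + ∑ j, M₁ j with hM'
    have hM₁ : ∀ j, M₁ j ≤ M' := fun j =>
      (Finset.single_le_sum (fun i _ => Nat.zero_le (M₁ i)) (Finset.mem_univ j)).trans (Nat.le_add_left _ _)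
    refine ⟨M', fun f => p f + ∑ j, (p (ι.testPartial j f) + D₁ j * p f), ?_, ?_, ?_, ?_⟩
    · exact hp.add (continuous_finsetSum _ fun j _ =>
        (hp.comp (continuous_testPartial j)).add (continuous_const.mul hp))
    · simp [testPartial_zero, hp0]
    · intro f
      exact add_nonneg (hpn f) (Finset.sum_nonneg fun j _ =>
        add_nonneg (hpn _) (mul_nonneg (hD₁ j) (hpn f)))
    intro ξ ψ f
    set a := ‖A (modulateS ξ ψ) (ι.testDeriv 0 f)‖ with ha
    set B := schwartzNorm M' ψ * (1 + ‖ξ‖) ^ L with hB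
    have hψ := schwartzNorm_nonneg M' ψ
    have hB0 : 0 ≤ B := by positivity
    have h0 : ∀ f, (1 + ‖ξ‖) ^ N * ‖A (modulateS ξ ψ) (ι.testDeriv 0 f)‖ ≤ B * p f := by
      intro f
      refine (h ξ ψ f).trans ?_
      rw [hB]
      have := hpn f
      gcongr
      exact schwartzNorm_mono (Nat.le_add_right _ _) ψ
    have hj : ∀ j, (1 + ‖ξ‖) ^ N * (|ξ j| * a) ≤ B * (p (ι.testPartial j f) + D₁ j * p f) := by
      intro j
      have h1 : (2 * Real.pi * Complex.I * (ξ j : ℂ)) • A (modulateS ξ ψ) (ι.testDeriv 0 f) =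
          -A (modulateS ξ ψ) (ι.testDeriv 0 (ι.testPartial j f)) -
            A (modulateS ξ (partialS j ψ)) (ι.testDeriv 0 f) := by
        rw [← hA.partialS_eq, partialS_modulateS, hA.map_add, hA.map_smul, add_sub_cancel_right]
      have h2 : |ξ j| * a ≤ ‖A (modulateS ξ ψ) (ι.testDeriv 0 (ι.testPartial j f))‖ +
          ‖A (modulateS ξ (partialS j ψ)) (ι.testDeriv 0 f)‖ := by
        calc |ξ j| * a ≤ ‖(2 * Real.pi * Complex.I * (ξ j : ℂ))‖ * a := by
              gcongr
              rw [norm_mul, norm_mul, norm_mul, Complex.norm_I, Complex.norm_real, Complex.norm_real,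
                Complex.norm_ofNat, mul_one, Real.norm_eq_abs, Real.norm_eq_abs, abs_of_pos Real.pi_pos]
              nlinarith [Real.pi_gt_three, abs_nonneg (ξ j)]
          _ = _ := (norm_smul _ _).symm
          _ ≤ _ := by
              rw [h1]
              refine (norm_sub_le _ _).trans ?_
              rw [norm_neg]
      calc (1 + ‖ξ‖) ^ N * (|ξ j| * a)
          ≤ (1 + ‖ξ‖) ^ N * ‖A (modulateS ξ ψ) (ι.testDeriv 0 (ι.testPartial j f))‖ +
            (1 + ‖ξ‖) ^ N * ‖A (modulateS ξ (partialS j ψ)) (ι.testDeriv 0 f)‖ := by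
            rw [← mul_add]
            gcongr
        _ ≤ B * p (ι.testPartial j f) + schwartzNorm M (partialS j ψ) * (1 + ‖ξ‖) ^ L * p f :=
            add_le_add (h0 _) (h ξ _ f)
        _ ≤ B * p (ι.testPartial j f) + (D₁ j * schwartzNorm M' ψ) * (1 + ‖ξ‖) ^ L * p f := by
            have := hpn f
            gcongr
            refine (hpart j ψ).trans ?_
            have := hD₁ j
            gcongr _ * ?_
            exact schwartzNorm_mono (hM₁ j) ψ
        _ = _ := by rw [hB]; ring
    calc (1 + ‖ξ‖) ^ (N + 1) * a = (1 + ‖ξ‖) ^ N * (a + ‖ξ‖ * a) := by ring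
      _ ≤ (1 + ‖ξ‖) ^ N * (a + ∑ j, |ξ j| * a) := by
          rw [← Finset.sum_mul]
          gcongr
          exact norm_le_sum_abs ξ
      _ = (1 + ‖ξ‖) ^ N * a + ∑ j, (1 + ‖ξ‖) ^ N * (|ξ j| * a) := by rw [mul_add, Finset.mul_sum]
      _ ≤ B * p f + ∑ j, B * (p (ι.testPartial j f) + D₁ j * p f) :=
          add_le_add (h0 f) (Finset.sum_le_sum fun j _ => hj j)
      _ = _ := by rw [← Finset.mul_sum, ← mul_add]

/-- For a test function, the local cosine coefficients decay rapidly. -/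
theorem IsAnalysis.exists_localCosine_le (hA : IsAnalysis ι χ A) (N : ℕ) :
    ∃ p : ι.TestSpace → ℝ, Continuous p ∧ p 0 = 0 ∧ (∀ f, 0 ≤ p f) ∧ ∀ (m : Fin n → ℤ) f,
      latticeWeight m ^ N * ‖A (localCosine m) (ι.testDeriv 0 f)‖ ≤ p f := by
  obtain ⟨L, h⟩ := hA.exists_modulateS_le
  obtain ⟨M, p, hp, hp0, hpn, h⟩ := h (N + L)
  set c := ((√2 / 2 : ℝ) : ℂ) ^ n with hc
  refine ⟨fun f => ‖c‖ * ∑ _ε : Fin n → Bool, 2 ^ N * (schwartzNorm M (bellS n) * p f),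
    continuous_const.mul (continuous_finsetSum _ fun _ _ =>
      continuous_const.mul (continuous_const.mul hp)), by simp [hp0], fun f => ?_, fun m f => ?_⟩
  · have := hpn f
    have := schwartzNorm_nonneg M (bellS n)
    positivity
  have h1 : A (localCosine m) (ι.testDeriv 0 f) =
      c • ∑ ε : Fin n → Bool, A (modulateS (localCosineFreq m ε) (bellS n)) (ι.testDeriv 0 f) := by
    change hA.linear (ι.testDeriv 0 f) _ = c • ∑ ε : Fin n → Bool, hA.linear (ι.testDeriv 0 f) _
    rw [localCosine, _root_.map_smul, _root_.map_sum]
  rw [h1, norm_smul, mul_left_comm]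
  change _ ≤ ‖c‖ * _
  gcongr
  refine (mul_le_mul_of_nonneg_left (norm_sum_le _ _) (pow_nonneg (latticeWeight_pos m).le N)).trans ?_
  rw [Finset.mul_sum]
  refine Finset.sum_le_sum fun ε _ => ?_
  have h2 := latticeWeight_le_one_add_norm_localCosineFreq m ε
  have h3 := h (localCosineFreq m ε) (bellS n) f
  have h4 := latticeWeight_pos m
  have h5 : 0 < 1 + ‖localCosineFreq m ε‖ := by positivity
  calc _ ≤ (2 * (1 + ‖localCosineFreq m ε‖)) ^ N *
        ‖A (modulateS (localCosineFreq m ε) (bellS n)) (ι.testDeriv 0 f)‖ := by gcongr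
    _ = 2 ^ N * ((1 + ‖localCosineFreq m ε‖) ^ N *
        ‖A (modulateS (localCosineFreq m ε) (bellS n)) (ι.testDeriv 0 f)‖) := by rw [mul_pow, mul_assoc]
    _ ≤ _ := by
        gcongr _ * ?_
        refine le_of_mul_le_mul_right ?_ (pow_pos h5 L)
        calc _ = (1 + ‖localCosineFreq m ε‖) ^ (N + L) *
              ‖A (modulateS (localCosineFreq m ε) (bellS n)) (ι.testDeriv 0 f)‖ := by
              rw [pow_add]; ring
          _ ≤ _ := h3.trans (le_of_eq (by ring))

end Analysis

section Synthesis

variable {S : 𝓢(Rn n, ℂ) → ι.DiscreteSpace χ →L[ℂ] E}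

theorem _root_.latticeWeight_pow_mem_polyGrowthWeights (n N : ℕ) :
    (fun m => latticeWeight m ^ N) ∈ polyGrowthWeights n :=
  ⟨N, 1, fun m => by rw [one_mul, abs_of_pos (pow_pos (latticeWeight_pos m) N)]⟩

/-- For windows `u m` of polynomial growth, `a ↦ ∑ₘ S_{u m} a_m` is a continuous operator on the
rapidly decreasing sequences. -/
theorem IsSynthesis.exists_clm_hasSum [CompleteSpace E] (hS : IsSynthesis ι χ S)
    {u : (Fin n → ℤ) → 𝓢(Rn n, ℂ)}
    (hu : ∀ N, ∃ (M : ℕ) (C : ℝ), 0 ≤ C ∧ ∀ m, schwartzNorm N (u m) ≤ C * latticeWeight m ^ M) :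
    ∃ T : WeightedSeq (polyGrowthWeights n) (ι.DiscreteSpace χ) →L[ℂ] E,
      ∀ a, HasSum (fun m => S (u m) (WeightedSeq.coord m a)) (T a) := by
  obtain ⟨M, C, hC, hSn⟩ := hS.bound
  obtain ⟨L, D, hD, hu⟩ := hu M
  set r : polyGrowthWeights n := ⟨_, latticeWeight_pow_mem_polyGrowthWeights n (2 * n + L)⟩ with hr
  have key : ∀ a : WeightedSeq (polyGrowthWeights n) (ι.DiscreteSpace χ),
      (Summable fun m => ‖S (u m) (WeightedSeq.coord m a)‖) ∧
      ∑' m, ‖S (u m) (WeightedSeq.coord m a)‖ ≤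
        C * D * WeightedSeq.seminorm r a * ∑' m : Fin n → ℤ, (latticeWeight m ^ (2 * n))⁻¹ := by
    intro a
    refine summable_of_latticeWeight_pow_mul_le (fun _ => norm_nonneg _) fun m => ?_
    have h0 := latticeWeight_pos m
    calc latticeWeight m ^ (2 * n) * ‖S (u m) (WeightedSeq.coord m a)‖
        ≤ latticeWeight m ^ (2 * n) * (C * (D * latticeWeight m ^ L) * ‖WeightedSeq.coord m a‖) := by
          gcongr
          refine (hSn _ _).trans ?_
          gcongr
          exact hu m
      _ = C * D * (latticeWeight m ^ (2 * n + L) * ‖WeightedSeq.coord m a‖) := by rw [pow_add]; ring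
      _ ≤ C * D * WeightedSeq.seminorm r a := by
          gcongr
          refine le_trans (le_of_eq ?_) (WeightedSeq.mul_norm_coord_le_seminorm a r m)
          rw [hr, abs_of_pos (pow_pos h0 _)]
  have hs : ∀ a, Summable fun m => S (u m) (WeightedSeq.coord m a) := fun a => (key a).1.of_norm
  let T : WeightedSeq (polyGrowthWeights n) (ι.DiscreteSpace χ) →ₗ[ℂ] E :=
    { toFun := fun a => ∑' m, S (u m) (WeightedSeq.coord m a)
      map_add' := fun a b => by
        rw [← (hs a).tsum_add (hs b)]
        exact tsum_congr fun m => by rw [map_add, map_add]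
      map_smul' := fun z a => by
        rw [RingHom.id_apply, ← (hs a).tsum_const_smul]
        exact tsum_congr fun m => by rw [map_smul, map_smul] }
  refine ⟨⟨T, ?_⟩, fun a => (hs a).hasSum⟩
  have hw : 0 ≤ ∑' k : Fin n → ℤ, (latticeWeight k ^ (2 * n))⁻¹ :=
    tsum_nonneg fun k => inv_nonneg.2 (pow_nonneg (latticeWeight_pos k).le _)
  refine WithSeminorms.continuous_normedSpace_rng E WeightedSeq.withSeminorms T
    ⟨{r}, ⟨C * D * ∑' k : Fin n → ℤ, (latticeWeight k ^ (2 * n))⁻¹, by positivity⟩, fun a => ?_⟩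
  rw [Finset.sup_singleton]
  change ‖∑' m, S (u m) (WeightedSeq.coord m a)‖ ≤
    (C * D * ∑' k : Fin n → ℤ, (latticeWeight k ^ (2 * n))⁻¹) * WeightedSeq.seminorm r a
  exact (norm_tsum_le_tsum_norm (key a).1).trans ((key a).2.trans (le_of_eq (by ring)))

end Synthesis

/-- The local cosine expansion identifies `D_E` with the rapidly decreasing sequences in `E_d`. -/
theorem nonempty_testSpace_equiv [CompleteSpace E] (hι : IsConvModBounded ι)
    (hχ : ∃ η : 𝓢(Rn n, ℂ), ∀ k l : Fin n → ℤ,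
      schwartzToDist (latticeShift k χ) (latticeShift l η) = if k = l then 1 else 0) :
    Nonempty (ι.TestSpace ≃L[ℂ] WeightedSeq (polyGrowthWeights n) (ι.DiscreteSpace χ)) := by
  obtain ⟨A, hA⟩ := exists_isAnalysis hι χ
  obtain ⟨S, hS⟩ := exists_isSynthesis hι hχ
  let ana : ι.TestSpace →ₗ[ℂ] WeightedSeq (polyGrowthWeights n) (ι.DiscreteSpace χ) :=
    { toFun := fun f => WeightedSeq.mk (fun m => A (localCosine m) (ι.testDeriv 0 f)) (by
        rintro r ⟨N, C, hr⟩
        obtain ⟨p, -, -, -, hp⟩ := hA.exists_localCosine_le N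
        have hC : 0 ≤ C := by
          have := (abs_nonneg _).trans (hr 0)
          exact nonneg_of_mul_nonneg_left this (pow_pos (latticeWeight_pos 0) N)
        refine ⟨C * p f, fun m => ?_⟩
        calc |r m| * _ ≤ C * latticeWeight m ^ N * ‖A (localCosine m) (ι.testDeriv 0 f)‖ := by
              gcongr
              exact hr m
          _ ≤ _ := by rw [mul_assoc]; gcongr; exact hp m f)
      map_add' := fun f g => WeightedSeq.ext_coord fun m =>
        map_add ((A (localCosine m)).toLinearMap ∘ₗ ι.testDerivLinear 0) f g
      map_smul' := fun z f => WeightedSeq.ext_coord fun m =>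
        map_smul ((A (localCosine m)).toLinearMap ∘ₗ ι.testDerivLinear 0) z f }
  have hana : ∀ f m k, (WeightedSeq.coord m (ana f)).1 k = f.1 (latticeShift k (localCosine m)) := by
    intro f m k
    change (A (localCosine m) (ι.testDeriv 0 f)).1 k = _
    rw [hA.coeff, toDist_testDeriv_zero]
  have hderiv : ∀ (α : Fin n → ℕ) (N : ℕ), ∃ (M : ℕ) (C : ℝ), 0 ≤ C ∧
      ∀ m, schwartzNorm N (derivS α (localCosine m)) ≤ C * latticeWeight m ^ M := by
    intro α N
    obtain ⟨M₁, C₁, hC₁, h₁⟩ := exists_schwartzNorm_map_le (derivS α) N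
    obtain ⟨M₂, C₂, hC₂, h₂⟩ := exists_schwartzNorm_localCosine_le n M₁
    refine ⟨M₂, C₁ * C₂, by positivity, fun m => (h₁ _).trans ?_⟩
    rw [mul_assoc]
    gcongr
    exact h₂ m
  choose T hT using fun α => hS.exists_clm_hasSum (hderiv α)
  have hTι : ∀ α a, HasSum (fun m => ι.toDist (S (derivS α (localCosine m)) (WeightedSeq.coord m a)))
      (ι.toDist (T α a)) := fun α a => (hT α a).mapL ι.toDist
  have hTα : ∀ α a, derivD α (ι.toDist (T 0 a)) = ι.toDist (T α a) := by
    intro α a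
    refine ((hTι 0 a).mapL (derivD α)).unique (hasSum_of_eq (fun m => ?_) (hTι α a))
    refine ((hS.hasSum _ _).mapL (derivD α)).unique (hasSum_of_eq (fun k => ?_) (hS.hasSum _ _))
    rw [map_smul, derivD_schwartzToDist, derivS_translateS, derivS_zero]
  let syn : WeightedSeq (polyGrowthWeights n) (ι.DiscreteSpace χ) → ι.TestSpace := fun a =>
    ⟨ι.toDist (T 0 a), (Submodule.mem_iInf _).2 fun α => ⟨T α a, (hTα α a).symm⟩⟩
  have hright : ∀ a, ana (syn a) = a := by
    intro a
    refine WeightedSeq.ext_coord fun m => Subtype.ext (funext fun k => ?_)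
    rw [hana]
    refine hS.coeff_eq (a := fun m => WeightedSeq.coord m a) ?_ m k
    have := hTι 0 a
    simpa only [derivS_zero] using this
  have hinj : Function.Injective ana := by
    intro f g hfg
    refine Subtype.ext (dist_ext_localCosine fun m k => ?_)
    rw [← hana, ← hana, hfg]
  have hanac : Continuous ana := by
    refine continuous_of_continuousAt_zero ana ?_
    rw [ContinuousAt, map_zero, WeightedSeq.withSeminorms.tendsto_nhds]
    rintro ⟨r, N, C, hr⟩ ε hε
    obtain ⟨p, hp, hp0, hpn, hpm⟩ := hA.exists_localCosine_le N
    have hC : 0 ≤ C := by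
      have := (abs_nonneg _).trans (hr 0)
      exact nonneg_of_mul_nonneg_left this (pow_pos (latticeWeight_pos 0) N)
    have hev : ∀ᶠ f in 𝓝 (0 : ι.TestSpace), C * p f < ε :=
      (continuous_const.mul hp).continuousAt.eventually_lt continuousAt_const (by simpa [hp0] using hε)
    filter_upwards [hev] with f hf
    rw [sub_zero]
    refine (WeightedSeq.seminorm_le (mul_nonneg hC (hpn f)) fun m => ?_).trans_lt hf
    calc |r m| * ‖A (localCosine m) (ι.testDeriv 0 f)‖
        ≤ C * latticeWeight m ^ N * ‖A (localCosine m) (ι.testDeriv 0 f)‖ := by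
          gcongr
          exact hr m
      _ ≤ _ := by rw [mul_assoc]; gcongr; exact hpm m f
  have hsync : Continuous syn := by
    refine continuous_iInf_rng.2 fun α => continuous_induced_rng.2 ?_
    have : ι.testDeriv α ∘ syn = T α := by
      funext a
      refine ι.injective ?_
      rw [Function.comp_apply, toDist_testDeriv]
      exact hTα α a
    rw [this]
    exact (T α).continuous
  exact ⟨{ LinearEquiv.ofBijective ana ⟨hinj, fun a => ⟨syn a, hright a⟩⟩ with
    continuous_toFun := hanac
    continuous_invFun := by
      refine hsync.congr fun a => hinj ?_
      rw [hright]
      exact ((LinearEquiv.ofBijective ana ⟨hinj, fun a => ⟨syn a, hright a⟩⟩).apply_symm_apply a).symm }⟩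

end DistInclusion

/-! ### The distribution space as a space of sequences -/

section RapidBounds

variable {n : ℕ}

/-- A family that is rapidly decreasing, locally uniformly in a parameter, is dominated by a rapidly
decreasing weight. -/
theorem exists_rapidDecayWeights_ge {J : Type*} {g : (Fin n → ℤ) → J → ℝ} (hg0 : ∀ m j, 0 ≤ g m j)
    (hg : ∀ N, ∃ C, 0 ≤ C ∧ ∀ m j, latticeWeight m ^ N * g m j ≤ C) (K : ℕ) :
    ∃ r ∈ rapidDecayWeights n, (∀ m, 0 ≤ r m) ∧ ∀ m j, latticeWeight m ^ K * g m j ≤ r m := by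
  refine ⟨fun m => ⨆ j, latticeWeight m ^ K * g m j, fun N => ?_, fun m => ?_, fun m j => ?_⟩
  · obtain ⟨C, hC, h⟩ := hg (N + K)
    refine ⟨C, fun m => ?_⟩
    have h0 := latticeWeight_pos m
    rw [abs_of_nonneg (Real.iSup_nonneg fun j => mul_nonneg (pow_pos h0 K).le (hg0 m j)),
      Real.mul_iSup_of_nonneg (pow_pos h0 N).le]
    refine Real.iSup_le (fun j => ?_) hC
    rw [← mul_assoc, ← pow_add]
    exact h m j
  · exact Real.iSup_nonneg fun j => mul_nonneg (pow_pos (latticeWeight_pos m) K).le (hg0 m j)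
  · obtain ⟨C, hC, h⟩ := hg K
    exact le_ciSup (f := fun j => latticeWeight m ^ K * g m j) ⟨C, by rintro _ ⟨j, rfl⟩; exact h m j⟩ j

theorem exists_rapidDecayWeights_convS {u : (Fin n → ℤ) → 𝓢(Rn n, ℂ)}
    (hu : ∀ K N, ∃ (M : ℕ) (C : ℝ), 0 ≤ C ∧ ∀ (m : Fin n → ℤ) (g : 𝓢(Rn n, ℂ)),
      latticeWeight m ^ K * schwartzNorm N (convS (u m) g) ≤ C * schwartzNorm M g)
    {B : Set 𝓢(Rn n, ℂ)} (hB : Bornology.IsVonNBounded ℂ B) (K M : ℕ) :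
    ∃ r ∈ rapidDecayWeights n, (∀ m, 0 ≤ r m) ∧
      ∀ m, ∀ θ ∈ B, latticeWeight m ^ K * schwartzNorm M (convS (u m) θ) ≤ r m := by
  obtain ⟨r, hr, hr0, h⟩ := exists_rapidDecayWeights_ge (J := B)
    (g := fun m θ => schwartzNorm M (convS (u m) θ.1)) (fun m θ => schwartzNorm_nonneg _ _)
    (fun N => by
      obtain ⟨M', C, hC, h⟩ := hu N M
      obtain ⟨D, hD⟩ := isVonNBounded_iff_schwartzNorm.1 hB M'
      refine ⟨C * max D 0, mul_nonneg hC (le_max_right _ _), fun m θ => (h m θ.1).trans ?_⟩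
      gcongr
      exact (hD θ.1 θ.2).trans (le_max_left _ _)) K
  exact ⟨r, hr, hr0, fun m θ hθ => h m ⟨θ, hθ⟩⟩

end RapidBounds

namespace DistInclusion

variable {n : ℕ} {E : Type*} [NormedAddCommGroup E] [NormedSpace ℂ E]
  {ι : DistInclusion n E} {χ : 𝓢(Rn n, ℂ)}

theorem distConv_sub (f g : ι.DistSpace) (θ : 𝓢(Rn n, ℂ)) :
    ι.distConv (f - g) θ = ι.distConv f θ - ι.distConv g θ :=
  ι.injective (by
    rw [map_sub, toDist_distConv, toDist_distConv, toDist_distConv]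
    exact map_sub (convD θ) f.1 g.1)

/-- The seminorms `f ↦ sup_{θ ∈ B} ‖f * θ‖` are continuous. -/
theorem eventually_norm_distConv_sub_lt {B : Set 𝓢(Rn n, ℂ)} (hB : Bornology.IsVonNBounded ℂ B)
    (g : ι.DistSpace) {ε : ℝ} (hε : 0 < ε) :
    ∀ᶠ f in 𝓝 g, ∀ θ ∈ B, ‖ι.distConv f θ - ι.distConv g θ‖ < ε := by
  have h1 : Continuous fun f : ι.DistSpace =>
      UniformOnFun.ofFun {B : Set 𝓢(Rn n, ℂ) | Bornology.IsVonNBounded ℂ B} (ι.distConv f) :=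
    continuous_induced_dom
  have h2 := UniformOnFun.tendsto_iff_tendstoUniformlyOn.1 (h1.tendsto g) B hB
  filter_upwards [Metric.tendstoUniformlyOn_iff.1 h2 ε hε] with f hf θ hθ
  have := hf θ hθ
  rw [dist_eq_norm, norm_sub_rev] at this
  exact this

theorem continuous_to_distSpace {T : Type*} [TopologicalSpace T] {F : T → ι.DistSpace}
    (h : ∀ B : Set 𝓢(Rn n, ℂ), Bornology.IsVonNBounded ℂ B → ∀ t, ∀ ε > 0,
      ∀ᶠ s in 𝓝 t, ∀ θ ∈ B, ‖ι.distConv (F s) θ - ι.distConv (F t) θ‖ < ε) : Continuous F := by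
  refine continuous_induced_rng.2 (continuous_iff_continuousAt.2 fun t => ?_)
  refine UniformOnFun.tendsto_iff_tendstoUniformlyOn.2 fun B hB => ?_
  rw [Metric.tendstoUniformlyOn_iff]
  intro ε hε
  filter_upwards [h B hB t ε hε] with s hs θ hθ
  rw [dist_eq_norm, norm_sub_rev]
  exact hs θ hθ

/-- The local cosine coefficients of `f ∈ D'_E` are of at most polynomial growth, in terms of the
seminorms of `D'_E`. -/
theorem exists_localCosine_coeff_bound [CompleteSpace E] (hι : IsConvModBounded ι) (χ : 𝓢(Rn n, ℂ)) :
    ∃ (c : (Fin n → ℤ) → ι.DistSpace → ι.DiscreteSpace χ),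
      (∀ m f k, (c m f).1 k = f.1 (latticeShift k (localCosine m))) ∧
      ∀ r ∈ rapidDecayWeights n, ∃ (B : Set 𝓢(Rn n, ℂ)) (C : ℝ), Bornology.IsVonNBounded ℂ B ∧ 0 ≤ C ∧
        ∀ f A, (∀ θ ∈ B, ‖ι.distConv f θ‖ ≤ A) → ∀ m, |r m| * ‖c m f‖ ≤ C * A := by
  obtain ⟨K, C, hC, h⟩ := exists_analysis_distSpace hι χ
  choose c hc hcn using fun m : Fin n → ℤ => h (localCosine m)
  refine ⟨c, hc, fun r hr => ?_⟩
  set ω : (Fin n → ℤ) → (Fin n → ℤ) → 𝓢(Rn n, ℂ) := fun m j =>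
    convS (reflectS (localCosine m)) (modulateS (-latticePt j) χ) with hω
  refine ⟨Set.range fun p : (Fin n → ℤ) × (Fin n → ℤ) =>
    ((|r p.1| * latticeWeight p.2 ^ K : ℝ) : ℂ) • ω p.1 p.2, C, ?_, hC, fun f A hA m => ?_⟩
  · rw [isVonNBounded_iff_schwartzNorm]
    intro N
    obtain ⟨M, D, hD, hconv⟩ := exists_schwartzNorm_convS_modulateS_le n K N
    obtain ⟨M₁, D₁, hD₁, hrefl⟩ := exists_schwartzNorm_map_le (reflectS (n := n)) M
    obtain ⟨L, D₂, hD₂, hw⟩ := exists_schwartzNorm_localCosine_le n M₁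
    obtain ⟨D₃, hr⟩ := hr L
    refine ⟨D * schwartzNorm M χ * (D₁ * (D₂ * D₃)), ?_⟩
    rintro _ ⟨⟨m, j⟩, rfl⟩
    have h1 := hconv (-latticePt j) χ (reflectS (localCosine m))
    rw [norm_neg, convS_comm] at h1
    have h2 := schwartzNorm_nonneg M χ
    have h3 : 0 ≤ |r m| := abs_nonneg _
    have h4 := latticeWeight_pos j
    change schwartzNorm N (((|r m| * latticeWeight j ^ K : ℝ) : ℂ) • ω m j) ≤ _
    rw [map_smul_eq_mul, Complex.norm_real, Real.norm_eq_abs, abs_of_nonneg (by positivity), mul_assoc]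
    calc |r m| * (latticeWeight j ^ K * schwartzNorm N (ω m j))
        ≤ |r m| * (D * schwartzNorm M χ * (D₁ * (D₂ * latticeWeight m ^ L))) := by
          gcongr _ * ?_
          refine h1.trans ?_
          gcongr _ * ?_
          refine (hrefl _).trans ?_
          gcongr _ * ?_
          exact hw m
      _ = D * schwartzNorm M χ * (D₁ * (D₂ * (latticeWeight m ^ L * |r m|))) := by ring
      _ ≤ _ := by gcongr; exact hr m
  · rcases (abs_nonneg (r m)).eq_or_lt with h0 | h0
    · rw [← h0, zero_mul]
      exact mul_nonneg hC ((norm_nonneg _).trans (hA _ ⟨(m, 0), rfl⟩))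
    rw [← le_div_iff₀' h0, mul_div_assoc]
    refine hcn m f (A / |r m|) fun j => ?_
    have h1 := hA _ ⟨(m, j), rfl⟩
    have h4 := latticeWeight_pos j
    have h2 : ι.distConv f (((|r m| * latticeWeight j ^ K : ℝ) : ℂ) • ω m j) =
        ((|r m| * latticeWeight j ^ K : ℝ) : ℂ) • ι.distConv f (ω m j) := by
      refine ι.injective ?_
      ext ρ
      rw [map_smul, toDist_distConv, toDist_distConv]
      change convD _ f.1 ρ = _ * convD _ f.1 ρ
      rw [convD_apply, convD_apply, convS_comm, map_smul, map_smul, convS_comm, dist_map_smul]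
    change ‖ι.distConv f (((|r m| * latticeWeight j ^ K : ℝ) : ℂ) • ω m j)‖ ≤ A at h1
    rw [h2, norm_smul, Complex.norm_real, Real.norm_eq_abs, abs_of_nonneg (by positivity), mul_assoc] at h1
    rwa [le_div_iff₀' h0]

/-- The local cosine expansion identifies `D'_E` with the sequences of polynomial growth in `E_d`. -/
theorem nonempty_distSpace_equiv [CompleteSpace E] (hι : IsConvModBounded ι)
    (hχ : ∃ η : 𝓢(Rn n, ℂ), ∀ k l : Fin n → ℤ,
      schwartzToDist (latticeShift k χ) (latticeShift l η) = if k = l then 1 else 0) :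
    Nonempty (ι.DistSpace ≃L[ℂ] WeightedSeq (rapidDecayWeights n) (ι.DiscreteSpace χ)) := by
  obtain ⟨c, hc, hcb⟩ := exists_localCosine_coeff_bound hι χ
  obtain ⟨S, hS⟩ := exists_isSynthesis hι hχ
  obtain ⟨M, C, hC, hSn⟩ := hS.bound
  obtain ⟨M₀, C₀, hC₀, hpair⟩ := exists_norm_toDist_apply_le ι
  obtain ⟨η, hη⟩ := hχ
  obtain ⟨M₁, C₁, hC₁, hlat⟩ := exists_schwartzNorm_latticeConv_le n M₀
  set W := ∑' k : Fin n → ℤ, (latticeWeight k ^ (2 * n))⁻¹ with hW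
  have hW0 : 0 ≤ W := tsum_nonneg fun k => inv_nonneg.2 (pow_nonneg (latticeWeight_pos k).le _)
  -- the analysis map
  let ana : ι.DistSpace →ₗ[ℂ] WeightedSeq (rapidDecayWeights n) (ι.DiscreteSpace χ) :=
    { toFun := fun f => WeightedSeq.mk (fun m => c m f) (fun r hr => by
        obtain ⟨B, D, hB, hD, h⟩ := hcb r hr
        obtain ⟨N, D', hD', hf⟩ := exists_distConv_bound ι f
        obtain ⟨D'', hBN⟩ := isVonNBounded_iff_schwartzNorm.1 hB N
        refine ⟨D * (D' * D''), h f _ fun θ hθ => (hf θ).trans ?_⟩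
        gcongr
        exact hBN θ hθ)
      map_add' := fun f g => WeightedSeq.ext_coord fun m => Subtype.ext (funext fun k => by
        change (c m (f + g)).1 k = (c m f).1 k + (c m g).1 k
        rw [hc, hc, hc]
        rfl)
      map_smul' := fun z f => WeightedSeq.ext_coord fun m => Subtype.ext (funext fun k => by
        change (c m (z • f)).1 k = z * (c m f).1 k
        rw [hc, hc]
        rfl) }
  have hana : ∀ f m k, (WeightedSeq.coord m (ana f)).1 k = f.1 (latticeShift k (localCosine m)) :=
    fun f m k => hc m f k
  -- the functional `ρ ↦ ∑ₘ ⟨S_{w_m} a_m, ρ⟩`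
  have hpairB : ∀ (a : WeightedSeq (rapidDecayWeights n) (ι.DiscreteSpace χ)) (B : Set 𝓢(Rn n, ℂ)),
      Bornology.IsVonNBounded ℂ B → ∃ D, ∀ ρ ∈ B,
        (Summable fun m => ‖ι.toDist (S (localCosine m) (WeightedSeq.coord m a)) ρ‖) ∧
        ∑' m, ‖ι.toDist (S (localCosine m) (WeightedSeq.coord m a)) ρ‖ ≤ D := by
    intro a B hB
    obtain ⟨r, hr, hr0, h⟩ := exists_rapidDecayWeights_convS
      (exists_schwartzNorm_convS_reflectS_localCosine_le n) hB (2 * n) M₁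
    refine ⟨C₀ * C₁ * schwartzNorm M₁ η * WeightedSeq.seminorm ⟨r, hr⟩ a * W, fun ρ hρ => ?_⟩
    refine summable_of_latticeWeight_pow_mul_le (fun _ => norm_nonneg _) fun m => ?_
    have h0 := latticeWeight_pos m
    have h1 := schwartzNorm_nonneg M₁ η
    rw [hS.toDist_apply hη]
    calc _ ≤ latticeWeight m ^ (2 * n) * (C₀ * (C₁ * schwartzNorm M₁ η *
          schwartzNorm M₁ (convS (reflectS (localCosine m)) ρ)) * ‖WeightedSeq.coord m a‖) := by
          gcongr _ * ?_
          refine (hpair _ _).trans ?_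
          rw [norm_discreteSynthesis]
          gcongr
          exact hlat _ _
      _ = C₀ * C₁ * schwartzNorm M₁ η * ((latticeWeight m ^ (2 * n) *
          schwartzNorm M₁ (convS (reflectS (localCosine m)) ρ)) * ‖WeightedSeq.coord m a‖) := by ring
      _ ≤ C₀ * C₁ * schwartzNorm M₁ η * (r m * ‖WeightedSeq.coord m a‖) := by
          gcongr
          exact h m ρ hρ
      _ ≤ _ := by
          gcongr
          refine le_trans (le_of_eq ?_) (WeightedSeq.mul_norm_coord_le_seminorm a ⟨r, hr⟩ m)
          rw [abs_of_nonneg (hr0 m)]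
  have hsum : ∀ (a : WeightedSeq (rapidDecayWeights n) (ι.DiscreteSpace χ)) (ρ : 𝓢(Rn n, ℂ)),
      Summable fun m => ι.toDist (S (localCosine m) (WeightedSeq.coord m a)) ρ := by
    intro a ρ
    obtain ⟨D, h⟩ := hpairB a {ρ} (Bornology.isVonNBounded_singleton ρ)
    exact (h ρ rfl).1.of_norm
  have hF : ∀ a : WeightedSeq (rapidDecayWeights n) (ι.DiscreteSpace χ), ∃ f : 𝓢'(Rn n, ℂ),
      HasSum (fun m => ι.toDist (S (localCosine m) (WeightedSeq.coord m a))) f := by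
    intro a
    let F : 𝓢(Rn n, ℂ) →ₗ[ℂ] ℂ :=
      { toFun := fun ρ => ∑' m, ι.toDist (S (localCosine m) (WeightedSeq.coord m a)) ρ
        map_add' := fun ρ σ => by
          rw [← (hsum a ρ).tsum_add (hsum a σ)]
          exact tsum_congr fun m => map_add (ι.toDist _) ρ σ
        map_smul' := fun z ρ => by
          rw [RingHom.id_apply, ← (hsum a ρ).tsum_const_smul]
          exact tsum_congr fun m => dist_map_smul _ z ρ }
    have hFc : Continuous F := by
      refine LinearMap.continuous_of_locally_bounded F fun B hB => ?_
      rw [NormedSpace.isVonNBounded_iff]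
      obtain ⟨D, h⟩ := hpairB a B hB
      refine isBounded_iff_forall_norm_le.2 ⟨D, ?_⟩
      rintro _ ⟨ρ, hρ, rfl⟩
      exact (norm_tsum_le_tsum_norm (h ρ hρ).1).trans (h ρ hρ).2
    exact ⟨(⟨F, hFc⟩ : 𝓢(Rn n, ℂ) →L[ℂ] ℂ), hasSum_dist_iff.2 fun ρ => (hsum a ρ).hasSum⟩
  choose F hF using hF
  -- the convolutions `∑ₘ S_{w_m * θ} a_m`
  have hconvB : ∀ (B : Set 𝓢(Rn n, ℂ)), Bornology.IsVonNBounded ℂ B →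
      ∃ r : rapidDecayWeights n, ∀ (a : WeightedSeq (rapidDecayWeights n) (ι.DiscreteSpace χ)), ∀ θ ∈ B,
        (Summable fun m => ‖S (convS (localCosine m) θ) (WeightedSeq.coord m a)‖) ∧
        ∑' m, ‖S (convS (localCosine m) θ) (WeightedSeq.coord m a)‖ ≤
          C * WeightedSeq.seminorm r a * W := by
    intro B hB
    obtain ⟨r, hr, hr0, h⟩ := exists_rapidDecayWeights_convS
      (exists_schwartzNorm_convS_localCosine_le n) hB (2 * n) M
    refine ⟨⟨r, hr⟩, fun a θ hθ => ?_⟩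
    refine summable_of_latticeWeight_pow_mul_le (fun _ => norm_nonneg _) fun m => ?_
    have h0 := latticeWeight_pos m
    calc _ ≤ latticeWeight m ^ (2 * n) * (C * schwartzNorm M (convS (localCosine m) θ) *
          ‖WeightedSeq.coord m a‖) := by gcongr; exact hSn _ _
      _ = C * ((latticeWeight m ^ (2 * n) * schwartzNorm M (convS (localCosine m) θ)) *
          ‖WeightedSeq.coord m a‖) := by ring
      _ ≤ C * (r m * ‖WeightedSeq.coord m a‖) := by
          gcongr
          exact h m θ hθ
      _ ≤ _ := by
          gcongr
          refine le_trans (le_of_eq ?_) (WeightedSeq.mul_norm_coord_le_seminorm a ⟨r, hr⟩ m)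
          rw [abs_of_nonneg (hr0 m)]
  have hconv : ∀ (a : WeightedSeq (rapidDecayWeights n) (ι.DiscreteSpace χ)) (θ : 𝓢(Rn n, ℂ)),
      Summable fun m => S (convS (localCosine m) θ) (WeightedSeq.coord m a) := by
    intro a θ
    obtain ⟨r, h⟩ := hconvB {θ} (Bornology.isVonNBounded_singleton θ)
    exact (h a θ rfl).1.of_norm
  have hconvF : ∀ a θ, ι.toDist (∑' m, S (convS (localCosine m) θ) (WeightedSeq.coord m a)) =
      convD θ (F a) := by
    intro a θ
    refine ((hconv a θ).hasSum.mapL ι.toDist).unique (hasSum_of_eq (fun m => ?_) ((hF a).mapL (convD θ)))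
    refine (hS.hasSum _ _).unique (hasSum_of_eq (fun k => ?_) ((hS.hasSum _ _).mapL (convD θ)))
    have h : latticeShift k (convS (localCosine m) θ) = convS θ (latticeShift k (localCosine m)) := by
      rw [convS_comm, latticeShift, translateS_convS]
    rw [map_smul, convD_schwartzToDist, h]
  let syn : WeightedSeq (rapidDecayWeights n) (ι.DiscreteSpace χ) → ι.DistSpace := fun a =>
    ⟨F a, (Submodule.mem_iInf _).2 fun θ => ⟨_, hconvF a θ⟩⟩
  have hsyn : ∀ a θ, ι.distConv (syn a) θ =
      ∑' m, S (convS (localCosine m) θ) (WeightedSeq.coord m a) := fun a θ =>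
    ι.injective (by rw [toDist_distConv, hconvF])
  have hright : ∀ a, ana (syn a) = a := by
    intro a
    refine WeightedSeq.ext_coord fun m => Subtype.ext (funext fun k => ?_)
    rw [hana]
    exact hS.coeff_eq (a := fun m => WeightedSeq.coord m a) (hF a) m k
  have hinj : Function.Injective ana := by
    intro f g hfg
    refine Subtype.ext (dist_ext_localCosine fun m k => ?_)
    rw [← hana, ← hana, hfg]
  have hanac : Continuous ana := by
    refine continuous_iff_continuousAt.2 fun g => ?_
    rw [ContinuousAt, WeightedSeq.withSeminorms.tendsto_nhds]
    rintro ⟨r, hr⟩ ε hε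
    obtain ⟨B, D, hB, hD, h⟩ := hcb r hr
    have hδ : 0 < ε / (D + 1) := by positivity
    filter_upwards [eventually_norm_distConv_sub_lt hB g hδ] with f hf
    rw [← map_sub]
    refine (WeightedSeq.seminorm_le (C := D * (ε / (D + 1))) (by positivity) fun m => ?_).trans_lt ?_
    · refine h (f - g) _ (fun θ hθ => ?_) m
      rw [distConv_sub]
      exact (hf θ hθ).le
    · rw [← mul_div_assoc, div_lt_iff₀ (by positivity)]
      nlinarith
  have hsync : Continuous syn := by
    refine continuous_to_distSpace fun B hB a ε hε => ?_
    obtain ⟨r, h⟩ := hconvB B hB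
    have hδ : 0 < ε / (C * W + 1) := by positivity
    have hev := (WeightedSeq.withSeminorms (R := rapidDecayWeights n) (B := ι.DiscreteSpace χ)).tendsto_nhds
      id a |>.1 tendsto_id r _ hδ
    filter_upwards [hev] with b hb θ hθ
    have h1 : ι.distConv (syn b) θ - ι.distConv (syn a) θ =
        ∑' m, S (convS (localCosine m) θ) (WeightedSeq.coord m (b - a)) := by
      rw [hsyn, hsyn, ← (hconv b θ).tsum_sub (hconv a θ)]
      exact tsum_congr fun m => by rw [map_sub, map_sub]
    rw [h1]
    obtain ⟨h2, h3⟩ := h (b - a) θ hθ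
    refine ((norm_tsum_le_tsum_norm h2).trans h3).trans_lt ?_
    rw [id, lt_div_iff₀ (by positivity)] at hb
    have := apply_nonneg (WeightedSeq.seminorm (B := ι.DiscreteSpace χ) r) (b - a)
    nlinarith
  exact ⟨{ LinearEquiv.ofBijective ana ⟨hinj, fun a => ⟨syn a, hright a⟩⟩ with
    continuous_toFun := hanac
    continuous_invFun := by
      refine hsync.congr fun a => hinj ?_
      rw [hright]
      exact ((LinearEquiv.ofBijective ana ⟨hinj, fun a => ⟨syn a, hright a⟩⟩).apply_symm_apply a).symm }⟩

end DistInclusion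

/-! ### The tensor product representations -/

theorem theorem4p1 (n : ℕ) {E : Type*} [NormedAddCommGroup E] [NormedSpace ℂ E] [CompleteSpace E]
    (ι : DistInclusion n E) (hE : IsTMIB ι ∨ IsDTMIB ι)
    (U : Set (Rn n)) (χ : 𝓢(Rn n, ℂ)) (hχ : IsDiscreteWindow U χ) :
    (Nonempty (ι.TestSpace ≃L[ℂ] CompletedProjTensor (ι.DiscreteSpace χ) (RapidSeq n)) ∧
      Nonempty (ι.TestSpace ≃L[ℂ] CompletedInjTensor (ι.DiscreteSpace χ) (RapidSeq n))) ∧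
    (Nonempty (ι.DistSpace ≃L[ℂ] CompletedProjTensor (ι.DiscreteSpace χ) (SlowSeq n)) ∧
      Nonempty (ι.DistSpace ≃L[ℂ] CompletedInjTensor (ι.DiscreteSpace χ) (SlowSeq n))) := by
  have hι : IsConvModBounded ι := hE.elim IsTMIB.isConvModBounded IsDTMIB.isConvModBounded
  have hη := hχ.exists_dual
  have := DistInclusion.t0Space_discreteSpace (ι := ι) hη
  have := DistInclusion.completeSpace_discreteSpace hι hη
  obtain ⟨e⟩ := DistInclusion.nonempty_testSpace_equiv hι hη
  obtain ⟨e'⟩ := DistInclusion.nonempty_distSpace_equiv hι hη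
  have hs := RapidSeq.isNuclearSeqSpace n
  have hs' := SlowSeq.isNuclearSeqSpace n
  exact ⟨⟨hs.nonempty_equiv_completedProjTensor.map e.trans,
    hs.nonempty_equiv_completedInjTensor.map e.trans⟩,
    hs'.nonempty_equiv_completedProjTensor.map e'.trans,
    hs'.nonempty_equiv_completedInjTensor.map e'.trans⟩
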